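/- **Setting.** Workers are the vertices $V$ of a finite undirected graph; $V_R\subseteq V$ is the set of regular workers, $n=|V_R|$, and the other workers $V_B$ are Byzantine. The subgraph induced by $V_R$ is connected. Each $i\in V_R$ has mixing weights $W_{ij}\ge 0$ ($j\in V$) with $\sum_{j\in V}W_{ij}=1$, $W_{ij}>0$ if and only if $j=i$ or $j$ is a neighbour of $i$, and $W_{ij}=W_{ji}$ for $i,j\in V_R$. Let $\delta_i=\sum_{j\in V_B}W_{ij}$, $\delta_{\max}=\max_{i\in V_R}\delta_i$, let $\widetilde W\in\mathbb R^{V_R\times V_R}$ be given by $\widetilde W_{ij}=W_{ij}$ for $i\ne j$ and $\widetilde W_{ii}=W_{ii}+\delta_i$, and let $\gamma=1-\|\widetilde W-\frac1n\mathbf 1\mathbf 1^\top\|_2$ be its spectral gap. The objective is $f=\frac1n\sum_{i\in V_R}f_i$ on $\mathbb R^d$, with $f^\star=\inf f>-\infty$. For $i\in V_R$ the function $f_i$ is differentiable and $\nabla f_i$ is $L$-Lipschitz, $L>0$; the stochastic gradients $g_i(x;\xi)$, $\xi\sim\mathcal D_i$, satisfy $\mathbb E\,g_i(x;\xi)=\nabla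 f_i(x)$ and $\mathbb E\|g_i(x;\xi)-\nabla f_i(x)\|^2\le\sigma^2$ for all $x$; and $\frac1n\sum_{i\in V_R}\|\nabla f_i(x)-\nabla f(x)\|^2\le\zeta^2$ for all $x$. **Algorithm (ClippedGossip).** With momentum $\alpha$ and step size $\eta$, start from $x_i^0=x^0$, $m_i^0=0$, and for $t\ge 0$, $i\in V_R$ put $$m_i^{t+1}=(1-\alpha)m_i^t+\alpha g_i(x_i^t;\xi_i^t),\quad x_i^{t+1/2}=x_i^t-\eta m_i^{t+1},$$ $$z_{j\to i}^{t+1}=x_i^{t+1/2}+\mathrm{Clip}\bigl(x_{j\to i}^{t+1/2}-x_i^{t+1/2},\tau_i^{t+1}\bigr),\quad x_i^{t+1}=\sum_{j\in V}W_{ij}z_{j\to i}^{t+1},$$ where $\mathrm{Clip}(v,\tau)=\min(1,\tau/\|v\|)\,v$, $x_{j\to i}^{t+1/2}=x_j^{t+1/2}$ for $j\in V_R$, and for $j\in V_B$ the vector $x_{j\to i}^{t+1/2}$ is arbitrary (it may be random and depend on everything up to and including step $t$). The samples $\xi_i^t\sim\mathcal D_i$, $i\in V_R$, of step $t$ are independent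 of each other and of everything before step $t$. The clipping radius is $$\tau_i^{t+1}=\sqrt{\tfrac1{\delta_i}\sum_{j\in V_R}W_{ij}\,\mathbb E_t\bigl\|x_i^{t+1/2}-x_j^{t+1/2}\bigr\|^2}$$ ($\tau_i^{t+1}=\infty$ if $\delta_i=0$), where $\mathbb E_t$ is the expectation over the samples of step $t$, conditional on the past. **Theorem.** Let $c_1=32$, $c_2=5$, $d_0=40L/\gamma$, $\bar x^t=\frac1n\sum_{i\in V_R}x_i^t$, $r_0=f(x^0)-f^\star>0$, and suppose that $\delta_{\max}\le\gamma^2/(64c_1c_2)$. For every $T\ge 0$ there is a step size $\eta>0$ with $3\eta L\le 1$, depending only on $n,L,\sigma,r_0,\gamma,\delta_{\max},\zeta,T$, such that with $\alpha=3\eta L$ $$\frac1{T+1}\sum_{t=0}^T\mathbb E\|\nabla f(\bar x^t)\|^2\le\frac{200c_1c_2}{\gamma^2}\delta_{\max}\zeta^2+2\Bigl(\frac{3^2}{n}+\frac{320c_1c_2}{\gamma^2}\delta_{\max}\Bigr)^{1/2}\Bigl(\frac{3L\sigma^2r_0}{T+1}\Bigr)^{1/2}+2\Bigl(\frac{48c_2}{\gamma^2}\zeta^2\Bigr)^{1/3}\Bigl(\frac{r_0L}{T+1}\Bigr)^{2/3}+2\Bigl(\frac{144c_2}{\gamma^2}\sigma^2\Bigr)^{1/4}\Bigl(\frac{r_0L}{T+1}\Bigr)^{3/4}+\frac{d_0r_0}{T+1}.$$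 Furthermore, with the same step size, if $\sigma>0$ and $\zeta>0$ then for all sufficiently large $T$ and all $t\le T+1$ $$\frac1n\sum_{i\in V_R}\mathbb E\|x_i^t-\bar x^t\|^2\le C\,\frac{\zeta^2}{\gamma^2(T+1)},$$ where $C$ depends only on $n,L,\sigma,r_0$, and the threshold on $T$ depends in addition only on $\gamma,\delta_{\max},\zeta$. -/

import Mathlib

open MeasureTheory ProbabilityTheory

noncomputable section

namespace ClippedGossip

section Network

variable {V : Type*} [Fintype V] [DecidableEq V]

/-- Standing assumptions on the communication network. `G` is the (undirected) graph of all workers,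
`R` is the set of regular workers (the others are Byzantine), `W i j` is the mixing weight which
worker `i` gives to worker `j`. Nothing is assumed on the rows of `W` of Byzantine workers. -/
structure IsNetwork (G : SimpleGraph V) (R : Finset V) (W : V → V → ℝ) : Prop where
  /-- The subgraph induced by the regular workers is connected. -/
  connected : (G.induce (R : Set V)).Connected
  nonneg : ∀ i ∈ R, ∀ j, 0 ≤ W i j
  pos_iff : ∀ i ∈ R, ∀ j, 0 < W i j ↔ (j = i ∨ G.Adj i j)
  row_sum : ∀ i ∈ R, ∑ j, W i j = 1
  symm : ∀ i ∈ R, ∀ j ∈ R, W i j = W j i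

/-- `δ_i`: the total weight that worker `i` gives to Byzantine workers. -/
def byzWeight (R : Finset V) (W : V → V → ℝ) (i : V) : ℝ := ∑ j ∈ Rᶜ, W i j

/-- `δ_max`: the maximum of `δ_i` over the regular workers. -/
def byzWeightMax (R : Finset V) (W : V → V → ℝ) : ℝ := ⨆ i : {i // i ∈ R}, byzWeight R W i

/-- The mixing matrix of the regular workers: every regular worker puts the weight of its Byzantine
neighbours on itself. -/
def regularMixing (R : Finset V) (W : V → V → ℝ) : Matrix {i // i ∈ R} {i // i ∈ R} ℝ :=
  Matrix.of fun i j => W i j + if i = j then byzWeight R W i else 0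

/-- The spectral gap `1 - ‖W̃ - (1/|R|) 𝟏𝟏ᵀ‖₂` (the norm is the `ℓ²` operator norm) of the mixing
matrix of the regular workers; as that matrix is symmetric and doubly stochastic, this is `1` minus
the second largest absolute value of its eigenvalues, with multiplicity. -/
def spectralGap (R : Finset V) (W : V → V → ℝ) : ℝ :=
  1 - ‖Matrix.toEuclideanCLM (n := {i // i ∈ R}) (𝕜 := ℝ)
    (regularMixing R W - Matrix.of fun _ _ => (1 : ℝ) / (R.card : ℝ))‖

end Network

section Objective

variable {V S : Type*} [MeasurableSpace S] {d : ℕ}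

/-- The objective `f = (1/|R|) ∑_{i ∈ R} f_i`. -/
def avgObjective (R : Finset V) (f : V → EuclideanSpace ℝ (Fin d) → ℝ)
    (x : EuclideanSpace ℝ (Fin d)) : ℝ :=
  (1 / (R.card : ℝ)) * ∑ i ∈ R, f i x

/-- Smoothness of the local objectives `f_i`, unbiasedness and bounded variance of the stochastic
gradients `g i x s` (where `s` has law `D i`), bounded heterogeneity. -/
structure IsProblem (R : Finset V) (f : V → EuclideanSpace ℝ (Fin d) → ℝ)
    (g : V → EuclideanSpace ℝ (Fin d) → S → EuclideanSpace ℝ (Fin d))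
    (D : V → Measure S) (L σ ζ : ℝ) : Prop where
  differentiable : ∀ i ∈ R, Differentiable ℝ (f i)
  smooth : ∀ i ∈ R, ∀ x y, ‖gradient (f i) x - gradient (f i) y‖ ≤ L * ‖x - y‖
  measurable : ∀ i ∈ R, Measurable (Function.uncurry (g i))
  integrable : ∀ i ∈ R, ∀ x, Integrable (g i x) (D i)
  unbiased : ∀ i ∈ R, ∀ x, ∫ s, g i x s ∂(D i) = gradient (f i) x
  sq_integrable : ∀ i ∈ R, ∀ x, Integrable (fun s => ‖g i x s - gradient (f i) x‖ ^ 2) (D i)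
  noise : ∀ i ∈ R, ∀ x, ∫ s, ‖g i x s - gradient (f i) x‖ ^ 2 ∂(D i) ≤ σ ^ 2
  heterogeneity : ∀ x, (1 / (R.card : ℝ)) *
    ∑ i ∈ R, ‖gradient (f i) x - gradient (avgObjective R f) x‖ ^ 2 ≤ ζ ^ 2

end Objective

section Algorithm

variable {V S Ω : Type*} [Fintype V] [DecidableEq V] [mΩ : MeasurableSpace Ω]
  {d : ℕ}

/-- The randomness. `ℱ t` is the information available before step `t`. In step `t` the regular
workers draw samples `ξ t i ∼ D i`, independent of each other and of `ℱ t`. `byz t j i` is the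
vector which the Byzantine worker `j` sends to worker `i` in step `t`: an arbitrary random vector
that may depend on everything that has happened, the samples of step `t` included. -/
structure IsExecution [MeasurableSpace S] (R : Finset V) (D : V → Measure S) (μ : Measure Ω) (ℱ : Filtration ℕ mΩ)
    (ξ : ℕ → V → Ω → S) (byz : ℕ → V → V → Ω → EuclideanSpace ℝ (Fin d)) : Prop where
  sample_measurable : ∀ t, ∀ i ∈ R, Measurable[ℱ (t + 1)] (ξ t i)
  sample_law : ∀ t, ∀ i ∈ R, μ.map (ξ t i) = D i
  sample_indep : ∀ t, iIndepFun (fun (i : {i // i ∈ R}) => ξ t i) μ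
  sample_indep_past : ∀ t,
    Indep (⨆ i : {i // i ∈ R}, MeasurableSpace.comap (ξ t i) inferInstance) (ℱ t) μ
  byz_measurable : ∀ t, ∀ j ∉ R, ∀ i ∈ R, Measurable[ℱ (t + 1)] (byz t j i)

/-- `Clip(v, τ) = min(1, τ / ‖v‖) v`. -/
def clip (τ : ℝ) (v : EuclideanSpace ℝ (Fin d)) : EuclideanSpace ℝ (Fin d) :=
  min 1 (τ / ‖v‖) • v

/-- The models and the momenta of the workers. -/
structure State (V Ω : Type*) (d : ℕ) where
  x : V → Ω → EuclideanSpace ℝ (Fin d)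
  m : V → Ω → EuclideanSpace ℝ (Fin d)

/-- `m_i^{t+1} = (1 - α) m_i^t + α g_i(x_i^t)`, where `ξ` are the samples of step `t`. -/
def nextMomentum (g : V → EuclideanSpace ℝ (Fin d) → S → EuclideanSpace ℝ (Fin d)) (α : ℝ)
    (ξ : V → Ω → S) (s : State V Ω d) (i : V) (ω : Ω) : EuclideanSpace ℝ (Fin d) :=
  (1 - α) • s.m i ω + α • g i (s.x i ω) (ξ i ω)

/-- `x_i^{t+1/2} = x_i^t - η m_i^{t+1}`. -/
def halfStep (g : V → EuclideanSpace ℝ (Fin d) → S → EuclideanSpace ℝ (Fin d)) (α η : ℝ)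
    (ξ : V → Ω → S) (s : State V Ω d) (i : V) (ω : Ω) : EuclideanSpace ℝ (Fin d) :=
  s.x i ω - η • nextMomentum g α ξ s i ω

/-- The clipping radius
`τ_i^{t+1} = √((1/δ_i) ∑_{j ∈ R} W_ij 𝔼_t ‖x_i^{t+1/2} - x_j^{t+1/2}‖²)`, where `𝔼_t` is the
expectation over the samples of step `t`, conditional on the past `ℱ t`. It is used only when
`δ_i ≠ 0`. -/
def clipRadius (R : Finset V) (W : V → V → ℝ)
    (g : V → EuclideanSpace ℝ (Fin d) → S → EuclideanSpace ℝ (Fin d)) (α η : ℝ)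
    (μ : Measure Ω) (ℱ : Filtration ℕ mΩ) (t : ℕ) (ξ : V → Ω → S) (s : State V Ω d)
    (i : V) (ω : Ω) : ℝ :=
  √((1 / byzWeight R W i) * ∑ j ∈ R, W i j *
    (μ[fun ω' => ‖halfStep g α η ξ s i ω' - halfStep g α η ξ s j ω'‖ ^ 2 | ℱ t]) ω)

/-- The vector that worker `i` receives from worker `j`. -/
def received (R : Finset V)
    (g : V → EuclideanSpace ℝ (Fin d) → S → EuclideanSpace ℝ (Fin d)) (α η : ℝ)
    (ξ : V → Ω → S) (byz : V → V → Ω → EuclideanSpace ℝ (Fin d)) (s : State V Ω d)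
    (j i : V) (ω : Ω) : EuclideanSpace ℝ (Fin d) :=
  if j ∈ R then halfStep g α η ξ s j ω else byz j i ω

/-- `z_{j→i}^{t+1} = x_i^{t+1/2} + Clip(x_j^{t+1/2} - x_i^{t+1/2}, τ_i^{t+1})`; a worker `i` with
`δ_i = 0` has `τ_i^{t+1} = ∞`, so that nothing is clipped. -/
def clippedMsg (R : Finset V) (W : V → V → ℝ)
    (g : V → EuclideanSpace ℝ (Fin d) → S → EuclideanSpace ℝ (Fin d)) (α η : ℝ)
    (μ : Measure Ω) (ℱ : Filtration ℕ mΩ) (t : ℕ) (ξ : V → Ω → S)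
    (byz : V → V → Ω → EuclideanSpace ℝ (Fin d)) (s : State V Ω d)
    (j i : V) (ω : Ω) : EuclideanSpace ℝ (Fin d) :=
  if byzWeight R W i = 0 then received R g α η ξ byz s j i ω
  else halfStep g α η ξ s i ω +
    clip (clipRadius R W g α η μ ℱ t ξ s i ω)
      (received R g α η ξ byz s j i ω - halfStep g α η ξ s i ω)

/-- The iterates of the algorithm with `x_i^0 = x⁰`, `m_i^0 = 0` and
`x_i^{t+1} = ∑_j W_ij z_{j→i}^{t+1}`. (The entries of Byzantine workers have no meaning; the entries
of regular workers do not depend on them.) -/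
def iterates (R : Finset V) (W : V → V → ℝ)
    (g : V → EuclideanSpace ℝ (Fin d) → S → EuclideanSpace ℝ (Fin d)) (α η : ℝ)
    (x₀ : EuclideanSpace ℝ (Fin d)) (μ : Measure Ω) (ℱ : Filtration ℕ mΩ)
    (ξ : ℕ → V → Ω → S) (byz : ℕ → V → V → Ω → EuclideanSpace ℝ (Fin d)) :
    ℕ → State V Ω d
  | 0 => ⟨fun _ _ => x₀, fun _ _ => 0⟩
  | t + 1 =>
    let s := iterates R W g α η x₀ μ ℱ ξ byz t
    ⟨fun i ω => ∑ j, W i j • clippedMsg R W g α η μ ℱ t (ξ t) (byz t) s j i ω,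
      nextMomentum g α (ξ t) s⟩

/-- The average model `x̄` of the regular workers. -/
def avgModel (R : Finset V) (s : State V Ω d) (ω : Ω) : EuclideanSpace ℝ (Fin d) :=
  (1 / (R.card : ℝ)) • ∑ i ∈ R, s.x i ω

/-- The consensus distance `(1/|R|) ∑_{i ∈ R} ‖x_i - x̄‖²`. -/
def consensusDist (R : Finset V) (s : State V Ω d) (ω : Ω) : ℝ :=
  (1 / (R.card : ℝ)) * ∑ i ∈ R, ‖s.x i ω - avgModel R s ω‖ ^ 2

end Algorithm

end ClippedGossip

end

/-! Write y_i for the half step of worker i. One step of the algorithm is x_i^{t+1} = Σ_j W̃_ij y_j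
+ b_i + c_i (`sum_clippedMsg_eq`): exact gossip with the symmetric doubly stochastic matrix W̃, plus
two errors of different nature. The error b_i collects the Byzantine messages and the conditional
expectation of the clipping error on regular messages; c_i is the centered rest of that clipping
error.

The radius balances the two parts of b_i. A clipped Byzantine message moves worker i by at most τ_i,
in total by δ_i τ_i (`norm_byzError_le`). Clipping v costs at most ‖v‖²/τ_i, so the expected cost on
regular messages is at most (1/τ_i) Σ_j W_ij 𝔼_t‖y_i - y_j‖², which is again δ_i τ_i by the choice
of τ_i (`norm_clipBias_le`). Hence Σ_i 𝔼‖b_i‖² is at most 16 δ_max times the total disagreement of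
the half steps (`sum_integral_bias_sq_le`).

The part c_i has no factor δ_max, but it is harmless. It is centered given the past, so it is
orthogonal to ∇f(x̄^t) and enters the descent inequality only quadratically. Moreover its average
over the workers has second moment of order η²α²σ²/n (`variance_mean_regularClipError_le`). For this
the clipping errors of the pairs (i,j) and (j,i) are combined into a 1-Lipschitz function of y_j -
y_i (`mean_regularClipError`, `norm_clipResidual_diff_le`), and disjoint pairs are uncorrelated. The
radius is known before the step, so it may be held fixed here.

Random vectors are then treated as points of L²: second moments are squared norms, the past is a
subspace, conditional centering is orthogonality. The facts needed from probability form the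
interface `IsPerturbedGossip`, established by `isPerturbedGossip_iterates`; the remaining
convergence argument is deterministic Hilbert space geometry.

There, the spectral gap and the smallness of δ_max bound the consensus distance by 5η²(ζ²+ασ²)/γ²
(`consensus_le`). The potential f(x̄^t) + ‖m̄^{t+1} - ∇f(x̄^t)‖²/(4L) decreases by η‖∇f(x̄^t)‖²/2 up
to controlled errors when α = 3ηL (`sum_norm_h_sq_le_of_bounds`). Telescoping gives a bound that is
polynomial in η apart from r₀/(ηT), and the step size balances its terms (`exists_stepSize`). The
same choice makes η² of order 1/T if σ > 0, which turns the consensus estimate into the second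
claim. -/

noncomputable section

namespace ClippedGossip

/-! ### Functions with Lipschitz gradient. -/

section Smooth

variable {E : Type*} [NormedAddCommGroup E] [InnerProductSpace ℝ E] [CompleteSpace E]

/-- The descent lemma for functions with Lipschitz gradient. -/
theorem le_quadratic_of_lipschitz_gradient {f : E → ℝ} {L : ℝ} (hf : Differentiable ℝ f)
    (hL : ∀ x y, ‖gradient f x - gradient f y‖ ≤ L * ‖x - y‖) (x y : E) :
    f y ≤ f x + inner ℝ (gradient f x) (y - x) + L / 2 * ‖y - x‖ ^ 2 := by
  set v := y - x with hv
  -- The claim is φ 1 ≤ φ 0. The derivative of φ is the change of the directional derivative along v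
  -- minus its Lipschitz bound L s ‖v‖², hence nonpositive on [0,1].
  set φ : ℝ → ℝ := fun s => f (x + s • v) - s * inner ℝ (gradient f x) v
    - L / 2 * ‖v‖ ^ 2 * s ^ 2 with hφ
  have hd : ∀ s : ℝ, HasDerivAt φ
      (inner ℝ (gradient f (x + s • v)) v - inner ℝ (gradient f x) v - L * ‖v‖ ^ 2 * s) s := by
    intro s
    have h1 : HasDerivAt (fun s : ℝ => f (x + s • v)) (inner ℝ (gradient f (x + s • v)) v) s := by
      have hg := (hf (x + s • v)).hasGradientAt.hasFDerivAt
      have hl : HasDerivAt (fun s : ℝ => x + s • v) v s := by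
        simpa using ((hasDerivAt_id s).smul_const v).const_add x
      have hc := hg.comp_hasDerivAt s hl
      rwa [InnerProductSpace.toDual_apply_apply] at hc
    have h2 : HasDerivAt (fun s : ℝ => s * inner ℝ (gradient f x) v)
        (inner ℝ (gradient f x) v) s := by
      simpa using (hasDerivAt_id s).mul_const (inner ℝ (gradient f x) v)
    have h3 : HasDerivAt (fun s : ℝ => L / 2 * ‖v‖ ^ 2 * s ^ 2) (L * ‖v‖ ^ 2 * s) s := by
      have := (hasDerivAt_pow 2 s).const_mul (L / 2 * ‖v‖ ^ 2)
      exact this.congr_deriv (by push_cast; ring)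
    exact (h1.sub h2).sub h3
  have hanti : AntitoneOn φ (Set.Icc 0 1) := by
    apply antitoneOn_of_deriv_nonpos (convex_Icc 0 1)
    · exact fun s _ => (hd s).continuousAt.continuousWithinAt
    · exact fun s _ => (hd s).differentiableAt.differentiableWithinAt
    · intro s hs
      rw [interior_Icc] at hs
      rw [(hd s).deriv, ← inner_sub_left]
      have h1 := real_inner_le_norm (gradient f (x + s • v) - gradient f x) v
      have h2 := hL (x + s • v) x
      rw [add_sub_cancel_left, norm_smul, Real.norm_of_nonneg hs.1.le] at h2
      nlinarith [mul_le_mul_of_nonneg_right h2 (norm_nonneg v)]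
  have := hanti (Set.left_mem_Icc.2 zero_le_one) (Set.right_mem_Icc.2 zero_le_one) zero_le_one
  simp only [hφ, one_smul, zero_smul, add_zero] at this
  have hy : x + v = y := by simp [hv]
  rw [hy] at this
  linarith

/-- A gradient step of length 1/L lowers f by at least ‖∇f x‖²/(2L), and it cannot go below c. -/
theorem norm_gradient_sq_le {f : E → ℝ} {L c : ℝ} (hL0 : 0 < L) (hf : Differentiable ℝ f)
    (hL : ∀ x y, ‖gradient f x - gradient f y‖ ≤ L * ‖x - y‖) (hc : ∀ y, c ≤ f y) (x : E) :
    ‖gradient f x‖ ^ 2 ≤ 2 * L * (f x - c) := by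
  have h := le_quadratic_of_lipschitz_gradient hf hL x (x - (1 / L) • gradient f x)
  have h2 := hc (x - (1 / L) • gradient f x)
  rw [sub_sub_cancel_left, inner_neg_right, norm_neg, norm_smul, inner_smul_right,
    real_inner_self_eq_norm_sq, Real.norm_of_nonneg (by positivity)] at h
  have h3 : L / 2 * (1 / L * ‖gradient f x‖) ^ 2 = 1 / (2 * L) * ‖gradient f x‖ ^ 2 := by
    field_simp
  have h4 : 1 / (2 * L) * ‖gradient f x‖ ^ 2 ≤ f x - c := by
    have : 1 / L * ‖gradient f x‖ ^ 2 = 2 * (1 / (2 * L) * ‖gradient f x‖ ^ 2) := by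
      field_simp
    linarith
  have h5 : ‖gradient f x‖ ^ 2 = 2 * L * (1 / (2 * L) * ‖gradient f x‖ ^ 2) := by field_simp
  rw [h5]
  exact mul_le_mul_of_nonneg_left h4 (by positivity)

end Smooth

/-! ### Clipping as the metric projection onto a ball. -/

section FirmlyNonexpansive

variable {E : Type*} [NormedAddCommGroup E] [InnerProductSpace ℝ E]

theorem norm_le_of_firm {a b : E} (h : ‖b‖ ^ 2 ≤ inner ℝ a b) : ‖b‖ ≤ ‖a‖ := by
  have := real_inner_le_norm a b
  by_contra! hlt
  nlinarith [norm_nonneg a, norm_nonneg b]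

/-- The complement of a firmly nonexpansive map is firmly nonexpansive: the hypothesis is symmetric
under b ↦ a - b. -/
theorem norm_sub_le_of_firm {a b : E} (h : ‖b‖ ^ 2 ≤ inner ℝ a b) : ‖a - b‖ ≤ ‖a‖ := by
  apply norm_le_of_firm
  rw [inner_sub_right, real_inner_self_eq_norm_sq, norm_sub_sq_real]
  linarith

end FirmlyNonexpansive

section Clip

variable {d : ℕ}

theorem clip_eq_self {τ : ℝ} {v : EuclideanSpace ℝ (Fin d)} (h : ‖v‖ ≤ τ) : clip τ v = v := by
  by_cases hv : v = 0
  · simp [clip, hv]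
  · have : 1 ≤ τ / ‖v‖ := (one_le_div (norm_pos_iff.2 hv)).2 h
    simp [clip, min_eq_left this]

theorem clip_eq_smul {τ : ℝ} {v : EuclideanSpace ℝ (Fin d)} (h0 : 0 ≤ τ) (h : τ < ‖v‖) :
    clip τ v = (τ / ‖v‖) • v := by
  have : τ / ‖v‖ ≤ 1 := (div_le_one (h0.trans_lt h)).2 h.le
  simp [clip, min_eq_right this]

theorem clip_neg (τ : ℝ) (v : EuclideanSpace ℝ (Fin d)) : clip τ (-v) = -clip τ v := by
  simp [clip]

theorem norm_clip_le {τ : ℝ} (h0 : 0 ≤ τ) (v : EuclideanSpace ℝ (Fin d)) : ‖clip τ v‖ ≤ τ := by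
  rcases le_or_gt ‖v‖ τ with h | h
  · rwa [clip_eq_self h]
  · have hv : 0 < ‖v‖ := h0.trans_lt h
    rw [clip_eq_smul h0 h, norm_smul, Real.norm_of_nonneg (by positivity)]
    exact (div_mul_cancel₀ τ hv.ne').le

/-- The variational inequality that characterizes clip τ v as the point of the ball of radius τ
nearest to v. -/
theorem inner_sub_clip_nonpos {τ : ℝ} (h0 : 0 ≤ τ) (v w : EuclideanSpace ℝ (Fin d))
    (hw : ‖w‖ ≤ τ) : inner ℝ (v - clip τ v) (w - clip τ v) ≤ 0 := by
  rcases le_or_gt ‖v‖ τ with h | h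
  · simp [clip_eq_self h]
  · have hv : 0 < ‖v‖ := h0.trans_lt h
    rw [clip_eq_smul h0 h]
    have h1 : v - (τ / ‖v‖) • v = (1 - τ / ‖v‖) • v := by rw [sub_smul, one_smul]
    rw [h1, inner_smul_left, inner_sub_right, inner_smul_right, real_inner_self_eq_norm_sq]
    have h2 : τ / ‖v‖ ≤ 1 := (div_le_one hv).2 h.le
    have h3 : τ / ‖v‖ * ‖v‖ ^ 2 = ‖v‖ * τ := by field_simp
    have h4 := real_inner_le_norm v w
    have h5 := mul_le_mul_of_nonneg_left hw hv.le
    rw [h3]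
    exact mul_nonpos_of_nonneg_of_nonpos (by simpa using h2) (by linarith)

/-- Add the variational inequality at u, tested with clip τ v, to the one at v, tested with clip τ
u. -/
theorem clip_firm {τ : ℝ} (h0 : 0 ≤ τ) (u v : EuclideanSpace ℝ (Fin d)) :
    ‖clip τ u - clip τ v‖ ^ 2 ≤ inner ℝ (u - v) (clip τ u - clip τ v) := by
  have h1 := inner_sub_clip_nonpos h0 u (clip τ v) (norm_clip_le h0 v)
  have h2 := inner_sub_clip_nonpos h0 v (clip τ u) (norm_clip_le h0 u)
  rw [← neg_sub (clip τ u) (clip τ v), inner_neg_right] at h1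
  have h3 : u - v = (u - clip τ u) - (v - clip τ v) + (clip τ u - clip τ v) := by abel
  rw [h3, inner_add_left, inner_sub_left, real_inner_self_eq_norm_sq]
  linarith

/-- Projections onto concentric balls compose to the projection onto the smaller ball. This lets the
difference of two clippings be written as a composition of nonexpansive maps. -/
theorem clip_clip {τ τ' : ℝ} (h0 : 0 ≤ τ) (h : τ ≤ τ') (v : EuclideanSpace ℝ (Fin d)) :
    clip τ (clip τ' v) = clip τ v := by
  rcases le_or_gt ‖v‖ τ' with h1 | h1
  · rw [clip_eq_self h1]
  · have h0' := h0.trans h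
    have hv : 0 < ‖v‖ := h0'.trans_lt h1
    have hn : ‖clip τ' v‖ = τ' := by
      rw [clip_eq_smul h0' h1, norm_smul, Real.norm_of_nonneg (by positivity)]
      exact div_mul_cancel₀ τ' hv.ne'
    rcases h.eq_or_lt with rfl | h2
    · exact clip_eq_self hn.le
    · rw [clip_eq_smul h0 (h2.trans_eq hn.symm), hn, clip_eq_smul h0' h1,
        clip_eq_smul h0 (h2.trans h1), smul_smul]
      have := (h0.trans_lt h2).ne'
      congr 1
      field_simp

/-- The change of a vector `v` by clipping with radius `τ`; a worker with `δ = 0` does not clip. -/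
def clipResidual (δ τ : ℝ) (v : EuclideanSpace ℝ (Fin d)) : EuclideanSpace ℝ (Fin d) :=
  if δ = 0 then 0 else clip τ v - v

theorem clipResidual_neg (δ τ : ℝ) (v : EuclideanSpace ℝ (Fin d)) :
    clipResidual δ τ (-v) = -clipResidual δ τ v := by
  unfold clipResidual
  split_ifs
  · simp
  · rw [clip_neg]; abel

theorem norm_clipResidual_sub_le (δ : ℝ) {τ : ℝ} (h0 : 0 ≤ τ) (u v : EuclideanSpace ℝ (Fin d)) :
    ‖clipResidual δ τ u - clipResidual δ τ v‖ ≤ ‖u - v‖ := by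
  unfold clipResidual
  split_ifs
  · simp
  · have := norm_sub_le_of_firm (clip_firm h0 u v)
    have e : clip τ u - u - (clip τ v - v) = -(u - v - (clip τ u - clip τ v)) := by abel
    rwa [e, norm_neg]

@[simp]
theorem clipResidual_zero (δ τ : ℝ) : clipResidual δ τ (0 : EuclideanSpace ℝ (Fin d)) = 0 := by
  simp [clipResidual, clip]

theorem norm_clipResidual_le (δ : ℝ) {τ : ℝ} (h0 : 0 ≤ τ) (u : EuclideanSpace ℝ (Fin d)) :
    ‖clipResidual δ τ u‖ ≤ ‖u‖ := by
  simpa using norm_clipResidual_sub_le δ h0 u 0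

/-- The residual vanishes unless ‖u‖ > τ, so one factor ‖u‖ may replace τ. This quadratic bound
matches the definition of the clipping radius by second moments. -/
theorem mul_norm_clipResidual_le (δ : ℝ) {τ : ℝ} (h0 : 0 ≤ τ) (u : EuclideanSpace ℝ (Fin d)) :
    τ * ‖clipResidual δ τ u‖ ≤ ‖u‖ ^ 2 := by
  rcases le_or_gt ‖u‖ τ with h | h
  · have : clipResidual δ τ u = 0 := by simp [clipResidual, clip_eq_self h]
    simp [this]
  · rw [sq]
    exact mul_le_mul h.le (norm_clipResidual_le δ h0 u) (norm_nonneg _) (norm_nonneg _)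

/-- The two ends of an edge clip the same difference with different radii. The triangle inequality
would give the Lipschitz constant 2; nested balls give 1. -/
theorem norm_clipResidual_diff_le (δ δ' : ℝ) {τ τ' : ℝ} (h0 : 0 ≤ τ) (h0' : 0 ≤ τ')
    (u v : EuclideanSpace ℝ (Fin d)) :
    ‖(clipResidual δ τ u - clipResidual δ' τ' u) - (clipResidual δ τ v - clipResidual δ' τ' v)‖
      ≤ ‖u - v‖ := by
  by_cases hδ : δ = 0
  · have := norm_clipResidual_sub_le δ' h0' u v
    have e : ∀ w : EuclideanSpace ℝ (Fin d), clipResidual δ τ w = 0 := fun w => by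
      simp [clipResidual, hδ]
    rwa [e, e, zero_sub, zero_sub, neg_sub_neg, norm_sub_rev]
  by_cases hδ' : δ' = 0
  · have := norm_clipResidual_sub_le δ h0 u v
    have e : ∀ w : EuclideanSpace ℝ (Fin d), clipResidual δ' τ' w = 0 := fun w => by
      simp [clipResidual, hδ']
    rwa [e, e, sub_zero, sub_zero]
  -- For τ ≤ τ' one has clip τ' - clip τ = (id - clip τ) ∘ clip τ', a composition of two
  -- nonexpansive maps.
  have key : ∀ {τ τ' : ℝ}, 0 ≤ τ → τ ≤ τ' → ‖(clip τ' u - clip τ u) - (clip τ' v - clip τ v)‖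
      ≤ ‖u - v‖ := by
    intro τ τ' h0 h
    have h1 := norm_sub_le_of_firm (clip_firm h0 (clip τ' u) (clip τ' v))
    rw [clip_clip h0 h, clip_clip h0 h] at h1
    have h2 := norm_le_of_firm (clip_firm (h0.trans h) u v)
    refine le_trans ?_ (h1.trans h2)
    apply le_of_eq
    congr 1
    abel
  simp only [clipResidual, hδ, hδ', if_false]
  rcases le_total τ' τ with h | h
  · refine le_trans (le_of_eq ?_) (key h0' h)
    congr 1
    abel
  · refine le_trans (le_of_eq ?_) (key h0 h)
    rw [← norm_neg]
    congr 1
    abel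

theorem measurable_clip {α : Type*} [MeasurableSpace α] {τ : α → ℝ}
    {v : α → EuclideanSpace ℝ (Fin d)} (hτ : Measurable τ) (hv : Measurable v) :
    Measurable fun a => clip (τ a) (v a) := by
  unfold clip
  exact (measurable_const.min (hτ.div hv.norm)).smul hv

theorem measurable_clipResidual {α : Type*} [MeasurableSpace α] (δ : ℝ) {τ : α → ℝ}
    {v : α → EuclideanSpace ℝ (Fin d)} (hτ : Measurable τ) (hv : Measurable v) :
    Measurable fun a => clipResidual δ (τ a) (v a) := by
  unfold clipResidual
  split_ifs
  · exact measurable_const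
  · exact (measurable_clip hτ hv).sub hv

end Clip

end ClippedGossip

end

noncomputable section

namespace ClippedGossip

/-! ### Contraction by mixing matrices. -/

section Matrices

variable {ι : Type*} [Fintype ι] [DecidableEq ι]

/-- A matrix acts on families of vectors of an inner product space with its `ℓ²` operator norm. -/
theorem sum_norm_sq_matrix_le {H : Type*} [NormedAddCommGroup H] [InnerProductSpace ℝ H]
    (A : Matrix ι ι ℝ) {c : ℝ} (hA : ‖Matrix.toEuclideanCLM (n := ι) (𝕜 := ℝ) A‖ ≤ c)
    (u : ι → H) : ∑ i, ‖∑ j, A i j • u j‖ ^ 2 ≤ c ^ 2 * ∑ i, ‖u i‖ ^ 2 := by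
  -- The norm bound says that c² - AᵀA is positive semidefinite, hence a sum of rank one matrices v
  -- vᵀ. The corresponding form on vectors of H is then a sum of squares ‖Σ_i v_i u_i‖², so the
  -- scalar inequality passes to any inner product space.
  set S : Matrix ι ι ℝ := c ^ 2 • (1 : Matrix ι ι ℝ) - A.transpose * A with hS
  have hpsd : S.PosSemidef := by
    apply Matrix.PosSemidef.of_dotProduct_mulVec_nonneg
    · simp [Matrix.IsHermitian, hS, Matrix.transpose_mul]
    · intro x
      have h1 : ‖Matrix.toEuclideanCLM (n := ι) (𝕜 := ℝ) A (WithLp.toLp 2 x)‖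
          ≤ c * ‖(WithLp.toLp 2 x : EuclideanSpace ℝ ι)‖ :=
        (ContinuousLinearMap.le_opNorm _ _).trans
          (mul_le_mul_of_nonneg_right hA (norm_nonneg _))
      have h2 := pow_le_pow_left₀ (norm_nonneg _) h1 2
      rw [mul_pow, Matrix.toEuclideanCLM_toLp, EuclideanSpace.norm_sq_eq,
        EuclideanSpace.norm_sq_eq] at h2
      have h3 : star x ⬝ᵥ S.mulVec x
          = c ^ 2 * ∑ i, x i ^ 2 - ∑ i, (A.mulVec x) i ^ 2 := by
        rw [hS, Matrix.sub_mulVec, dotProduct_sub, Matrix.smul_mulVec, Matrix.one_mulVec,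
          ← Matrix.mulVec_mulVec, Matrix.dotProduct_mulVec _ A.transpose, Matrix.vecMul_transpose]
        simp [dotProduct, Finset.mul_sum, sq]
        simp [mul_left_comm]
      rw [h3]
      simpa using h2
  obtain ⟨m, v, hv⟩ := Matrix.posSemidef_iff_eq_sum_vecMulVec.1 hpsd
  have key : ∑ i, ∑ j, S i j * inner ℝ (u i) (u j)
      = c ^ 2 * ∑ i, ‖u i‖ ^ 2 - ∑ i, ‖∑ j, A i j • u j‖ ^ 2 := by
    have h1 : ∀ i j, S i j = (if i = j then c ^ 2 else 0) - ∑ k, A k i * A k j := by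
      intro i j
      simp [hS, Matrix.mul_apply, Matrix.one_apply]
    simp_rw [h1, sub_mul, Finset.sum_sub_distrib]
    congr 1
    · simp [Finset.mul_sum]
    · simp_rw [← real_inner_self_eq_norm_sq, sum_inner, inner_sum, inner_smul_left, inner_smul_right,
        Finset.sum_mul]
      simp only [conj_trivial]
      rw [Finset.sum_congr rfl fun i _ => Finset.sum_comm, Finset.sum_comm]
      simp [mul_assoc]
  have hnn : 0 ≤ ∑ i, ∑ j, S i j * inner ℝ (u i) (u j) := by
    have : ∑ i, ∑ j, S i j * inner ℝ (u i) (u j) = ∑ k, ‖∑ i, v k i • u i‖ ^ 2 := by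
      simp_rw [← real_inner_self_eq_norm_sq, sum_inner, inner_sum, inner_smul_left, inner_smul_right]
      simp only [conj_trivial]
      simp_rw [hv, Matrix.sum_apply, Finset.sum_mul]
      rw [Finset.sum_congr rfl fun i _ => Finset.sum_comm, Finset.sum_comm]
      simp [Matrix.vecMulVec_apply, mul_assoc]
    rw [this]
    positivity
  linarith

-- The equality case of Jensen's inequality. The weighted variances of u seen from the vertices i
-- add up to Σ u_i² - Σ (A u)_i², because A is doubly stochastic. If this is not positive, every
-- weighted square is zero.
omit [DecidableEq ι] in
theorem eq_of_mixing_norm_eq {A : Matrix ι ι ℝ} (hA : ∀ i j, 0 ≤ A i j)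
    (hsymm : ∀ i j, A i j = A j i) (hrow : ∀ i, ∑ j, A i j = 1) {u : ι → ℝ}
    (h : ∑ i, u i ^ 2 ≤ ∑ i, (∑ j, A i j * u j) ^ 2) {i j : ι} (hij : 0 < A i j) :
    u j = ∑ k, A i k * u k := by
  have h1 : ∀ i, ∑ j, A i j * (u j - ∑ k, A i k * u k) ^ 2
      = ∑ j, A i j * u j ^ 2 - (∑ j, A i j * u j) ^ 2 := by
    intro i
    set c := ∑ k, A i k * u k with hc
    have e : ∀ j, A i j * (u j - c) ^ 2
        = A i j * u j ^ 2 - 2 * c * (A i j * u j) + c ^ 2 * A i j := fun j => by ring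
    simp_rw [e, Finset.sum_add_distrib, Finset.sum_sub_distrib, ← Finset.mul_sum]
    rw [hrow, ← hc]
    ring
  have h2 : ∑ i, ∑ j, A i j * u j ^ 2 = ∑ i, u i ^ 2 := by
    rw [Finset.sum_comm]
    refine Finset.sum_congr rfl fun j _ => ?_
    rw [← Finset.sum_mul, Finset.sum_congr rfl fun i _ => hsymm i j, hrow, one_mul]
  have h3 : ∑ i, ∑ j, A i j * (u j - ∑ k, A i k * u k) ^ 2 ≤ 0 := by
    simp_rw [h1, Finset.sum_sub_distrib, h2]
    linarith
  have hn : ∀ i j, 0 ≤ A i j * (u j - ∑ k, A i k * u k) ^ 2 :=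
    fun i j => mul_nonneg (hA i j) (sq_nonneg _)
  have h4 := (Finset.sum_eq_zero_iff_of_nonneg
    fun i _ => Finset.sum_nonneg fun j _ => hn i j).1
    (le_antisymm h3 (Finset.sum_nonneg fun i _ => Finset.sum_nonneg fun j _ => hn i j))
  have h5 := (Finset.sum_eq_zero_iff_of_nonneg fun j _ => hn i j).1 (h4 i (Finset.mem_univ i)) j
    (Finset.mem_univ j)
  rcases mul_eq_zero.1 h5 with h6 | h6
  · exact absurd h6 hij.ne'
  · exact sub_eq_zero.1 (pow_eq_zero_iff two_ne_zero |>.1 h6)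


/-- The mixing matrix of a connected network contracts deviations from the mean strictly. -/
theorem norm_mixing_sub_lt_one [Nonempty ι] {A : Matrix ι ι ℝ} (hA : ∀ i j, 0 ≤ A i j)
    (hsymm : ∀ i j, A i j = A j i) (hrow : ∀ i, ∑ j, A i j = 1) {G : SimpleGraph ι}
    (hG : G.Connected) (hdiag : ∀ i, 0 < A i i) (hadj : ∀ i j, G.Adj i j → 0 < A i j) :
    ‖Matrix.toEuclideanCLM (n := ι) (𝕜 := ℝ)
      (A - Matrix.of fun _ _ => (1 : ℝ) / (Fintype.card ι : ℝ))‖ < 1 := by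
  set B := Matrix.toEuclideanCLM (n := ι) (𝕜 := ℝ)
    (A - Matrix.of fun _ _ => (1 : ℝ) / (Fintype.card ι : ℝ)) with hB
  have hcard : (Fintype.card ι : ℝ) ≠ 0 := by positivity
  -- B v equals A applied to the deviations of v from its mean c, so ‖B v‖ ≥ ‖v‖ would force
  -- equality in Jensen's inequality for v - c.
  have strict : ∀ v : EuclideanSpace ℝ ι, v ≠ 0 → ‖B v‖ < ‖v‖ := by
    intro v hv
    set c : ℝ := (1 / (Fintype.card ι : ℝ)) * ∑ i, v i with hc
    have hBv : ∀ i, (B v) i = ∑ j, A i j * (v j - c) := by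
      intro i
      have : (B v) i = ((A - Matrix.of fun _ _ => (1 : ℝ) / (Fintype.card ι : ℝ)).mulVec v.ofLp) i := by
        rw [hB, Matrix.ofLp_toEuclideanCLM]
      rw [this]
      simp only [Matrix.mulVec, dotProduct, Matrix.sub_apply, Matrix.of_apply, sub_mul, mul_sub,
        Finset.sum_sub_distrib, ← Finset.mul_sum, ← Finset.sum_mul, hrow, hc, one_mul]
    have hsum : ∑ i, (v i - c) ^ 2 = ∑ i, v i ^ 2 - Fintype.card ι * c ^ 2 := by
      have e : ∀ i, (v i - c) ^ 2 = v i ^ 2 - 2 * c * v i + c ^ 2 := fun i => by ring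
      simp_rw [e, Finset.sum_add_distrib, Finset.sum_sub_distrib, ← Finset.mul_sum]
      have : ∑ i, v i = Fintype.card ι * c := by rw [hc]; field_simp
      rw [this]
      simp
      ring
    by_contra! hle
    have h1 := pow_le_pow_left₀ (norm_nonneg _) hle 2
    rw [EuclideanSpace.norm_sq_eq, EuclideanSpace.norm_sq_eq] at h1
    simp only [Real.norm_eq_abs, sq_abs, hBv] at h1
    have h2 : ∑ i, (v i - c) ^ 2 ≤ ∑ i, (∑ j, A i j * (v j - c)) ^ 2 := by
      rw [hsum]
      have : 0 ≤ (Fintype.card ι : ℝ) * c ^ 2 := by positivity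
      linarith
    -- The positive diagonal entry identifies the local average at i with the value at i itself;
    -- without it an eigenvalue -1 would be possible.
    have hstep : ∀ i j, G.Adj i j → v i = v j := by
      intro i j hij
      have h3 := eq_of_mixing_norm_eq hA hsymm hrow (u := fun i => v i - c) h2 (hdiag i)
      have h4 := eq_of_mixing_norm_eq hA hsymm hrow (u := fun i => v i - c) h2 (hadj i j hij)
      simp only at h3 h4
      linarith
    have hconst : ∀ i j, v i = v j := by
      intro i j
      obtain ⟨w⟩ := hG.preconnected i j
      induction w with
      | nil => rfl
      | cons h _ ih => exact (hstep _ _ h).trans ih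
    have hvc : ∀ i, v i - c = 0 := by
      intro i
      have : ∑ j, v j = Fintype.card ι * v i := by
        rw [Finset.sum_congr rfl fun j _ => hconst j i]
        simp
      rw [hc, this]
      field_simp
      ring
    have h5 : ∑ i, v i ^ 2 ≤ 0 := by simpa [hvc] using h1
    apply hv
    ext i
    have := (Finset.sum_eq_zero_iff_of_nonneg fun i _ => sq_nonneg (v i)).1
      (le_antisymm h5 (Finset.sum_nonneg fun i _ => sq_nonneg (v i))) i (Finset.mem_univ i)
    simpa using this
  -- The unit ball is compact, so the operator norm is bounded by a value attained at one vector,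
  -- where strictness applies.
  obtain ⟨v, hv, hmax⟩ := (isCompact_closedBall (0 : EuclideanSpace ℝ ι) 1).exists_isMaxOn
    ⟨0, by simp⟩ (f := fun v => ‖B v‖) (by fun_prop)
  have hlt : ‖B v‖ < 1 := by
    by_cases h0 : v = 0
    · simp [h0]
    · exact (strict v h0).trans_le (by simpa using hv)
  refine lt_of_le_of_lt ?_ hlt
  exact ContinuousLinearMap.opNorm_le_of_unit_norm (norm_nonneg _)
    fun x hx => hmax (by simp [hx])

end Matrices

/-! ### The weights and the spectral gap of the network. -/

section Network

variable {V : Type*} [Fintype V] [DecidableEq V] {G : SimpleGraph V} {R : Finset V}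
  {W : V → V → ℝ}

theorem IsNetwork.byzWeight_nonneg (h : IsNetwork G R W) {i : V} (hi : i ∈ R) :
    0 ≤ byzWeight R W i :=
  Finset.sum_nonneg fun j _ => h.nonneg i hi j

theorem byzWeight_le_max {i : V} (hi : i ∈ R) : byzWeight R W i ≤ byzWeightMax R W :=
  le_ciSup (f := fun i : {i // i ∈ R} => byzWeight R W i) (Set.finite_range _).bddAbove ⟨i, hi⟩

omit [DecidableEq V] in
theorem IsNetwork.nonempty (h : IsNetwork G R W) : Nonempty {i // i ∈ R} := h.connected.nonempty

theorem IsNetwork.byzWeightMax_nonneg (h : IsNetwork G R W) : 0 ≤ byzWeightMax R W := by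
  obtain ⟨i⟩ := h.nonempty
  exact (h.byzWeight_nonneg i.2).trans (byzWeight_le_max i.2)

theorem IsNetwork.sum_add_byzWeight (h : IsNetwork G R W) {i : V} (hi : i ∈ R) :
    ∑ j : {j // j ∈ R}, W i j + byzWeight R W i = 1 := by
  rw [← h.row_sum i hi, byzWeight, ← Finset.sum_add_sum_compl R]
  congr 1
  exact Finset.sum_coe_sort R (W i)

theorem IsNetwork.sum_regularMixing (h : IsNetwork G R W) (i : {i // i ∈ R}) :
    ∑ j, regularMixing R W i j = 1 := by
  simp [regularMixing, Finset.sum_add_distrib]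
  exact h.sum_add_byzWeight i.2

theorem IsNetwork.regularMixing_symm (h : IsNetwork G R W) (i j : {i // i ∈ R}) :
    regularMixing R W i j = regularMixing R W j i := by
  by_cases hij : i = j
  · rw [hij]
  · simp [regularMixing, hij, Ne.symm hij, h.symm i i.2 j j.2]

theorem IsNetwork.weight_le_regularMixing (h : IsNetwork G R W) (i j : {i // i ∈ R}) :
    W i j ≤ regularMixing R W i j := by
  simp only [regularMixing, Matrix.of_apply]
  split_ifs
  · linarith [h.byzWeight_nonneg i.2]
  · linarith

theorem spectralGap_le_one : spectralGap R W ≤ 1 := by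
  simp [spectralGap]

theorem IsNetwork.spectralGap_pos (h : IsNetwork G R W) : 0 < spectralGap R W := by
  have := h.nonempty
  have hG : (G.comap (Subtype.val : {i // i ∈ R} → V)).Connected := h.connected
  have := norm_mixing_sub_lt_one (A := regularMixing R W)
    (fun i j => (h.nonneg i i.2 j).trans (h.weight_le_regularMixing i j))
    h.regularMixing_symm h.sum_regularMixing hG
    (fun i => ((h.pos_iff i i.2 i).2 (Or.inl rfl)).trans_le (h.weight_le_regularMixing i i))
    (fun i j hij => ((h.pos_iff i i.2 j).2 (Or.inr hij)).trans_le (h.weight_le_regularMixing i j))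
  rw [Fintype.card_coe] at this
  rw [spectralGap]
  linarith

/-- The matrix 𝟏𝟏ᵀ/n annihilates families with sum zero, so on these W̃ acts like W̃ - 𝟏𝟏ᵀ/n. -/
theorem sum_norm_sq_regularMixing_le {H : Type*} [NormedAddCommGroup H] [InnerProductSpace ℝ H]
    (u : {i // i ∈ R} → H) (hu : ∑ i, u i = 0) :
    ∑ i, ‖∑ j, regularMixing R W i j • u j‖ ^ 2
      ≤ (1 - spectralGap R W) ^ 2 * ∑ i, ‖u i‖ ^ 2 := by
  have := sum_norm_sq_matrix_le (regularMixing R W - Matrix.of fun _ _ => (1 : ℝ) / (R.card : ℝ))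
    le_rfl u
  simp only [Matrix.sub_apply, Matrix.of_apply, sub_smul, Finset.sum_sub_distrib,
    ← Finset.smul_sum, hu, smul_zero, sub_zero] at this
  rwa [spectralGap, sub_sub_cancel]

end Network

end ClippedGossip

end

noncomputable section

namespace ClippedGossip

/-! ### Means and deviations of families of vectors. -/

section Families

variable {ι H : Type*} [Fintype ι] [NormedAddCommGroup H] [InnerProductSpace ℝ H]

/-- The average of a family of vectors. -/
def mean (u : ι → H) : H := (1 / (Fintype.card ι : ℝ)) • ∑ i, u i

/-- The deviations from the average. -/
def dev (u : ι → H) (i : ι) : H := u i - mean u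

theorem mean_add (u v : ι → H) : mean (fun i => u i + v i) = mean u + mean v := by
  simp [mean, Finset.sum_add_distrib]

theorem mean_sub (u v : ι → H) : mean (fun i => u i - v i) = mean u - mean v := by
  simp [mean, Finset.sum_sub_distrib, smul_sub]

theorem mean_smul (a : ℝ) (u : ι → H) : mean (fun i => a • u i) = a • mean u := by
  simp [mean, ← Finset.smul_sum, smul_comm a]

theorem mean_const [Nonempty ι] (a : H) : mean (fun _ : ι => a) = a := by
  simp only [mean, Finset.sum_const, Finset.card_univ, ← Nat.cast_smul_eq_nsmul ℝ, smul_smul]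
  rw [one_div_mul_cancel (by positivity), one_smul]

theorem card_smul_mean [Nonempty ι] (u : ι → H) : (Fintype.card ι : ℝ) • mean u = ∑ i, u i := by
  rw [mean, smul_smul, mul_one_div_cancel (by positivity), one_smul]

theorem mean_mem (P : Submodule ℝ H) {u : ι → H} (hu : ∀ i, u i ∈ P) : mean u ∈ P :=
  P.smul_mem _ (P.sum_mem fun i _ => hu i)

theorem dev_add (u v : ι → H) (i : ι) : dev (fun i => u i + v i) i = dev u i + dev v i := by
  rw [dev, mean_add, dev, dev]; abel

theorem dev_sub (u v : ι → H) (i : ι) : dev (fun i => u i - v i) i = dev u i - dev v i := by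
  rw [dev, mean_sub, dev, dev]; abel

theorem dev_smul (a : ℝ) (u : ι → H) (i : ι) : dev (fun i => a • u i) i = a • dev u i := by
  rw [dev, mean_smul, dev, smul_sub]

theorem sum_dev [Nonempty ι] (u : ι → H) : ∑ i, dev u i = 0 := by
  simp only [dev, Finset.sum_sub_distrib, Finset.sum_const, Finset.card_univ,
    ← Nat.cast_smul_eq_nsmul ℝ, card_smul_mean, sub_self]

theorem sum_norm_sq_dev [Nonempty ι] (u : ι → H) :
    ∑ i, ‖dev u i‖ ^ 2 = ∑ i, ‖u i‖ ^ 2 - Fintype.card ι * ‖mean u‖ ^ 2 := by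
  simp only [dev, norm_sub_sq_real, Finset.sum_add_distrib, Finset.sum_sub_distrib,
    ← Finset.mul_sum, ← sum_inner, ← card_smul_mean u, inner_smul_left, real_inner_self_eq_norm_sq,
    Finset.sum_const, Finset.card_univ, nsmul_eq_mul]
  simp only [conj_trivial]
  ring

theorem sum_norm_sq_dev_le [Nonempty ι] (u : ι → H) : ∑ i, ‖dev u i‖ ^ 2 ≤ ∑ i, ‖u i‖ ^ 2 := by
  rw [sum_norm_sq_dev]
  have : 0 ≤ (Fintype.card ι : ℝ) * ‖mean u‖ ^ 2 := by positivity
  linarith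

theorem card_mul_norm_sq_mean_le [Nonempty ι] (u : ι → H) :
    Fintype.card ι * ‖mean u‖ ^ 2 ≤ ∑ i, ‖u i‖ ^ 2 := by
  have h := sum_norm_sq_dev u
  have : 0 ≤ ∑ i, ‖dev u i‖ ^ 2 := by positivity
  linarith

theorem norm_add_sq_le_two (a b : H) : ‖a + b‖ ^ 2 ≤ 2 * ‖a‖ ^ 2 + 2 * ‖b‖ ^ 2 := by
  have h1 := parallelogram_law_with_norm ℝ a b
  nlinarith [sq_nonneg ‖a - b‖]

theorem norm_sub_sq_le_two (a b : H) : ‖a - b‖ ^ 2 ≤ 2 * ‖a‖ ^ 2 + 2 * ‖b‖ ^ 2 := by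
  have := norm_add_sq_le_two a (-b)
  rwa [← sub_eq_add_neg, norm_neg] at this

/-- Young's inequality; the weight s is tuned at each use. -/
theorem two_inner_le (a b : H) {s : ℝ} (hs : 0 < s) :
    2 * inner ℝ a b ≤ s * ‖a‖ ^ 2 + ‖b‖ ^ 2 / s := by
  have h1 := real_inner_le_norm a b
  have h2 : s * ‖a‖ ^ 2 + ‖b‖ ^ 2 / s - 2 * (‖a‖ * ‖b‖) = (s * ‖a‖ - ‖b‖) ^ 2 / s := by
    field_simp
    ring
  have h3 : 0 ≤ (s * ‖a‖ - ‖b‖) ^ 2 / s := by positivity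
  linarith

theorem sum_norm_sq_dev_sub_smul_le (u v : ι → H) (η : ℝ) :
    ∑ i, ‖dev (fun i => u i - η • v i) i‖ ^ 2
      ≤ 2 * ∑ i, ‖dev u i‖ ^ 2 + 2 * η ^ 2 * ∑ i, ‖dev v i‖ ^ 2 := by
  rw [Finset.mul_sum, Finset.mul_sum, ← Finset.sum_add_distrib]
  refine Finset.sum_le_sum fun i _ => ?_
  rw [dev_sub, dev_smul]
  refine (norm_sub_sq_le_two _ _).trans ?_
  rw [norm_smul, mul_pow, Real.norm_eq_abs, sq_abs]
  linarith

theorem norm_add_sq_le (a b : H) {s : ℝ} (hs : 0 < s) :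
    ‖a + b‖ ^ 2 ≤ (1 + s) * ‖a‖ ^ 2 + (1 + 1 / s) * ‖b‖ ^ 2 := by
  rw [norm_add_sq_real]
  have := two_inner_le a b hs
  have e : ‖b‖ ^ 2 / s = 1 / s * ‖b‖ ^ 2 := by ring
  nlinarith

/-- The difference of the two sides is exactly α (1 - α) ‖a - b‖². -/
theorem norm_convex_sq_le (a b : H) {α : ℝ} (h0 : 0 ≤ α) (h1 : α ≤ 1) :
    ‖(1 - α) • a + α • b‖ ^ 2 ≤ (1 - α) * ‖a‖ ^ 2 + α * ‖b‖ ^ 2 := by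
  have h2 : (1 - α) * ‖a‖ ^ 2 + α * ‖b‖ ^ 2 - ‖(1 - α) • a + α • b‖ ^ 2
      = α * (1 - α) * ‖a - b‖ ^ 2 := by
    rw [norm_add_sq_real, norm_sub_sq_real, norm_smul, norm_smul, inner_smul_left, inner_smul_right,
      mul_pow, mul_pow, Real.norm_eq_abs, Real.norm_eq_abs, sq_abs, sq_abs, conj_trivial]
    ring
  have h3 : 0 ≤ α * (1 - α) * ‖a - b‖ ^ 2 :=
    mul_nonneg (mul_nonneg h0 (by linarith)) (sq_nonneg _)
  linarith

theorem norm_add_sq_of_orthogonal {a b : H} (h : inner ℝ a b = 0) :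
    ‖a + b‖ ^ 2 = ‖a‖ ^ 2 + ‖b‖ ^ 2 := by
  rw [norm_add_sq_real, h]; ring

/-- Adding a perturbation to a contraction. -/
theorem sum_norm_sq_add_le_of_contraction {a w : ι → H} {γ X : ℝ} (h0 : 0 < γ) (h1 : γ ≤ 1)
    (ha : ∑ i, ‖a i‖ ^ 2 ≤ (1 - γ) ^ 2 * X) :
    ∑ i, ‖a i + w i‖ ^ 2 ≤ (1 - γ) * X + 1 / γ * ∑ i, ‖w i‖ ^ 2 := by
  -- For γ = 1 the weight γ/(1-γ) is not available, but then all a i vanish.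
  rcases h1.eq_or_lt with rfl | h1
  · have h2 : ∑ i, ‖a i‖ ^ 2 ≤ 0 := by simpa using ha
    have h3 := (Finset.sum_eq_zero_iff_of_nonneg fun i _ => sq_nonneg ‖a i‖).1
      (le_antisymm h2 (Finset.sum_nonneg fun i _ => sq_nonneg ‖a i‖))
    have h4 : ∀ i, a i = 0 := fun i => by simpa using h3 i (Finset.mem_univ i)
    simp [h4]
  · have h2 : 0 < 1 - γ := by linarith
    have h3 : ∀ i, ‖a i + w i‖ ^ 2 ≤ 1 / (1 - γ) * ‖a i‖ ^ 2 + 1 / γ * ‖w i‖ ^ 2 := by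
      intro i
      -- This weight spends one of the two factors 1 - γ, so the rate 1 - γ remains and the
      -- perturbation is multiplied by 1/γ.
      have := norm_add_sq_le (a i) (w i) (s := γ / (1 - γ)) (by positivity)
      have e1 : 1 + γ / (1 - γ) = 1 / (1 - γ) := by field_simp; ring
      have e2 : 1 + 1 / (γ / (1 - γ)) = 1 / γ := by field_simp; ring
      rwa [e1, e2] at this
    refine (Finset.sum_le_sum fun i _ => h3 i).trans ?_
    rw [Finset.sum_add_distrib, ← Finset.mul_sum, ← Finset.mul_sum]
    have h4 : 1 / (1 - γ) * ∑ i, ‖a i‖ ^ 2 ≤ 1 / (1 - γ) * ((1 - γ) ^ 2 * X) := by gcongr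
    have h5 : 1 / (1 - γ) * ((1 - γ) ^ 2 * X) = (1 - γ) * X := by field_simp
    linarith

end Families

/-! ### Perturbed gossip in a Hilbert space and its consensus distance. -/

section PerturbedGossip

variable {ι H : Type*} [Fintype ι] [NormedAddCommGroup H] [InnerProductSpace ℝ H]

/-- Gossip averaging with momentum in an inner product space (of square integrable random vectors):
`x` models, `m` momenta, `N` gradient noise, `b` and `c` errors of the communication,
`gl t i = ∇f_i(x_i^t)`, `hl t i = ∇f_i(x̄^t)`, `h t = ∇f(x̄^t)`; `P t` are the vectors that are
known before step `t`. -/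
structure IsPerturbedGossip (A : Matrix ι ι ℝ) (γ δ L σ ζ α η : ℝ) (P : ℕ → Submodule ℝ H)
    (x m gl hl N b c : ℕ → ι → H) (h : ℕ → H) : Prop where
  col_sum : ∀ j, ∑ i, A i j = 1
  row_sum : ∀ i, ∑ j, A i j = 1
  contraction : ∀ u : ι → H, ∑ i, u i = 0 →
    ∑ i, ‖∑ j, A i j • u j‖ ^ 2 ≤ (1 - γ) ^ 2 * ∑ i, ‖u i‖ ^ 2
  x_zero : ∀ i j, x 0 i = x 0 j
  m_zero : ∀ i, m 0 i = 0
  m_succ : ∀ t i, m (t + 1) i = (1 - α) • m t i + α • (gl t i + N t i)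
  x_succ : ∀ t i, x (t + 1) i = ∑ j, A i j • (x t j - η • m (t + 1) j) + (b t i + c t i)
  m_mem : ∀ t i, m t i ∈ P t
  gl_mem : ∀ t i, gl t i ∈ P t
  h_mem : ∀ t, h t ∈ P t
  noise_orthogonal : ∀ t i, ∀ k ∈ P t, inner ℝ k (N t i) = 0
  noise_pairwise : ∀ t i j, i ≠ j → inner ℝ (N t i) (N t j) = 0
  noise_sq : ∀ t i, ‖N t i‖ ^ 2 ≤ σ ^ 2
  c_orthogonal : ∀ t, inner ℝ (h t) (mean (c t)) = 0
  c_sq : ∀ t i, ‖c t i‖ ^ 2 ≤ 2 * η ^ 2 * α ^ 2 * σ ^ 2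
  c_mean_sq : ∀ t, ‖mean (c t)‖ ^ 2 ≤ 2 * η ^ 2 * α ^ 2 * σ ^ 2 / Fintype.card ι
  b_sq : ∀ t, ∑ i, ‖b t i‖ ^ 2 ≤ 16 * δ * ∑ i, ‖dev (fun i => x t i - η • m (t + 1) i) i‖ ^ 2
  smooth : ∀ t i, ‖gl t i - hl t i‖ ≤ L * ‖dev (x t) i‖
  mean_hl : ∀ t, mean (hl t) = h t
  heterogeneity : ∀ t, ∑ i, ‖dev (hl t) i‖ ^ 2 ≤ Fintype.card ι * ζ ^ 2
  h_lipschitz : ∀ t, ‖h (t + 1) - h t‖ ≤ L * ‖mean (x (t + 1)) - mean (x t)‖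

namespace IsPerturbedGossip

variable {A : Matrix ι ι ℝ} {γ δ L σ ζ α η : ℝ} {P : ℕ → Submodule ℝ H}
  {x m gl hl N b c : ℕ → ι → H} {h : ℕ → H}

/-- Noises of different workers are orthogonal, so Pythagoras gains the factor 1/n. -/
theorem mean_noise_sq_le [Nonempty ι] (S : IsPerturbedGossip A γ δ L σ ζ α η P x m gl hl N b c h)
    (t : ℕ) : ‖mean (N t)‖ ^ 2 ≤ σ ^ 2 / Fintype.card ι := by
  have hc : (0 : ℝ) < Fintype.card ι := by positivity
  have h1 : ‖∑ i, N t i‖ ^ 2 = ∑ i, ‖N t i‖ ^ 2 := by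
    rw [← real_inner_self_eq_norm_sq, sum_inner]
    refine Finset.sum_congr rfl fun i _ => ?_
    rw [inner_sum, Finset.sum_eq_single i (fun j _ hj => S.noise_pairwise t i j hj.symm)
      (by simp), real_inner_self_eq_norm_sq]
  have h2 : ∑ i, ‖N t i‖ ^ 2 ≤ Fintype.card ι * σ ^ 2 := by
    refine (Finset.sum_le_sum fun i _ => S.noise_sq t i).trans ?_
    simp
  rw [mean, norm_smul, mul_pow, h1, Real.norm_of_nonneg (by positivity), le_div_iff₀ hc]
  calc _ ≤ (1 / (Fintype.card ι : ℝ)) ^ 2 * (Fintype.card ι * σ ^ 2) * Fintype.card ι := by gcongr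
    _ = σ ^ 2 := by field_simp

theorem inner_mean_noise (S : IsPerturbedGossip A γ δ L σ ζ α η P x m gl hl N b c h)
    (t : ℕ) {k : H} (hk : k ∈ P t) : inner ℝ k (mean (N t)) = 0 := by
  rw [mean, inner_smul_right, inner_sum,
    Finset.sum_eq_zero fun j _ => S.noise_orthogonal t j _ hk, mul_zero]

theorem inner_dev_noise (S : IsPerturbedGossip A γ δ L σ ζ α η P x m gl hl N b c h)
    (t : ℕ) (i : ι) {k : H} (hk : k ∈ P t) : inner ℝ k (dev (N t) i) = 0 := by
  rw [dev, inner_sub_right, S.inner_mean_noise t hk, S.noise_orthogonal t i _ hk, sub_zero]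

/-- Gradients at the common point x̄ differ by the heterogeneity; moving them to the local models
costs L times the consensus distance. -/
theorem sum_dev_gl_sq_le [Nonempty ι]
    (S : IsPerturbedGossip A γ δ L σ ζ α η P x m gl hl N b c h) (t : ℕ) :
    ∑ i, ‖dev (gl t) i‖ ^ 2
      ≤ 2 * (Fintype.card ι * ζ ^ 2) + 2 * L ^ 2 * ∑ i, ‖dev (x t) i‖ ^ 2 := by
  have e : ∀ i, dev (gl t) i = dev (hl t) i + dev (fun i => gl t i - hl t i) i := by
    intro i
    rw [← dev_add]
    congr 1
    ext j
    abel
  have h1 : ∑ i, ‖dev (fun i => gl t i - hl t i) i‖ ^ 2 ≤ L ^ 2 * ∑ i, ‖dev (x t) i‖ ^ 2 := by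
    refine (sum_norm_sq_dev_le _).trans ?_
    rw [Finset.mul_sum]
    refine Finset.sum_le_sum fun i _ => ?_
    rw [← mul_pow]
    exact pow_le_pow_left₀ (norm_nonneg _) (S.smooth t i) 2
  calc ∑ i, ‖dev (gl t) i‖ ^ 2
      ≤ ∑ i, (2 * ‖dev (hl t) i‖ ^ 2 + 2 * ‖dev (fun i => gl t i - hl t i) i‖ ^ 2) := by
        refine Finset.sum_le_sum fun i _ => ?_
        rw [e]
        exact norm_add_sq_le_two _ _
    _ = 2 * ∑ i, ‖dev (hl t) i‖ ^ 2 + 2 * ∑ i, ‖dev (fun i => gl t i - hl t i) i‖ ^ 2 := by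
        rw [Finset.sum_add_distrib, Finset.mul_sum, Finset.mul_sum]
    _ ≤ _ := by linarith [S.heterogeneity t]

/-- The part known before the step is a convex combination of old momentum and gradient. The noise
is orthogonal to it and so enters with α² instead of α. -/
theorem sum_dev_m_sq_succ_le [Nonempty ι] (hα0 : 0 ≤ α) (hα1 : α ≤ 1)
    (S : IsPerturbedGossip A γ δ L σ ζ α η P x m gl hl N b c h) (t : ℕ) :
    ∑ i, ‖dev (m (t + 1)) i‖ ^ 2 ≤ (1 - α) * ∑ i, ‖dev (m t) i‖ ^ 2
      + α * (2 * (Fintype.card ι * ζ ^ 2) + 2 * L ^ 2 * ∑ i, ‖dev (x t) i‖ ^ 2)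
      + α ^ 2 * (Fintype.card ι * σ ^ 2) := by
  have e : ∀ i, dev (m (t + 1)) i
      = ((1 - α) • dev (m t) i + α • dev (gl t) i) + α • dev (N t) i := by
    intro i
    have : m (t + 1) = fun i => ((1 - α) • m t i + α • gl t i) + α • N t i := by
      ext i; rw [S.m_succ, smul_add]; abel
    rw [this, dev_add, dev_add, dev_smul, dev_smul, dev_smul]
  have hmem : ∀ i, (1 - α) • dev (m t) i + α • dev (gl t) i ∈ P t := fun i =>
    (P t).add_mem ((P t).smul_mem _ ((P t).sub_mem (S.m_mem t i) (mean_mem _ (S.m_mem t))))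
      ((P t).smul_mem _ ((P t).sub_mem (S.gl_mem t i) (mean_mem _ (S.gl_mem t))))
  have horth : ∀ i, inner ℝ ((1 - α) • dev (m t) i + α • dev (gl t) i) (α • dev (N t) i) = 0 := by
    intro i
    rw [inner_smul_right, S.inner_dev_noise t i (hmem i), mul_zero]
  have h1 : ∀ i, ‖dev (m (t + 1)) i‖ ^ 2 ≤ (1 - α) * ‖dev (m t) i‖ ^ 2 + α * ‖dev (gl t) i‖ ^ 2
      + α ^ 2 * ‖dev (N t) i‖ ^ 2 := by
    intro i
    rw [e, norm_add_sq_of_orthogonal (horth i), norm_smul α (dev (N t) i), mul_pow,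
      Real.norm_eq_abs, sq_abs]
    linarith [norm_convex_sq_le (dev (m t) i) (dev (gl t) i) hα0 hα1]
  have h2 : ∑ i, ‖dev (N t) i‖ ^ 2 ≤ Fintype.card ι * σ ^ 2 := by
    refine (sum_norm_sq_dev_le _).trans ((Finset.sum_le_sum fun i _ => S.noise_sq t i).trans ?_)
    simp
  refine (Finset.sum_le_sum fun i _ => h1 i).trans ?_
  rw [Finset.sum_add_distrib, Finset.sum_add_distrib, ← Finset.mul_sum, ← Finset.mul_sum,
    ← Finset.mul_sum]
  have h3 := mul_le_mul_of_nonneg_left (S.sum_dev_gl_sq_le t) hα0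
  have h4 := mul_le_mul_of_nonneg_left h2 (sq_nonneg α)
  linarith

/-- Mixing commutes with taking deviations. The contraction is applied to the models; the mixed
momenta and the errors b and c are treated as a perturbation. The factor 64 is 4 · 16, from two
splittings of the square and `b_sq`. -/
theorem sum_dev_x_sq_succ_le [Nonempty ι] (hγ0 : 0 < γ) (hγ1 : γ ≤ 1)
    (S : IsPerturbedGossip A γ δ L σ ζ α η P x m gl hl N b c h) (t : ℕ) :
    ∑ i, ‖dev (x (t + 1)) i‖ ^ 2 ≤ (1 - γ) * ∑ i, ‖dev (x t) i‖ ^ 2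
      + 1 / γ * (2 * η ^ 2 * ∑ i, ‖dev (m (t + 1)) i‖ ^ 2
        + 64 * δ * ∑ i, ‖dev (fun i => x t i - η • m (t + 1) i) i‖ ^ 2
        + 8 * (Fintype.card ι * (η ^ 2 * α ^ 2 * σ ^ 2))) := by
  have hmix : ∀ (u : ι → H) (i : ι), dev (fun i => ∑ j, A i j • u j) i = ∑ j, A i j • dev u j := by
    intro u i
    have h1 : mean (fun i => ∑ j, A i j • u j) = mean u := by
      rw [mean, Finset.sum_comm]
      simp_rw [← Finset.sum_smul, S.col_sum, one_smul]
      rfl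
    simp_rw [dev, h1, smul_sub, Finset.sum_sub_distrib, ← Finset.sum_smul, S.row_sum, one_smul]
  set w : ι → H := fun i =>
    -(η • ∑ j, A i j • dev (m (t + 1)) j) + dev (fun i => b t i + c t i) i with hw
  have e : ∀ i, dev (x (t + 1)) i = ∑ j, A i j • dev (x t) j + w i := by
    intro i
    have h1 : x (t + 1) = fun i => ∑ j, A i j • (x t j - η • m (t + 1) j) + (b t i + c t i) := by
      ext i; rw [S.x_succ]
    rw [h1, dev_add, hmix]
    simp only [hw, dev_sub, dev_smul, smul_sub, Finset.sum_sub_distrib, Finset.smul_sum,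
      smul_comm η]
    abel
  have h1 := S.contraction _ (sum_dev (x t))
  have h2 := S.contraction _ (sum_dev (m (t + 1)))
  have h3 : ∑ i, ‖w i‖ ^ 2 ≤ 2 * η ^ 2 * ∑ i, ‖dev (m (t + 1)) i‖ ^ 2
      + (4 * ∑ i, ‖b t i‖ ^ 2 + 4 * ∑ i, ‖c t i‖ ^ 2) := by
    have h4 : ∑ i, ‖w i‖ ^ 2 ≤ 2 * η ^ 2 * ∑ i, ‖∑ j, A i j • dev (m (t + 1)) j‖ ^ 2
        + 2 * ∑ i, ‖dev (fun i => b t i + c t i) i‖ ^ 2 := by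
      rw [Finset.mul_sum, Finset.mul_sum, ← Finset.sum_add_distrib]
      refine Finset.sum_le_sum fun i _ => ?_
      refine (norm_add_sq_le_two _ _).trans ?_
      rw [norm_neg, norm_smul, mul_pow, Real.norm_eq_abs, sq_abs]
      linarith
    have h5 : ∑ i, ‖dev (fun i => b t i + c t i) i‖ ^ 2
        ≤ 2 * ∑ i, ‖b t i‖ ^ 2 + 2 * ∑ i, ‖c t i‖ ^ 2 := by
      refine (sum_norm_sq_dev_le _).trans ?_
      rw [Finset.mul_sum, Finset.mul_sum, ← Finset.sum_add_distrib]
      exact Finset.sum_le_sum fun i _ => norm_add_sq_le_two _ _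
    have h6 : (1 - γ) ^ 2 * ∑ i, ‖dev (m (t + 1)) i‖ ^ 2 ≤ 1 * ∑ i, ‖dev (m (t + 1)) i‖ ^ 2 := by
      gcongr
      nlinarith
    have h7 : 2 * η ^ 2 * ∑ i, ‖∑ j, A i j • dev (m (t + 1)) j‖ ^ 2
        ≤ 2 * η ^ 2 * ∑ i, ‖dev (m (t + 1)) i‖ ^ 2 := by
      have := h2.trans (h6.trans_eq (one_mul _))
      gcongr
    linarith
  have h8 : ∑ i, ‖c t i‖ ^ 2 ≤ Fintype.card ι * (2 * η ^ 2 * α ^ 2 * σ ^ 2) := by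
    refine (Finset.sum_le_sum fun i _ => S.c_sq t i).trans ?_
    simp
  have h9 : ∑ i, ‖w i‖ ^ 2 ≤ 2 * η ^ 2 * ∑ i, ‖dev (m (t + 1)) i‖ ^ 2
        + 64 * δ * ∑ i, ‖dev (fun i => x t i - η • m (t + 1) i) i‖ ^ 2
        + 8 * (Fintype.card ι * (η ^ 2 * α ^ 2 * σ ^ 2)) := by
    have := S.b_sq t
    linarith
  simp_rw [e]
  refine (sum_norm_sq_add_le_of_contraction hγ0 hγ1 h1).trans ?_
  gcongr

/-- The consensus distance stays bounded. -/
theorem consensus_le [Nonempty ι] (hL : 0 < L) (hγ0 : 0 < γ) (hγ1 : γ ≤ 1)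
    (hδ : δ ≤ γ ^ 2 / 10240) (hη : 0 < η) (hηL : η * L ≤ 3 * γ / 40) (hα : α = 3 * η * L)
    (S : IsPerturbedGossip A γ δ L σ ζ α η P x m gl hl N b c h) (t : ℕ) :
    ∑ i, ‖dev (x t) i‖ ^ 2
        ≤ Fintype.card ι * (5 * η ^ 2 * (ζ ^ 2 + α * σ ^ 2) / γ ^ 2) ∧
      ∑ i, ‖dev (m t) i‖ ^ 2
        ≤ Fintype.card ι * (2 * ζ ^ 2 + α * σ ^ 2 + (ζ ^ 2 + α * σ ^ 2) * (9 / 160)) := by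
  have hηL0 : 0 < η * L := mul_pos hη hL
  have hα0 : 0 < α := by rw [hα]; linarith
  have hα1 : α ≤ 9 / 40 := by rw [hα]; linarith
  set n : ℝ := (Fintype.card ι : ℝ) with hn
  have hn0 : 0 < n := by rw [hn]; positivity
  set K : ℝ := ζ ^ 2 + α * σ ^ 2 with hK
  have hK0 : 0 ≤ K := by positivity
  have hs0 : 0 ≤ α * σ ^ 2 := by positivity
  -- Models and momenta are bounded together: X and a are levels per worker that the two coupled
  -- recursions do not exceed.
  set X : ℝ := 5 * η ^ 2 * K / γ ^ 2 with hX
  have hX0 : 0 ≤ X := by positivity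
  have hγX : γ ^ 2 * X = 5 * η ^ 2 * K := by rw [hX]; field_simp
  have hLX : 2 * L ^ 2 * X ≤ K * (9 / 160) := by
    have h1 : (η * L) ^ 2 ≤ (3 * γ / 40) ^ 2 := pow_le_pow_left₀ hηL0.le hηL 2
    have h2 : 2 * L ^ 2 * X = 10 * (η * L) ^ 2 * K / γ ^ 2 := by rw [hX]; ring
    rw [h2, div_le_iff₀ (by positivity)]
    nlinarith [mul_le_mul_of_nonneg_right h1 hK0]
  set a : ℝ := 2 * ζ ^ 2 + α * σ ^ 2 + K * (9 / 160) with ha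
  have ha0 : 0 ≤ a := by positivity
  induction t with
  | zero =>
    have hx : ∀ i, dev (x 0) i = 0 := by
      intro i
      have : x 0 = fun _ => x 0 i := funext fun j => S.x_zero j i
      rw [dev, this, mean_const, sub_self]
    have hm : ∀ i, dev (m 0) i = 0 := by
      intro i
      have : m 0 = fun _ => 0 := funext fun j => S.m_zero j
      rw [dev, this, mean_const, sub_self]
    simp only [hx, hm]
    constructor <;> simp <;> positivity
  | succ t ih =>
    obtain ⟨ihx, ihm⟩ := ih
    have hm : ∑ i, ‖dev (m (t + 1)) i‖ ^ 2 ≤ n * a := by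
      have h1 := S.sum_dev_m_sq_succ_le hα0.le (by linarith) t
      have h2 : (1 - α) * ∑ i, ‖dev (m t) i‖ ^ 2 ≤ (1 - α) * (n * a) :=
        mul_le_mul_of_nonneg_left ihm (by linarith)
      have h3 : 2 * L ^ 2 * ∑ i, ‖dev (x t) i‖ ^ 2 ≤ n * (K * (9 / 160)) := by
        calc 2 * L ^ 2 * ∑ i, ‖dev (x t) i‖ ^ 2 ≤ 2 * L ^ 2 * (n * X) := by gcongr
          _ = n * (2 * L ^ 2 * X) := by ring
          _ ≤ _ := by gcongr
      have h4 : α * (2 * (n * ζ ^ 2) + 2 * L ^ 2 * ∑ i, ‖dev (x t) i‖ ^ 2)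
          ≤ α * (2 * (n * ζ ^ 2) + n * (K * (9 / 160))) := by gcongr
      -- The level a is a fixed point of the momentum recursion. The momentum bound at time t + 1
      -- comes first because the model update uses the new momentum.
      have h5 : (1 - α) * (n * a) + α * (2 * (n * ζ ^ 2) + n * (K * (9 / 160)))
          + α ^ 2 * (n * σ ^ 2) = n * a := by rw [ha]; ring
      linarith
    refine ⟨?_, hm⟩
    have h1 := S.sum_dev_x_sq_succ_le hγ0 hγ1 t
    have h2 := sum_norm_sq_dev_sub_smul_le (x t) (m (t + 1)) η
    set Y := ∑ i, ‖dev (fun i => x t i - η • m (t + 1) i) i‖ ^ 2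
    have h3 : Y ≤ n * (2 * X + 2 * η ^ 2 * a) := by
      have h4 : 2 * η ^ 2 * ∑ i, ‖dev (m (t + 1)) i‖ ^ 2 ≤ 2 * η ^ 2 * (n * a) := by gcongr
      linarith
    have h5 : 64 * δ * Y ≤ 64 * (γ ^ 2 / 10240) * (n * (2 * X + 2 * η ^ 2 * a)) := by
      gcongr
    have hg : γ ^ 2 ≤ 1 := by nlinarith
    have h6 : 2 * η ^ 2 * ∑ i, ‖dev (m (t + 1)) i‖ ^ 2 ≤ 2 * η ^ 2 * (n * a) := by gcongr
    -- The perturbation is at most γ² n X, so after the factor 1/γ it refills at most the γ n X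
    -- removed by the contraction. With 64 δ ≤ γ²/160 the Byzantine term takes only a small share of
    -- it.
    have h7 : 2 * η ^ 2 * (n * a) + 64 * (γ ^ 2 / 10240) * (n * (2 * X + 2 * η ^ 2 * a))
        + 8 * (n * (η ^ 2 * α ^ 2 * σ ^ 2)) ≤ n * (γ ^ 2 * X) := by
      have e1 : 2 * η ^ 2 * (n * a) + 64 * (γ ^ 2 / 10240) * (n * (2 * X + 2 * η ^ 2 * a))
        + 8 * (n * (η ^ 2 * α ^ 2 * σ ^ 2))
        = n * (2 * η ^ 2 * a + (γ ^ 2 * X) / 80 + γ ^ 2 * (η ^ 2 * a) / 80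
          + 8 * η ^ 2 * (α * (α * σ ^ 2))) := by ring
      rw [e1, hγX]
      refine mul_le_mul_of_nonneg_left ?_ hn0.le
      have e2 : γ ^ 2 * (η ^ 2 * a) ≤ 1 * (η ^ 2 * a) := by gcongr
      have e3 : α * (α * σ ^ 2) ≤ 9 / 40 * (α * σ ^ 2) := by gcongr
      have e4 : 2 * a + K / 16 + a / 80 + 8 * (9 / 40 * (α * σ ^ 2)) ≤ 5 * K := by
        rw [ha, hK]
        linarith [sq_nonneg ζ, hs0]
      have e5 := mul_le_mul_of_nonneg_left e4 (sq_nonneg η)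
      have e6 := mul_le_mul_of_nonneg_left e3 (sq_nonneg η)
      linarith
    have h8 : 1 / γ * (2 * η ^ 2 * ∑ i, ‖dev (m (t + 1)) i‖ ^ 2 + 64 * δ * Y
        + 8 * (n * (η ^ 2 * α ^ 2 * σ ^ 2))) ≤ 1 / γ * (n * (γ ^ 2 * X)) := by
      gcongr
      linarith
    have h9 : 1 / γ * (n * (γ ^ 2 * X)) = γ * (n * X) := by field_simp
    have h10 : (1 - γ) * ∑ i, ‖dev (x t) i‖ ^ 2 ≤ (1 - γ) * (n * X) :=
      mul_le_mul_of_nonneg_left ihx (by linarith)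
    linarith

end IsPerturbedGossip

end PerturbedGossip

end ClippedGossip

end

noncomputable section

namespace ClippedGossip

/-! ### Decrease of the objective and of the momentum error. -/

namespace IsPerturbedGossip

variable {ι H : Type*} [Fintype ι] [NormedAddCommGroup H] [InnerProductSpace ℝ H]
  {A : Matrix ι ι ℝ} {γ δ L σ ζ α η : ℝ} {P : ℕ → Submodule ℝ H}
  {x m gl hl N b c : ℕ → ι → H} {h : ℕ → H}

/-- Column sums equal to 1 mean that exact gossip preserves the average, so only the momentum and
the errors move it. -/
theorem mean_x_succ (S : IsPerturbedGossip A γ δ L σ ζ α η P x m gl hl N b c h) (t : ℕ) :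
    mean (x (t + 1)) - mean (x t)
      = -(η • mean (m (t + 1)) - mean (b t)) + mean (c t) := by
  have h1 : x (t + 1) = fun i => ∑ j, A i j • (x t j - η • m (t + 1) j) + (b t i + c t i) := by
    ext i; rw [S.x_succ]
  have h2 : mean (fun i => ∑ j, A i j • (x t j - η • m (t + 1) j))
      = mean (x t) - η • mean (m (t + 1)) := by
    rw [← mean_smul, ← mean_sub, mean, Finset.sum_comm]
    simp_rw [← Finset.sum_smul, S.col_sum, one_smul]
    rfl
  rw [h1, mean_add, mean_add, h2]
  abel

/-- All workers start at one point, so their average gradient is exactly h 0. With zero initial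
momentum the error is -(1 - α) h 0 plus α times the average noise; this is the initial value in the
potential argument. -/
theorem norm_mean_m_one_sub_sq_le [Nonempty ι] (hα0 : 0 ≤ α) (hα1 : α ≤ 1)
    (S : IsPerturbedGossip A γ δ L σ ζ α η P x m gl hl N b c h) :
    ‖mean (m 1) - h 0‖ ^ 2 ≤ ‖h 0‖ ^ 2 + α ^ 2 * (σ ^ 2 / Fintype.card ι) := by
  have hx : ∀ i, dev (x 0) i = 0 := by
    intro i
    have : x 0 = fun _ => x 0 i := funext fun j => S.x_zero j i
    rw [dev, this, mean_const, sub_self]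
  have hgl : mean (gl 0) = h 0 := by
    rw [← S.mean_hl]
    congr 1
    ext i
    have := S.smooth 0 i
    rw [hx, norm_zero, mul_zero] at this
    exact sub_eq_zero.1 (norm_le_zero_iff.1 this)
  have e : mean (m 1) - h 0 = (-(1 - α)) • h 0 + α • mean (N 0) := by
    have h1 : m 1 = fun i => α • (gl 0 i + N 0 i) := by
      ext i; rw [S.m_succ 0 i, S.m_zero, smul_zero, zero_add]
    rw [h1, mean_smul, mean_add, hgl, neg_smul, sub_smul, one_smul, smul_add]
    abel
  have horth : inner ℝ ((-(1 - α)) • h 0) (α • mean (N 0)) = 0 := by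
    rw [inner_smul_right, S.inner_mean_noise 0 ((P 0).smul_mem _ (S.h_mem 0)), mul_zero]
  rw [e, norm_add_sq_of_orthogonal horth, norm_smul, norm_smul, mul_pow, mul_pow,
    Real.norm_eq_abs, Real.norm_eq_abs, sq_abs, sq_abs]
  have h2 : (-(1 - α)) ^ 2 * ‖h 0‖ ^ 2 ≤ 1 * ‖h 0‖ ^ 2 := by
    gcongr
    nlinarith
  have h3 := mul_le_mul_of_nonneg_left (S.mean_noise_sq_le 0) (sq_nonneg α)
  linarith

/-- The new error is (1 - α) times the old error plus gradient drift, plus α times the gradient bias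
from disagreement, plus orthogonal noise. The drift may cost a factor 1/α because the potential pays
for it with the movement of the average model. -/
theorem norm_mean_m_sub_sq_succ_le [Nonempty ι] (hα0 : 0 < α) (hα1 : α ≤ 1)
    (S : IsPerturbedGossip A γ δ L σ ζ α η P x m gl hl N b c h) (t : ℕ) :
    ‖mean (m (t + 2)) - h (t + 1)‖ ^ 2 ≤ (1 - 7 / 10 * α) * ‖mean (m (t + 1)) - h t‖ ^ 2
      + 10 / (3 * α) * (L ^ 2 * ‖mean (x (t + 1)) - mean (x t)‖ ^ 2)
      + α * (L ^ 2 * ((∑ i, ‖dev (x (t + 1)) i‖ ^ 2) / Fintype.card ι))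
      + α ^ 2 * (σ ^ 2 / Fintype.card ι) := by
  have hc : (0 : ℝ) < Fintype.card ι := by positivity
  set M := mean (m (t + 1)) - h t with hM
  set D := h t - h (t + 1) with hD
  set B := mean (gl (t + 1)) - h (t + 1) with hB
  have e : mean (m (t + 2)) - h (t + 1)
      = ((1 - α) • (M + D) + α • B) + α • mean (N (t + 1)) := by
    have h1 : m (t + 2)
        = fun i => (1 - α) • m (t + 1) i + α • (gl (t + 1) i + N (t + 1) i) := by
      ext i; rw [S.m_succ (t + 1) i]
    rw [h1, mean_add, mean_smul, mean_smul, mean_add, hM, hD, hB]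
    module
  have hmem : (1 - α) • (M + D) + α • B ∈ P (t + 1) := by
    have h1 : M + D = mean (m (t + 1)) - h (t + 1) := by rw [hM, hD]; abel
    rw [h1]
    exact (P (t + 1)).add_mem ((P (t + 1)).smul_mem _ ((P (t + 1)).sub_mem
      (mean_mem _ (S.m_mem (t + 1))) (S.h_mem (t + 1)))) ((P (t + 1)).smul_mem _
      ((P (t + 1)).sub_mem (mean_mem _ (S.gl_mem (t + 1))) (S.h_mem (t + 1))))
  have horth : inner ℝ ((1 - α) • (M + D) + α • B) (α • mean (N (t + 1))) = 0 := by
    rw [inner_smul_right, S.inner_mean_noise (t + 1) hmem, mul_zero]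
  have hB2 : ‖B‖ ^ 2 ≤ L ^ 2 * ((∑ i, ‖dev (x (t + 1)) i‖ ^ 2) / Fintype.card ι) := by
    have h1 : B = mean (fun i => gl (t + 1) i - hl (t + 1) i) := by rw [mean_sub, S.mean_hl]
    rw [h1, ← mul_div_assoc, le_div_iff₀ hc, mul_comm, Finset.mul_sum]
    refine (card_mul_norm_sq_mean_le _).trans (Finset.sum_le_sum fun i _ => ?_)
    rw [← mul_pow]
    exact pow_le_pow_left₀ (norm_nonneg _) (S.smooth (t + 1) i) 2
  have hD2 : ‖D‖ ^ 2 ≤ L ^ 2 * ‖mean (x (t + 1)) - mean (x t)‖ ^ 2 := by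
    rw [← mul_pow, hD, norm_sub_rev]
    exact pow_le_pow_left₀ (norm_nonneg _) (S.h_lipschitz t) 2
  have hMD : (1 - α) * ‖M + D‖ ^ 2
      ≤ (1 - 7 / 10 * α) * ‖M‖ ^ 2 + 10 / (3 * α) * ‖D‖ ^ 2 := by
    rw [norm_add_sq_real]
    -- Young's inequality gives up 3α/10 of the contraction; the remaining 7α/10 is what the
    -- potential needs when α = 3ηL.
    have h1 := two_inner_le M ((1 - α) • D) (s := 3 / 10 * α) (by positivity)
    rw [inner_smul_right, norm_smul, mul_pow, Real.norm_eq_abs, sq_abs] at h1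
    have h2 : (1 - α) * ‖D‖ ^ 2 + (1 - α) ^ 2 * ‖D‖ ^ 2 / (3 / 10 * α)
        ≤ 10 / (3 * α) * ‖D‖ ^ 2 := by
      have h3 : 10 / (3 * α) * ‖D‖ ^ 2
          - ((1 - α) * ‖D‖ ^ 2 + (1 - α) ^ 2 * ‖D‖ ^ 2 / (3 / 10 * α))
          = (17 - 7 * α) / 3 * ‖D‖ ^ 2 := by
        field_simp
        ring
      have h4 : 0 ≤ (17 - 7 * α) / 3 * ‖D‖ ^ 2 :=
        mul_nonneg (by linarith) (sq_nonneg _)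
      linarith
    nlinarith
  rw [e, norm_add_sq_of_orthogonal horth, norm_smul α (mean _), mul_pow, Real.norm_eq_abs, sq_abs]
  have h1 := norm_convex_sq_le (M + D) B hα0.le hα1
  have h2 := mul_le_mul_of_nonneg_left (S.mean_noise_sq_le (t + 1)) (sq_nonneg α)
  have h3 := mul_le_mul_of_nonneg_left hB2 hα0.le
  have h4 : 10 / (3 * α) * ‖D‖ ^ 2
      ≤ 10 / (3 * α) * (L ^ 2 * ‖mean (x (t + 1)) - mean (x t)‖ ^ 2) := by gcongr
  linarith

/-- Decrease of the objective in one step, in terms of `v = m̄ - b̄ / η`. -/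
theorem objective_succ_le (hL : 0 < L) (hη : 0 < η) {φ : ℕ → ℝ}
    (hφ : ∀ t, φ (t + 1) ≤ φ t + inner ℝ (h t) (mean (x (t + 1)) - mean (x t))
      + L / 2 * ‖mean (x (t + 1)) - mean (x t)‖ ^ 2)
    (S : IsPerturbedGossip A γ δ L σ ζ α η P x m gl hl N b c h) (t : ℕ) :
    φ (t + 1) ≤ φ t - η / 2 * ‖h t‖ ^ 2
      - η / 2 * (1 - 2 * (η * L)) * ‖mean (m (t + 1)) - (1 / η) • mean (b t)‖ ^ 2
      + η / 2 * (21 / 20 * ‖mean (m (t + 1)) - h t‖ ^ 2 + 21 * (‖mean (b t)‖ ^ 2 / η ^ 2))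
      + L * ‖mean (c t)‖ ^ 2 := by
  set v := mean (m (t + 1)) - (1 / η) • mean (b t) with hv
  -- The error b may correlate with the gradient, so it is absorbed into the direction v. The error
  -- c is orthogonal to h t and leaves only its square.
  have hΔ : mean (x (t + 1)) - mean (x t) = -(η • v) + mean (c t) := by
    rw [S.mean_x_succ, hv, smul_sub, smul_smul, mul_one_div_cancel hη.ne', one_smul]
  have h1 := hφ t
  rw [hΔ, inner_add_right, S.c_orthogonal, inner_neg_right, inner_smul_right] at h1
  have h2 := norm_add_sq_le_two (-(η • v)) (mean (c t))
  rw [norm_neg, norm_smul, mul_pow, Real.norm_eq_abs, sq_abs] at h2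
  -- Polarization produces the negative term in ‖v‖², which later pays for the drift of the
  -- gradient.
  have h3 : inner ℝ (h t) v = 1 / 2 * ‖h t‖ ^ 2 + 1 / 2 * ‖v‖ ^ 2 - 1 / 2 * ‖v - h t‖ ^ 2 := by
    rw [norm_sub_sq_real v (h t), real_inner_comm v]
    ring
  have h4 : ‖v - h t‖ ^ 2
      ≤ 21 / 20 * ‖mean (m (t + 1)) - h t‖ ^ 2 + 21 * (‖mean (b t)‖ ^ 2 / η ^ 2) := by
    have e : v - h t = (mean (m (t + 1)) - h t) + (-((1 / η) • mean (b t))) := by rw [hv]; abel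
    rw [e]
    refine (norm_add_sq_le _ _ (s := 1 / 20) (by norm_num)).trans (le_of_eq ?_)
    rw [norm_neg, norm_smul, mul_pow, Real.norm_eq_abs, sq_abs]
    field_simp
    ring
  rw [h3] at h1
  have h5 := mul_le_mul_of_nonneg_left h2 (half_pos hL).le
  have h6 := mul_le_mul_of_nonneg_left h4 (half_pos hη).le
  linarith

theorem norm_mean_x_succ_sub_sq_le (hη : 0 < η)
    (S : IsPerturbedGossip A γ δ L σ ζ α η P x m gl hl N b c h) (t : ℕ) :
    ‖mean (x (t + 1)) - mean (x t)‖ ^ 2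
      ≤ 3 / 2 * η ^ 2 * ‖mean (m (t + 1)) - (1 / η) • mean (b t)‖ ^ 2
        + 3 * ‖mean (c t)‖ ^ 2 := by
  have hΔ : mean (x (t + 1)) - mean (x t)
      = -(η • (mean (m (t + 1)) - (1 / η) • mean (b t))) + mean (c t) := by
    rw [S.mean_x_succ, smul_sub, smul_smul, mul_one_div_cancel hη.ne', one_smul]
  rw [hΔ]
  refine (norm_add_sq_le _ _ (s := 1 / 2) (by norm_num)).trans (le_of_eq ?_)
  rw [norm_neg, norm_smul, mul_pow, Real.norm_eq_abs, sq_abs]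
  ring

/-- The sum of the squared gradient norms, for given bounds of the error terms. -/
theorem sum_norm_h_sq_le_of_bounds [Nonempty ι] (hL : 0 < L) (hη : 0 < η)
    (hηL : η * L ≤ 3 / 40) (hα : α = 3 * η * L) {φ : ℕ → ℝ} {fs β C X : ℝ}
    (hφ : ∀ t, φ (t + 1) ≤ φ t + inner ℝ (h t) (mean (x (t + 1)) - mean (x t))
      + L / 2 * ‖mean (x (t + 1)) - mean (x t)‖ ^ 2)
    (hfs : ∀ t, fs ≤ φ t) (h0 : ‖h 0‖ ^ 2 ≤ 2 * L * (φ 0 - fs))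
    (S : IsPerturbedGossip A γ δ L σ ζ α η P x m gl hl N b c h)
    (hβ : ∀ t, ‖mean (b t)‖ ^ 2 ≤ β) (hC : ∀ t, ‖mean (c t)‖ ^ 2 ≤ C)
    (hX : ∀ t, (∑ i, ‖dev (x t) i‖ ^ 2) / Fintype.card ι ≤ X) (T : ℕ) :
    η / 2 * ∑ t ∈ Finset.range (T + 1), ‖h t‖ ^ 2 ≤ 3 / 2 * (φ 0 - fs)
      + (T + 1) * (21 / 2 * (β / η) + L * C + 5 / 2 * (L * C / α)
        + (α * (L ^ 2 * X) + α ^ 2 * (σ ^ 2 / Fintype.card ι)) / (4 * L)) := by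
  have hηL0 : 0 < η * L := mul_pos hη hL
  have hα0 : 0 < α := by rw [hα]; linarith
  have hα1 : α ≤ 1 := by rw [hα]; linarith
  have hC0 : 0 ≤ C := (sq_nonneg _).trans (hC 0)
  have hX0 : 0 ≤ X := le_trans (by positivity) (hX 0)
  set ν := α * (L ^ 2 * X) + α ^ 2 * (σ ^ 2 / Fintype.card ι) with hν
  set κ := 21 / 2 * (β / η) + L * C with hκ
  have hstep : ∀ t, φ (t + 1) + η / 2 * ‖h t‖ ^ 2
      + η / 2 * (1 - 2 * (η * L)) * ‖mean (m (t + 1)) - (1 / η) • mean (b t)‖ ^ 2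
      ≤ φ t + η / 2 * (21 / 20 * ‖mean (m (t + 1)) - h t‖ ^ 2) + κ := by
    intro t
    have h1 := S.objective_succ_le hL hη hφ t
    have h2 := mul_le_mul_of_nonneg_left (hC t) hL.le
    have h3 : η / 2 * (21 * (‖mean (b t)‖ ^ 2 / η ^ 2)) ≤ 21 / 2 * (β / η) := by
      have : η / 2 * (21 * (‖mean (b t)‖ ^ 2 / η ^ 2)) = 21 / 2 * (‖mean (b t)‖ ^ 2 / η) := by
        field_simp
      rw [this]
      have := hβ t
      gcongr
    linarith
  -- The weight 1/(4L) fits α = 3ηL: the loss 7α/10 · 1/(4L) equals η/2 · 21/20, the coefficient of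
  -- the momentum error in the descent inequality, so the two cancel.
  have hMstep : ∀ t, 1 / (4 * L) * ‖mean (m (t + 2)) - h (t + 1)‖ ^ 2
      + η / 2 * (21 / 20 * ‖mean (m (t + 1)) - h t‖ ^ 2)
      ≤ 1 / (4 * L) * ‖mean (m (t + 1)) - h t‖ ^ 2
        + 5 / 12 * η * ‖mean (m (t + 1)) - (1 / η) • mean (b t)‖ ^ 2
        + 5 / 2 * (L * C / α) + ν / (4 * L) := by
    intro t
    have h1 := S.norm_mean_m_sub_sq_succ_le hα0 hα1 t
    have h2 := S.norm_mean_x_succ_sub_sq_le hη t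
    set v := mean (m (t + 1)) - (1 / η) • mean (b t)
    set M := mean (m (t + 1)) - h t
    have h3 : 10 / (3 * α) * (L ^ 2 * ‖mean (x (t + 1)) - mean (x t)‖ ^ 2)
        ≤ 10 / (3 * α) * (L ^ 2 * (3 / 2 * η ^ 2 * ‖v‖ ^ 2 + 3 * C)) := by
      have := h2.trans (add_le_add_right (mul_le_mul_of_nonneg_left (hC t) (by norm_num : (0:ℝ) ≤ 3)) _)
      gcongr
    have h4 : α * (L ^ 2 * ((∑ i, ‖dev (x (t + 1)) i‖ ^ 2) / Fintype.card ι))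
        ≤ α * (L ^ 2 * X) := by
      have := hX (t + 1)
      gcongr
    have h5 : ‖mean (m (t + 2)) - h (t + 1)‖ ^ 2 ≤ (1 - 7 / 10 * α) * ‖M‖ ^ 2
        + 10 / (3 * α) * (L ^ 2 * (3 / 2 * η ^ 2 * ‖v‖ ^ 2 + 3 * C)) + ν := by linarith
    have h6 := mul_le_mul_of_nonneg_left h5 (by positivity : 0 ≤ 1 / (4 * L))
    have h7 : 1 / (4 * L) * ((1 - 7 / 10 * α) * ‖M‖ ^ 2
        + 10 / (3 * α) * (L ^ 2 * (3 / 2 * η ^ 2 * ‖v‖ ^ 2 + 3 * C)) + ν)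
        = 1 / (4 * L) * ‖M‖ ^ 2 - η / 2 * (21 / 20 * ‖M‖ ^ 2)
          + 5 / 12 * η * ‖v‖ ^ 2 + 5 / 2 * (L * C / α) + ν / (4 * L) := by
      rw [hα]
      field_simp
      ring
    linarith
  -- The drift costs 5η/12 ‖v‖², while descent provides η/2 (1 - 2ηL) ‖v‖²; this needs ηL ≤ 1/12,
  -- and 3/40 is smaller.
  have hV : ∀ v : H, 5 / 12 * η * ‖v‖ ^ 2 ≤ η / 2 * (1 - 2 * (η * L)) * ‖v‖ ^ 2 := by
    intro v
    refine mul_le_mul_of_nonneg_right ?_ (sq_nonneg _)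
    nlinarith
  have hpot : ∀ t : ℕ, φ t + 1 / (4 * L) * ‖mean (m (t + 1)) - h t‖ ^ 2
      + η / 2 * ∑ s ∈ Finset.range t, ‖h s‖ ^ 2 ≤ fs + 3 / 2 * (φ 0 - fs)
        + α ^ 2 * (σ ^ 2 / Fintype.card ι) / (4 * L)
        + t * (κ + 5 / 2 * (L * C / α) + ν / (4 * L)) := by
    intro t
    induction t with
    | zero =>
      -- Initially ‖h 0‖²/(4L) is at most half of the initial gap, which explains the factor 3/2.
      have h1 := (S.norm_mean_m_one_sub_sq_le hα0.le hα1).trans (add_le_add_left h0 _)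
      have h2 := mul_le_mul_of_nonneg_left h1 (by positivity : 0 ≤ 1 / (4 * L))
      have h3 : 1 / (4 * L) * (2 * L * (φ 0 - fs) + α ^ 2 * (σ ^ 2 / Fintype.card ι))
          = 1 / 2 * (φ 0 - fs) + α ^ 2 * (σ ^ 2 / Fintype.card ι) / (4 * L) := by
        field_simp
        ring
      simp only [Finset.range_zero, Finset.sum_empty, Nat.cast_zero, zero_mul, mul_zero, add_zero,
        zero_add]
      linarith
    | succ t ih =>
      rw [Finset.sum_range_succ, mul_add]
      push_cast
      have h1 := hstep t
      have h2 := hMstep t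
      have h3 := hV (mean (m (t + 1)) - (1 / η) • mean (b t))
      linarith
  -- The last step uses only the descent of φ; its momentum error is paid by the potential at time
  -- T.
  have h1 := hpot T
  have h2 := hstep T
  have h3 := hV (mean (m (T + 1)) - (1 / η) • mean (b T))
  have h4 : η / 2 * (21 / 20 * ‖mean (m (T + 1)) - h T‖ ^ 2)
      ≤ 1 / (4 * L) * ‖mean (m (T + 1)) - h T‖ ^ 2 := by
    rw [← mul_assoc]
    refine mul_le_mul_of_nonneg_right ?_ (sq_nonneg _)
    rw [le_div_iff₀ (by positivity)]
    linarith
  have h5 := hfs (T + 1)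
  have h6 : 0 ≤ 5 / 12 * η * ‖mean (m (T + 1)) - (1 / η) • mean (b T)‖ ^ 2 := by positivity
  -- The momentum recursion is used T times only. The noise of the initial momentum takes the place
  -- of the missing (T+1)-st error term.
  have h7 : α ^ 2 * (σ ^ 2 / Fintype.card ι) / (4 * L) ≤ ν / (4 * L) := by
    have : 0 ≤ α * (L ^ 2 * X) := by positivity
    gcongr
    linarith
  have h8 : 0 ≤ 5 / 2 * (L * C / α) := by positivity
  rw [Finset.sum_range_succ, mul_add]
  linarith

/-- The average squared gradient norm, before the choice of the step size. -/
theorem average_norm_h_sq_le [Nonempty ι] (hL : 0 < L) (hγ0 : 0 < γ) (hγ1 : γ ≤ 1) (hδ0 : 0 ≤ δ)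
    (hδ : δ ≤ γ ^ 2 / 10240) (hη : 0 < η) (hηL : η * L ≤ 3 * γ / 40) (hα : α = 3 * η * L)
    {φ : ℕ → ℝ} {fs : ℝ}
    (hφ : ∀ t, φ (t + 1) ≤ φ t + inner ℝ (h t) (mean (x (t + 1)) - mean (x t))
      + L / 2 * ‖mean (x (t + 1)) - mean (x t)‖ ^ 2)
    (hfs : ∀ t, fs ≤ φ t) (h0 : ‖h 0‖ ^ 2 ≤ 2 * L * (φ 0 - fs))
    (S : IsPerturbedGossip A γ δ L σ ζ α η P x m gl hl N b c h) (T : ℕ) :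
    1 / ((T : ℝ) + 1) * ∑ t ∈ Finset.range (T + 1), ‖h t‖ ^ 2
      ≤ 3 * (φ 0 - fs) / (η * (T + 1)) + 9 * η * L * σ ^ 2 / Fintype.card ι
        + (5040 * δ / γ ^ 2 + 15 / 2 * (η * L) ^ 2 / γ ^ 2) * (ζ ^ 2 + 3 * η * L * σ ^ 2) := by
  have hηL0 : 0 < η * L := mul_pos hη hL
  have hα0 : 0 < α := by rw [hα]; linarith
  have hα1 : α ≤ 9 / 40 := by rw [hα]; linarith
  set n : ℝ := (Fintype.card ι : ℝ) with hn
  have hn0 : 0 < n := by rw [hn]; positivity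
  set K : ℝ := ζ ^ 2 + α * σ ^ 2 with hK
  have hK0 : 0 ≤ K := by positivity
  have hs0 : 0 ≤ α * σ ^ 2 := by positivity
  have hβ : ∀ t, ‖mean (b t)‖ ^ 2 ≤ 16 * δ * (15 * η ^ 2 * K / γ ^ 2) := by
    intro t
    have h1 := card_mul_norm_sq_mean_le (b t)
    have h2 := S.b_sq t
    have h3 := sum_norm_sq_dev_sub_smul_le (x t) (m (t + 1)) η
    obtain ⟨h4, -⟩ := S.consensus_le hL hγ0 hγ1 hδ hη hηL hα t
    obtain ⟨-, h5⟩ := S.consensus_le hL hγ0 hγ1 hδ hη hηL hα (t + 1)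
    rw [← hn, ← hK] at h4 h5
    have h6 : 2 * ζ ^ 2 + α * σ ^ 2 + K * (9 / 160) ≤ 5 / 2 * K / γ ^ 2 := by
      rw [le_div_iff₀ (by positivity)]
      have hg : γ ^ 2 ≤ 1 := by nlinarith
      have h7 : 2 * ζ ^ 2 + α * σ ^ 2 + K * (9 / 160) ≤ 5 / 2 * K := by
        rw [hK]; linarith [sq_nonneg ζ]
      have h8 : 0 ≤ 2 * ζ ^ 2 + α * σ ^ 2 + K * (9 / 160) := by positivity
      nlinarith
    -- Disagreement of the half steps: 2 · 5 from the models and 2 · 5/2 from the momenta give 15.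
    have h7 : ∑ i, ‖dev (fun i => x t i - η • m (t + 1) i) i‖ ^ 2
        ≤ n * (15 * η ^ 2 * K / γ ^ 2) := by
      have h8 : 2 * η ^ 2 * ∑ i, ‖dev (m (t + 1)) i‖ ^ 2
          ≤ 2 * η ^ 2 * (n * (5 / 2 * K / γ ^ 2)) := by
        have := h5.trans (mul_le_mul_of_nonneg_left h6 hn0.le)
        gcongr
      have e : n * (15 * η ^ 2 * K / γ ^ 2)
          = 2 * (n * (5 * η ^ 2 * K / γ ^ 2)) + 2 * η ^ 2 * (n * (5 / 2 * K / γ ^ 2)) := by ring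
      linarith
    have h8 : 16 * δ * ∑ i, ‖dev (fun i => x t i - η • m (t + 1) i) i‖ ^ 2
        ≤ 16 * δ * (n * (15 * η ^ 2 * K / γ ^ 2)) := by gcongr
    have h9 : n * ‖mean (b t)‖ ^ 2 ≤ n * (16 * δ * (15 * η ^ 2 * K / γ ^ 2)) := by linarith
    exact le_of_mul_le_mul_left h9 hn0
  have hX : ∀ t, (∑ i, ‖dev (x t) i‖ ^ 2) / Fintype.card ι ≤ 5 * η ^ 2 * K / γ ^ 2 := by
    intro t
    rw [← hn, div_le_iff₀ hn0, mul_comm]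
    exact (S.consensus_le hL hγ0 hγ1 hδ hη hηL hα t).1
  have h1 := S.sum_norm_h_sq_le_of_bounds hL hη (by linarith) hα hφ hfs h0 hβ S.c_mean_sq hX T
  rw [← hn] at h1
  set G := ∑ t ∈ Finset.range (T + 1), ‖h t‖ ^ 2
  have hT : (0 : ℝ) < (T : ℝ) + 1 := by positivity
  have h2 : 1 / ((T : ℝ) + 1) * G = 2 / (η * (T + 1)) * (η / 2 * G) := by
    field_simp
  rw [h2]
  refine (mul_le_mul_of_nonneg_left h1 (by positivity)).trans ?_
  -- Here 5040 = 2 · (21/2) · 16 · 15 collects the bias b, and 15/2 the disagreement of the local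
  -- gradients. The bracket in α is below 9 as α ≤ 9/40.
  have h3 : 2 / (η * ((T : ℝ) + 1)) * (3 / 2 * (φ 0 - fs)
      + (T + 1) * (21 / 2 * (16 * δ * (15 * η ^ 2 * K / γ ^ 2) / η)
        + L * (2 * η ^ 2 * α ^ 2 * σ ^ 2 / n) + 5 / 2 * (L * (2 * η ^ 2 * α ^ 2 * σ ^ 2 / n) / α)
        + (α * (L ^ 2 * (5 * η ^ 2 * K / γ ^ 2)) + α ^ 2 * (σ ^ 2 / n)) / (4 * L)))
      = 3 * (φ 0 - fs) / (η * (T + 1))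
        + (4 * α * α + 10 * α + 9 / 2) * (η * L * σ ^ 2 / n)
        + (5040 * δ / γ ^ 2 + 15 / 2 * (η * L) ^ 2 / γ ^ 2) * K := by
    have e1 : α ^ 2 = α * (3 * η * L) := by rw [sq]; nth_rewrite 2 [hα]; ring
    have e2 : 5 / 2 * (L * (2 * η ^ 2 * α ^ 2 * σ ^ 2 / n) / α)
        = 5 * L * η ^ 2 * α * σ ^ 2 / n := by
      field_simp
    have e3 : (α * (L ^ 2 * (5 * η ^ 2 * K / γ ^ 2)) + α ^ 2 * (σ ^ 2 / n)) / (4 * L)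
        = 3 * η / 4 * (L ^ 2 * (5 * η ^ 2 * K / γ ^ 2) + 3 * η * L * σ ^ 2 / n) := by
      have : α * (L ^ 2 * (5 * η ^ 2 * K / γ ^ 2)) + α ^ 2 * (σ ^ 2 / n)
        = (3 * η * L) * (L ^ 2 * (5 * η ^ 2 * K / γ ^ 2)) + (3 * η * L) ^ 2 * (σ ^ 2 / n) := by
        rw [← hα]
      rw [this]
      field_simp
    rw [e2, e3]
    field_simp
    ring
  rw [h3]
  have h4 : (4 * α * α + 10 * α + 9 / 2) * (η * L * σ ^ 2 / n) ≤ 9 * (η * L * σ ^ 2 / n) := by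
    refine mul_le_mul_of_nonneg_right ?_ (by positivity)
    nlinarith
  have h5 : 9 * (η * L * σ ^ 2 / n) = 9 * η * L * σ ^ 2 / n := by ring
  rw [hK, hα] at *
  linarith

end IsPerturbedGossip

end ClippedGossip

end

noncomputable section

namespace ClippedGossip

/-! ### Choice of the step size. -/

section StepSize

/-- A step size that balances the terms of the convergence bound. -/
theorem exists_balanced_stepSize {q d x y z : ℝ} (hq : 0 < q) (hd : 0 < d) (hx : 0 ≤ x)
    (hy : 0 ≤ y) (hz : 0 ≤ z) : ∃ η : ℝ, 0 < η ∧ η ≤ 1 / d ∧ x * η ≤ q ∧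
      q / η + x ^ 2 / q * η + y ^ 3 / q ^ 2 * η ^ 2 + z ^ 4 / q ^ 3 * η ^ 3
        ≤ 2 * x + 2 * y + 2 * z + d * q := by
  -- With η = 1/D each power of η contributes at most x, y or z, as x, y, z ≤ q D. The term q/η = q
  -- D is at most d q + x + y + z; hence the factors 2.
  set D : ℝ := max (max d (x / q)) (max (y / q) (z / q)) with hD
  have hdD : d ≤ D := (le_max_left _ _).trans (le_max_left _ _)
  have hD0 : 0 < D := hd.trans_le hdD
  have hxD : x ≤ q * D := by
    have : x / q ≤ D := (le_max_right _ _).trans (le_max_left _ _)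
    rwa [div_le_iff₀' hq] at this
  have hyD : y ≤ q * D := by
    have : y / q ≤ D := (le_max_left _ _).trans (le_max_right _ _)
    rwa [div_le_iff₀' hq] at this
  have hzD : z ≤ q * D := by
    have : z / q ≤ D := (le_max_right _ _).trans (le_max_right _ _)
    rwa [div_le_iff₀' hq] at this
  have hsum : D ≤ d + x / q + y / q + z / q := by
    have h1 : 0 ≤ x / q := by positivity
    have h2 : 0 ≤ y / q := by positivity
    have h3 : 0 ≤ z / q := by positivity
    refine max_le (max_le ?_ ?_) (max_le ?_ ?_) <;> linarith
  refine ⟨1 / D, by positivity, by gcongr, ?_, ?_⟩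
  · rw [mul_one_div, div_le_iff₀ hD0]
    exact hxD
  · have hqD : 0 < q * D := by positivity
    have h0 : q / (1 / D) ≤ d * q + x + y + z := by
      have : q / (1 / D) = q * D := by field_simp
      rw [this]
      have h1 := mul_le_mul_of_nonneg_left hsum hq.le
      have h2 : q * (d + x / q + y / q + z / q) = d * q + x + y + z := by field_simp
      linarith
    have h1 : x ^ 2 / q * (1 / D) ≤ x := by
      have : x ^ 2 / q * (1 / D) = x * (x / (q * D)) := by field_simp
      rw [this]
      exact mul_le_of_le_one_right hx ((div_le_one hqD).2 hxD)
    have h2 : y ^ 3 / q ^ 2 * (1 / D) ^ 2 ≤ y := by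
      have : y ^ 3 / q ^ 2 * (1 / D) ^ 2 = y * (y / (q * D)) ^ 2 := by field_simp
      rw [this]
      exact mul_le_of_le_one_right hy (pow_le_one₀ (by positivity) ((div_le_one hqD).2 hyD))
    have h3 : z ^ 4 / q ^ 3 * (1 / D) ^ 3 ≤ z := by
      have : z ^ 4 / q ^ 3 * (1 / D) ^ 3 = z * (z / (q * D)) ^ 3 := by field_simp
      rw [this]
      exact mul_le_of_le_one_right hz (pow_le_one₀ (by positivity) ((div_le_one hqD).2 hzD))
    linarith

theorem rpow_one_div_pow {a : ℝ} (ha : 0 ≤ a) {k : ℕ} (hk : k ≠ 0) (j : ℕ) :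
    (a ^ ((j : ℝ) / (k : ℝ))) ^ k = a ^ j := by
  rw [← Real.rpow_natCast, ← Real.rpow_mul ha, div_mul_cancel₀ _ (by exact_mod_cast hk),
    Real.rpow_natCast]

/-- The step size of the theorem. -/
theorem exists_stepSize {n : ℕ} {L σ r₀ γ δ ζ : ℝ} (hn : 0 < n) (hL : 0 < L) (hr₀ : 0 < r₀)
    (hγ0 : 0 < γ) (hδ0 : 0 ≤ δ) (T : ℕ) :
    ∃ η : ℝ, 0 < η ∧ η * L ≤ 3 * γ / 40 ∧ 3 * L * σ ^ 2 * η ^ 2 * (T + 1) ≤ r₀ * n ∧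
      3 * r₀ / (η * (T + 1)) + 9 * η * L * σ ^ 2 / n
        + (5040 * δ / γ ^ 2 + 15 / 2 * (η * L) ^ 2 / γ ^ 2) * (ζ ^ 2 + 3 * η * L * σ ^ 2)
        ≤ 200 * 32 * 5 / γ ^ 2 * δ * ζ ^ 2
          + 2 * (3 ^ 2 / (n : ℝ) + 320 * 32 * 5 / γ ^ 2 * δ) ^ (1 / 2 : ℝ)
            * (3 * L * σ ^ 2 * r₀ / ((T : ℝ) + 1)) ^ (1 / 2 : ℝ)
          + 2 * (48 * 5 / γ ^ 2 * ζ ^ 2) ^ (1 / 3 : ℝ)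
            * (r₀ * L / ((T : ℝ) + 1)) ^ (2 / 3 : ℝ)
          + 2 * (144 * 5 / γ ^ 2 * σ ^ 2) ^ (1 / 4 : ℝ)
            * (r₀ * L / ((T : ℝ) + 1)) ^ (3 / 4 : ℝ)
          + (40 * L / γ) * r₀ / ((T : ℝ) + 1) := by
  have hT : (0 : ℝ) < (T : ℝ) + 1 := by positivity
  have hn' : (0 : ℝ) < n := by exact_mod_cast hn
  set q : ℝ := r₀ / (T + 1) with hq
  have hq0 : 0 < q := by positivity
  set a : ℝ := 3 ^ 2 / (n : ℝ) + 320 * 32 * 5 / γ ^ 2 * δ with ha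
  have ha0 : 0 ≤ a := by positivity
  have e1 : 3 * L * σ ^ 2 * r₀ / ((T : ℝ) + 1) = 3 * L * σ ^ 2 * q := by rw [hq]; ring
  have e2 : r₀ * L / ((T : ℝ) + 1) = q * L := by rw [hq]; ring
  rw [e1, e2]
  set x : ℝ := a ^ (1 / 2 : ℝ) * (3 * L * σ ^ 2 * q) ^ (1 / 2 : ℝ) with hx
  set y : ℝ := (48 * 5 / γ ^ 2 * ζ ^ 2) ^ (1 / 3 : ℝ) * (q * L) ^ (2 / 3 : ℝ) with hy
  set z : ℝ := (144 * 5 / γ ^ 2 * σ ^ 2) ^ (1 / 4 : ℝ) * (q * L) ^ (3 / 4 : ℝ) with hz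
  have hx2 : x ^ 2 = a * (3 * L * σ ^ 2 * q) := by
    have h1 := rpow_one_div_pow ha0 two_ne_zero 1
    have h2 := rpow_one_div_pow (a := 3 * L * σ ^ 2 * q) (by positivity) two_ne_zero 1
    push_cast at h1 h2
    rw [hx, mul_pow, h1, h2, pow_one, pow_one]
  have hy3 : y ^ 3 = 48 * 5 / γ ^ 2 * ζ ^ 2 * (q * L) ^ 2 := by
    have h1 := rpow_one_div_pow (a := 48 * 5 / γ ^ 2 * ζ ^ 2) (by positivity) three_ne_zero 1
    have h2 := rpow_one_div_pow (a := q * L) (by positivity) three_ne_zero 2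
    push_cast at h1 h2
    rw [hy, mul_pow, h1, h2, pow_one]
  have hz4 : z ^ 4 = 144 * 5 / γ ^ 2 * σ ^ 2 * (q * L) ^ 3 := by
    have h1 := rpow_one_div_pow (a := 144 * 5 / γ ^ 2 * σ ^ 2) (by positivity) four_ne_zero 1
    have h2 := rpow_one_div_pow (a := q * L) (by positivity) four_ne_zero 3
    push_cast at h1 h2
    rw [hz, mul_pow, h1, h2, pow_one]
  have hx0 : 0 ≤ x := by positivity
  -- The numbers x, y, z are the terms of the final bound without the factor 2; d = 40L/γ is the cap
  -- that yields ηL ≤ 3γ/40 for the final step size.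
  obtain ⟨η, hη0, hηd, hxη, hη⟩ := exists_balanced_stepSize (d := 40 * L / γ) hq0
    (by positivity) hx0 (by positivity : 0 ≤ y) (by positivity : 0 ≤ z)
  -- Tripling the balanced step size turns 3 r₀/(η(T+1)) into q/η.
  refine ⟨3 * η, by positivity, ?_, ?_, ?_⟩
  · rw [le_div_iff₀ (by positivity), mul_div_assoc', div_le_iff₀ hγ0] at hηd
    linarith
  -- From x η ≤ q and a ≥ 9/n one gets η² of order r₀ n/(Lσ²(T+1)); this is kept for the consensus
  -- estimate.
  · have h1 : (x * η) ^ 2 ≤ q ^ 2 := pow_le_pow_left₀ (by positivity) hxη 2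
    rw [mul_pow, hx2] at h1
    have h2 : a * (3 * L * σ ^ 2) * η ^ 2 ≤ q := by
      refine le_of_mul_le_mul_left ?_ hq0
      linarith
    have h3 : 9 / (n : ℝ) * (3 * L * σ ^ 2) * η ^ 2 ≤ a * (3 * L * σ ^ 2) * η ^ 2 := by
      have : 9 / (n : ℝ) ≤ a := by
        rw [ha]
        have : 0 ≤ 320 * 32 * 5 / γ ^ 2 * δ := by positivity
        norm_num at this ⊢
        linarith
      gcongr
    have h4 := h3.trans h2
    rw [hq, le_div_iff₀ hT, div_mul_eq_mul_div, div_mul_eq_mul_div, div_mul_eq_mul_div,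
      div_le_iff₀ hn'] at h4
    linarith
  · rw [hx2, hy3, hz4] at hη
    have t0 : 3 * r₀ / (3 * η * (T + 1)) = q / η := by rw [hq]; field_simp
    have t1 : a * (3 * L * σ ^ 2 * q) / q * η
        = 27 * η * L * σ ^ 2 / n + 153600 * (δ / γ ^ 2 * (η * L * σ ^ 2)) := by
      rw [ha]; field_simp; ring
    have t2 : 48 * 5 / γ ^ 2 * ζ ^ 2 * (q * L) ^ 2 / q ^ 2 * η ^ 2
        = 240 * ((η * L) ^ 2 / γ ^ 2 * ζ ^ 2) := by
      field_simp; ring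
    have t3 : 144 * 5 / γ ^ 2 * σ ^ 2 * (q * L) ^ 3 / q ^ 3 * η ^ 3
        = 720 * ((η * L) ^ 2 / γ ^ 2 * (η * L * σ ^ 2)) := by
      field_simp; ring
    have t4 : (40 * L / γ) * r₀ / ((T : ℝ) + 1) = 40 * L / γ * q := by rw [hq]; ring
    have t5 : (5040 * δ / γ ^ 2 + 15 / 2 * (3 * η * L) ^ 2 / γ ^ 2)
        * (ζ ^ 2 + 3 * (3 * η) * L * σ ^ 2)
        = 5040 * (δ / γ ^ 2 * ζ ^ 2) + 45360 * (δ / γ ^ 2 * (η * L * σ ^ 2))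
          + 135 / 2 * ((η * L) ^ 2 / γ ^ 2 * ζ ^ 2)
          + 1215 / 2 * ((η * L) ^ 2 / γ ^ 2 * (η * L * σ ^ 2)) := by ring
    have t6 : 200 * 32 * 5 / γ ^ 2 * δ * ζ ^ 2 = 32000 * (δ / γ ^ 2 * ζ ^ 2) := by ring
    rw [t1, t2, t3] at hη
    rw [t0, t4, t5, t6]
    have p1 : 0 ≤ δ / γ ^ 2 * ζ ^ 2 := by positivity
    have p2 : 0 ≤ δ / γ ^ 2 * (η * L * σ ^ 2) := by positivity
    have p3 : 0 ≤ (η * L) ^ 2 / γ ^ 2 * ζ ^ 2 := by positivity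
    have p4 : 0 ≤ (η * L) ^ 2 / γ ^ 2 * (η * L * σ ^ 2) := by positivity
    have t7 : 9 * (3 * η) * L * σ ^ 2 / n = 27 * η * L * σ ^ 2 / n := by ring
    rw [t7]
    have t8 : ∀ u v : ℝ, 2 * u * v = 2 * (u * v) := fun u v => by ring
    rw [t8 (a ^ (1 / 2 : ℝ)), t8 ((48 * 5 / γ ^ 2 * ζ ^ 2) ^ (1 / 3 : ℝ)),
      t8 ((144 * 5 / γ ^ 2 * σ ^ 2) ^ (1 / 4 : ℝ)), ← hx, ← hy, ← hz]
    linarith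

end StepSize

end ClippedGossip

end

noncomputable section

namespace ClippedGossip

/-! ### Second moments of random vectors. -/

section SecondMoments

variable {Ω E : Type*} [MeasurableSpace Ω] {μ : Measure Ω}
  [NormedAddCommGroup E] [InnerProductSpace ℝ E]

theorem memLp_two_integrable_sq {E : Type*} [NormedAddCommGroup E] {X : Ω → E} (hX : MemLp X 2 μ) :
    Integrable (fun ω => ‖X ω‖ ^ 2) μ := by
  simpa using hX.integrable_norm_pow (p := 2) (by norm_num)

theorem memLp_two_integrable_inner {X Y : Ω → E} (hX : MemLp X 2 μ) (hY : MemLp Y 2 μ) :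
    Integrable (fun ω => inner ℝ (X ω) (Y ω)) μ := by
  refine ((memLp_two_integrable_sq hX).add (memLp_two_integrable_sq hY)).mono'
    (hX.1.inner hY.1) (Filter.Eventually.of_forall fun ω => ?_)
  have h1 := norm_inner_le_norm (𝕜 := ℝ) (X ω) (Y ω)
  simp only [Pi.add_apply]
  nlinarith [sq_nonneg (‖X ω‖ - ‖Y ω‖), sq_nonneg ‖X ω‖, sq_nonneg ‖Y ω‖]

/-- The cross term between the centered variable and a constant integrates to zero. -/
theorem integral_norm_sub_integral_sq [CompleteSpace E] [IsProbabilityMeasure μ] {X : Ω → E}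
    (hX : MemLp X 2 μ) (a : E) :
    ∫ ω, ‖X ω - ∫ ω', X ω' ∂μ‖ ^ 2 ∂μ = ∫ ω, ‖X ω - a‖ ^ 2 ∂μ - ‖∫ ω, X ω ∂μ - a‖ ^ 2 := by
  set e := ∫ ω', X ω' ∂μ with he
  have hi : Integrable X μ := hX.integrable one_le_two
  have h1 : ∀ ω, ‖X ω - a‖ ^ 2
      = ‖X ω - e‖ ^ 2 + (2 * inner ℝ (e - a) (X ω - e) + ‖e - a‖ ^ 2) := by
    intro ω
    have : X ω - a = (X ω - e) + (e - a) := by abel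
    rw [this, norm_add_sq_real, real_inner_comm]
    ring
  have hie : Integrable (fun ω => X ω - e) μ := hi.sub (integrable_const e)
  have h2 : Integrable (fun ω => inner ℝ (e - a) (X ω - e)) μ := hie.const_inner (e - a)
  have h3 : ∫ ω, inner ℝ (e - a) (X ω - e) ∂μ = 0 := by
    rw [integral_inner hie, integral_sub hi (integrable_const e), ← he]
    simp
  have h4 : Integrable (fun ω => ‖X ω - e‖ ^ 2) μ :=
    memLp_two_integrable_sq (hX.sub (memLp_const e))
  have h5 : Integrable (fun ω => 2 * inner ℝ (e - a) (X ω - e) + ‖e - a‖ ^ 2) μ :=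
    (h2.const_mul 2).add (integrable_const _)
  simp_rw [h1]
  rw [integral_add h4 h5,
    integral_add (h2.const_mul 2) (integrable_const _), integral_const_mul, h3]
  simp

theorem integral_norm_sub_integral_sq_le [CompleteSpace E] [IsProbabilityMeasure μ] {X : Ω → E}
    (hX : MemLp X 2 μ) (a : E) :
    ∫ ω, ‖X ω - ∫ ω', X ω' ∂μ‖ ^ 2 ∂μ ≤ ∫ ω, ‖X ω - a‖ ^ 2 ∂μ := by
  rw [integral_norm_sub_integral_sq hX a]
  linarith [sq_nonneg ‖∫ ω, X ω ∂μ - a‖]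

theorem norm_integral_sq_le [CompleteSpace E] [IsProbabilityMeasure μ] {X : Ω → E}
    (hX : MemLp X 2 μ) : ‖∫ ω, X ω ∂μ‖ ^ 2 ≤ ∫ ω, ‖X ω‖ ^ 2 ∂μ := by
  have h := integral_norm_sub_integral_sq hX 0
  have h1 : 0 ≤ ∫ ω, ‖X ω - ∫ ω', X ω' ∂μ‖ ^ 2 ∂μ := integral_nonneg fun ω => sq_nonneg _
  simp only [sub_zero] at h
  linarith

theorem integral_inner_eq_zero_of_indepFun [CompleteSpace E] [MeasurableSpace E] [BorelSpace E]
    {X Y : Ω → E} (h : IndepFun X Y μ) (hX : Integrable X μ) (hY : Integrable Y μ)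
    (h0 : ∫ ω, Y ω ∂μ = 0) : ∫ ω, inner ℝ (X ω) (Y ω) ∂μ = 0 := by
  have := h.integral_bilin hX hY (innerSL ℝ)
  rw [h0, map_zero] at this
  exact this

theorem norm_sum_smul_sq_le {ι : Type*} (s : Finset ι) {w : ι → ℝ} (hw : ∀ j ∈ s, 0 ≤ w j)
    (hs : ∑ j ∈ s, w j ≤ 1) (u : ι → E) :
    ‖∑ j ∈ s, w j • u j‖ ^ 2 ≤ ∑ j ∈ s, w j * ‖u j‖ ^ 2 := by
  have h1 : ‖∑ j ∈ s, w j • u j‖ ≤ ∑ j ∈ s, w j * ‖u j‖ := by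
    refine (norm_sum_le _ _).trans (le_of_eq (Finset.sum_congr rfl fun j hj => ?_))
    rw [norm_smul, Real.norm_of_nonneg (hw j hj)]
  have h2 : (∑ j ∈ s, w j * ‖u j‖) ^ 2 ≤ (∑ j ∈ s, w j) * ∑ j ∈ s, w j * ‖u j‖ ^ 2 := by
    refine Finset.sum_sq_le_sum_mul_sum_of_sq_le_mul s hw
      (fun j hj => mul_nonneg (hw j hj) (sq_nonneg _)) (fun j _ => ?_)
    nlinarith
  have h3 : 0 ≤ ∑ j ∈ s, w j * ‖u j‖ ^ 2 :=
    Finset.sum_nonneg fun j hj => mul_nonneg (hw j hj) (sq_nonneg _)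
  calc _ ≤ (∑ j ∈ s, w j * ‖u j‖) ^ 2 := pow_le_pow_left₀ (norm_nonneg _) h1 2
    _ ≤ _ := h2
    _ ≤ 1 * ∑ j ∈ s, w j * ‖u j‖ ^ 2 := by gcongr
    _ = _ := one_mul _

end SecondMoments

/-! ### Variance of weighted sums over pairs. -/

section PairwiseSums

variable {ι Ω E : Type*} [Fintype ι] [MeasurableSpace Ω] {μ : Measure Ω}
  [NormedAddCommGroup E] [InnerProductSpace ℝ E]

/-- Pairs of disjoint pairs contribute nothing to the second moment of a weighted sum over pairs. -/
theorem integral_norm_sum_pairs_sq_le {w : ι → ι → ℝ} (hw : ∀ i j, 0 ≤ w i j)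
    (hsymm : ∀ i j, w i j = w j i) (hrow : ∀ i, ∑ j, w i j ≤ 1)
    {X : ι → ι → Ω → E} (hX : ∀ i j, MemLp (X i j) 2 μ) {s : ℝ}
    (hs : ∀ i j, ∫ ω, ‖X i j ω‖ ^ 2 ∂μ ≤ s)
    (horth : ∀ i j k l, i ≠ k → i ≠ l → j ≠ k → j ≠ l →
      ∫ ω, inner ℝ (X i j ω) (X k l ω) ∂μ = 0) :
    ∫ ω, ‖∑ i, ∑ j, w i j • X i j ω‖ ^ 2 ∂μ ≤ 4 * (Fintype.card ι * s) := by
  classical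
  rcases isEmpty_or_nonempty ι with hι | ⟨⟨i₀⟩⟩
  · simp
  have hs0 : 0 ≤ s := (integral_nonneg fun ω => sq_nonneg _).trans (hs i₀ i₀)
  have hint : ∀ e e' : ι × ι, Integrable (fun ω => inner ℝ (X e.1 e.2 ω) (X e'.1 e'.2 ω)) μ :=
    fun e e' => memLp_two_integrable_inner (hX _ _) (hX _ _)
  have h1 : ∀ ω, ‖∑ i, ∑ j, w i j • X i j ω‖ ^ 2 = ∑ e : ι × ι, ∑ e' : ι × ι,
      w e.1 e.2 * w e'.1 e'.2 * inner ℝ (X e.1 e.2 ω) (X e'.1 e'.2 ω) := by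
    intro ω
    rw [← Fintype.sum_prod_type' (f := fun i j => w i j • X i j ω), ← real_inner_self_eq_norm_sq,
      sum_inner]
    refine Finset.sum_congr rfl fun e _ => ?_
    rw [inner_sum]
    refine Finset.sum_congr rfl fun e' _ => ?_
    rw [inner_smul_left, inner_smul_right, conj_trivial, mul_assoc]
  -- A covariance is at most s by Young's inequality and zero for disjoint pairs. It is therefore
  -- bounded by s times the number of coincidences of endpoints.
  have h2 : ∀ e e' : ι × ι, ∫ ω, inner ℝ (X e.1 e.2 ω) (X e'.1 e'.2 ω) ∂μ
      ≤ ((if e.1 = e'.1 then 1 else 0) + (if e.1 = e'.2 then 1 else 0)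
        + (if e.2 = e'.1 then 1 else 0) + (if e.2 = e'.2 then 1 else 0)) * s := by
    intro e e'
    have h3 : ∫ ω, inner ℝ (X e.1 e.2 ω) (X e'.1 e'.2 ω) ∂μ ≤ s := by
      have h4 : ∫ ω, inner ℝ (X e.1 e.2 ω) (X e'.1 e'.2 ω) ∂μ
          ≤ ∫ ω, (1 / 2 * ‖X e.1 e.2 ω‖ ^ 2 + 1 / 2 * ‖X e'.1 e'.2 ω‖ ^ 2) ∂μ := by
        refine integral_mono (hint e e') (((memLp_two_integrable_sq (hX _ _)).const_mul _).add
          ((memLp_two_integrable_sq (hX _ _)).const_mul _)) fun ω => ?_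
        have := two_inner_le (X e.1 e.2 ω) (X e'.1 e'.2 ω) one_pos
        simp only
        linarith
      rw [integral_add ((memLp_two_integrable_sq (hX _ _)).const_mul _)
        ((memLp_two_integrable_sq (hX _ _)).const_mul _), integral_const_mul,
        integral_const_mul] at h4
      linarith [hs e.1 e.2, hs e'.1 e'.2]
    by_cases c1 : e.1 = e'.1
    · refine h3.trans (le_mul_of_one_le_left hs0 ?_)
      rw [if_pos c1]
      have := ite_nonneg (p := e.1 = e'.2) zero_le_one (le_refl (0 : ℝ))
      have := ite_nonneg (p := e.2 = e'.1) zero_le_one (le_refl (0 : ℝ))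
      have := ite_nonneg (p := e.2 = e'.2) zero_le_one (le_refl (0 : ℝ))
      linarith
    by_cases c2 : e.1 = e'.2
    · refine h3.trans (le_mul_of_one_le_left hs0 ?_)
      rw [if_neg c1, if_pos c2]
      have := ite_nonneg (p := e.2 = e'.1) zero_le_one (le_refl (0 : ℝ))
      have := ite_nonneg (p := e.2 = e'.2) zero_le_one (le_refl (0 : ℝ))
      linarith
    by_cases c3 : e.2 = e'.1
    · refine h3.trans (le_mul_of_one_le_left hs0 ?_)
      rw [if_neg c1, if_neg c2, if_pos c3]
      have := ite_nonneg (p := e.2 = e'.2) zero_le_one (le_refl (0 : ℝ))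
      linarith
    by_cases c4 : e.2 = e'.2
    · refine h3.trans (le_mul_of_one_le_left hs0 ?_)
      rw [if_neg c1, if_neg c2, if_neg c3, if_pos c4]
      norm_num
    · rw [horth _ _ _ _ c1 c2 c3 c4]
      simp [c1, c2, c3, c4]
  have hcol : ∀ j, ∑ i, w i j ≤ 1 := fun j => by
    rw [Finset.sum_congr rfl fun i _ => hsymm i j]; exact hrow j
  -- The pairs with endpoint k have total weight at most a row sum plus a column sum, hence 2. Two
  -- endpoints give the constant 4.
  have hdom : ∀ (k : ι) (c : ι × ι), ∑ e' : ι × ι, w c.1 c.2 * w e'.1 e'.2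
      * ((if k = e'.1 then 1 else 0) + (if k = e'.2 then 1 else 0)) ≤ w c.1 c.2 * 2 := by
    intro k c
    simp_rw [mul_assoc]
    rw [← Finset.mul_sum]
    refine mul_le_mul_of_nonneg_left ?_ (hw _ _)
    rw [Fintype.sum_prod_type]
    simp only [mul_add, mul_ite, mul_one, mul_zero, Finset.sum_add_distrib, Finset.sum_ite_eq,
      Finset.mem_univ, if_true]
    have : ∑ i, ∑ j, (if k = i then w i j else 0) = ∑ j, w k j := by
      rw [Finset.sum_comm]
      simp
    rw [this]
    linarith [hrow k, hcol k]
  simp_rw [h1]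
  rw [integral_finsetSum _ fun e _ => integrable_finsetSum _ fun e' _ =>
    (hint e e').const_mul _]
  have h5 : ∀ e : ι × ι, ∫ ω, ∑ e' : ι × ι,
      w e.1 e.2 * w e'.1 e'.2 * inner ℝ (X e.1 e.2 ω) (X e'.1 e'.2 ω) ∂μ
      ≤ w e.1 e.2 * 4 * s := by
    intro e
    rw [integral_finsetSum _ fun e' _ => (hint e e').const_mul _]
    simp_rw [integral_const_mul]
    calc _ ≤ ∑ e' : ι × ι, w e.1 e.2 * w e'.1 e'.2
        * (((if e.1 = e'.1 then 1 else 0) + (if e.1 = e'.2 then 1 else 0)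
        + (if e.2 = e'.1 then 1 else 0) + (if e.2 = e'.2 then 1 else 0)) * s) :=
          Finset.sum_le_sum fun e' _ =>
            mul_le_mul_of_nonneg_left (h2 e e') (mul_nonneg (hw _ _) (hw _ _))
      _ = (∑ e' : ι × ι, w e.1 e.2 * w e'.1 e'.2
          * ((if e.1 = e'.1 then 1 else 0) + (if e.1 = e'.2 then 1 else 0))
          + ∑ e' : ι × ι, w e.1 e.2 * w e'.1 e'.2
          * ((if e.2 = e'.1 then 1 else 0) + (if e.2 = e'.2 then 1 else 0))) * s := by
        rw [← Finset.sum_add_distrib, Finset.sum_mul]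
        exact Finset.sum_congr rfl fun e' _ => by ring
      _ ≤ (w e.1 e.2 * 2 + w e.1 e.2 * 2) * s := by
        have := hdom e.1 e
        have := hdom e.2 e
        gcongr
      _ = _ := by ring
  refine (Finset.sum_le_sum fun e _ => h5 e).trans ?_
  rw [← Finset.sum_mul, ← Finset.sum_mul, Fintype.sum_prod_type]
  have h6 : ∑ i, ∑ j, w i j ≤ Fintype.card ι := by
    refine (Finset.sum_le_sum fun i _ => hrow i).trans ?_
    simp
  have := mul_le_mul_of_nonneg_right h6 hs0
  linarith

end PairwiseSums

/-! ### Clipping errors for independent noise and fixed radii. -/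

section ClippingOfIndependent

variable {ι Ω : Type*} [Fintype ι] [MeasurableSpace Ω] {μ : Measure Ω} {d : ℕ}

/-- The total change, by clipping at worker `i`, of the messages `z j` of the regular workers. -/
def regularClipError (w : ι → ι → ℝ) (δ T : ι → ℝ) (z : ι → EuclideanSpace ℝ (Fin d)) (i : ι) :
    EuclideanSpace ℝ (Fin d) :=
  ∑ j, w i j • clipResidual (δ i) (T i) (z j - z i)

variable {w : ι → ι → ℝ} {δ T : ι → ℝ} {p : ι → EuclideanSpace ℝ (Fin d)}
  {Q : ι → Ω → EuclideanSpace ℝ (Fin d)} {s : ℝ}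

theorem measurable_regularClipError {α : Type*} [MeasurableSpace α] {T : α → ι → ℝ}
    {z : α → ι → EuclideanSpace ℝ (Fin d)} (hT : ∀ i, Measurable fun a => T a i)
    (hz : ∀ i, Measurable fun a => z a i) (i : ι) :
    Measurable fun a => regularClipError w δ (T a) (z a) i :=
  Finset.measurable_sum _ fun j _ =>
    (measurable_clipResidual _ (hT i) ((hz j).sub (hz i))).const_smul (w i j)

theorem norm_regularClipError_sq_le (hw : ∀ i j, 0 ≤ w i j) (hrow : ∀ i, ∑ j, w i j ≤ 1)
    (hT : ∀ i, 0 ≤ T i) (z : ι → EuclideanSpace ℝ (Fin d)) (i : ι) :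
    ‖regularClipError w δ T z i‖ ^ 2 ≤ ∑ j, w i j * ‖z j - z i‖ ^ 2 := by
  refine (norm_sum_smul_sq_le _ (fun j _ => hw i j) (hrow i) _).trans ?_
  refine Finset.sum_le_sum fun j _ => mul_le_mul_of_nonneg_left ?_ (hw i j)
  exact pow_le_pow_left₀ (norm_nonneg _) (norm_clipResidual_le _ (hT i) _) 2

theorem mul_norm_regularClipError_le (hw : ∀ i j, 0 ≤ w i j) (hT : ∀ i, 0 ≤ T i)
    (z : ι → EuclideanSpace ℝ (Fin d)) (i : ι) :
    T i * ‖regularClipError w δ T z i‖ ≤ ∑ j, w i j * ‖z j - z i‖ ^ 2 := by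
  refine (mul_le_mul_of_nonneg_left (norm_sum_le _ _) (hT i)).trans ?_
  rw [Finset.mul_sum]
  refine Finset.sum_le_sum fun j _ => ?_
  rw [norm_smul, Real.norm_of_nonneg (hw i j), mul_left_comm]
  exact mul_le_mul_of_nonneg_left (mul_norm_clipResidual_le _ (hT i) _) (hw i j)

/-- The residual is odd and the weights are symmetric, so the terms of (i,j) and (j,i) combine. The
average becomes a sum over pairs to which the pairwise variance bound applies. -/
theorem mean_regularClipError (hsymm : ∀ i j, w i j = w j i) (z : ι → EuclideanSpace ℝ (Fin d)) :
    mean (regularClipError w δ T z) = (1 / (2 * (Fintype.card ι : ℝ))) • ∑ i, ∑ j, w i j •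
      (clipResidual (δ i) (T i) (z j - z i) - clipResidual (δ j) (T j) (z j - z i)) := by
  have h1 : ∑ i, ∑ j, w i j • clipResidual (δ j) (T j) (z j - z i)
      = -∑ i, regularClipError w δ T z i := by
    rw [Finset.sum_comm, ← Finset.sum_neg_distrib]
    refine Finset.sum_congr rfl fun i _ => ?_
    rw [regularClipError, ← Finset.sum_neg_distrib]
    refine Finset.sum_congr rfl fun j _ => ?_
    rw [← neg_sub (z j) (z i), clipResidual_neg, smul_neg, hsymm]
  have h2 : ∑ i, ∑ j, w i j • (clipResidual (δ i) (T i) (z j - z i)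
      - clipResidual (δ j) (T j) (z j - z i)) = (2 : ℝ) • ∑ i, regularClipError w δ T z i := by
    simp_rw [smul_sub, Finset.sum_sub_distrib]
    rw [h1, sub_neg_eq_add, two_smul]
    rfl
  rw [h2, smul_smul, mean]
  congr 1
  ring

variable [IsProbabilityMeasure μ]

omit [Fintype ι] in
theorem integral_norm_sub_sq_le_of_indep (hQ : iIndepFun Q μ) (hQ2 : ∀ i, MemLp (Q i) 2 μ)
    (hQ0 : ∀ i, ∫ ω, Q i ω ∂μ = 0) (hs0 : 0 ≤ s) (hs : ∀ i, ∫ ω, ‖Q i ω‖ ^ 2 ∂μ ≤ s) (i j : ι) :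
    ∫ ω, ‖Q j ω - Q i ω‖ ^ 2 ∂μ ≤ 2 * s := by
  by_cases hij : i = j
  · subst hij
    simpa using hs0
  · have h1 := integral_inner_eq_zero_of_indepFun (hQ.indepFun hij)
      ((hQ2 i).integrable one_le_two) ((hQ2 j).integrable one_le_two) (hQ0 j)
    have h2 : ∀ ω, ‖Q j ω - Q i ω‖ ^ 2
        = ‖Q j ω‖ ^ 2 + ‖Q i ω‖ ^ 2 - 2 * inner ℝ (Q i ω) (Q j ω) := by
      intro ω
      rw [norm_sub_sq_real, real_inner_comm]
      ring
    have i1 := memLp_two_integrable_sq (hQ2 j)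
    have i2 := memLp_two_integrable_sq (hQ2 i)
    have i3 := (memLp_two_integrable_inner (hQ2 i) (hQ2 j)).const_mul 2
    simp_rw [h2]
    have i12 : Integrable (fun ω => ‖Q j ω‖ ^ 2 + ‖Q i ω‖ ^ 2) μ := i1.add i2
    rw [integral_sub i12 i3, integral_add i1 i2, integral_const_mul, h1]
    linarith [hs i, hs j]

omit [Fintype ι] in
theorem memLp_translate (hQ2 : ∀ i, MemLp (Q i) 2 μ) (i j : ι) :
    MemLp (fun ω => (p j + Q j ω) - (p i + Q i ω)) 2 μ :=
  ((memLp_const (p j)).add (hQ2 j)).sub ((memLp_const (p i)).add (hQ2 i))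

omit [IsProbabilityMeasure μ] in
theorem memLp_clipResidual {X : Ω → EuclideanSpace ℝ (Fin d)} (hX : MemLp X 2 μ)
    (hXm : Measurable X) (δ : ℝ) {τ : ℝ} (hτ : 0 ≤ τ) :
    MemLp (fun ω => clipResidual δ τ (X ω)) 2 μ :=
  hX.mono (measurable_clipResidual δ measurable_const hXm).aestronglyMeasurable
    (Filter.Eventually.of_forall fun _ => norm_clipResidual_le δ hτ _)

theorem memLp_regularClipError (hT : ∀ i, 0 ≤ T i) (hQm : ∀ i, Measurable (Q i))
    (hQ2 : ∀ i, MemLp (Q i) 2 μ) (i : ι) :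
    MemLp (fun ω => regularClipError w δ T (fun k => p k + Q k ω) i) 2 μ := by
  refine memLp_finsetSum _ fun j _ => ?_
  have := (memLp_clipResidual (memLp_translate (p := p) hQ2 i j)
    (((hQm j).const_add _).sub ((hQm i).const_add _)) (δ i) (hT i)).const_smul (w i j)
  exact this

/-- The expected clipping error of regular messages is controlled by the clipping radius. -/
theorem norm_integral_regularClipError_le (hw : ∀ i j, 0 ≤ w i j) (hrow : ∀ i, ∑ j, w i j ≤ 1)
    (hT : ∀ i, 0 ≤ T i) (hQm : ∀ i, Measurable (Q i))
    (hQ2 : ∀ i, MemLp (Q i) 2 μ) (i : ι)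
    (hTi : δ i ≠ 0 → ∑ j, w i j * ∫ ω, ‖(p i + Q i ω) - (p j + Q j ω)‖ ^ 2 ∂μ = δ i * T i ^ 2) :
    ‖∫ ω, regularClipError w δ T (fun k => p k + Q k ω) i ∂μ‖ ≤ δ i * T i := by
  by_cases hδi : δ i = 0
  · simp [regularClipError, clipResidual, hδi]
  have hint : ∀ j, Integrable (fun ω => w i j * ‖(p j + Q j ω) - (p i + Q i ω)‖ ^ 2) μ :=
    fun j => (memLp_two_integrable_sq (memLp_translate hQ2 i j)).const_mul _
  have hv : ∫ ω, ∑ j, w i j * ‖(p j + Q j ω) - (p i + Q i ω)‖ ^ 2 ∂μ = δ i * T i ^ 2 := by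
    rw [integral_finsetSum _ fun j _ => hint j, ← hTi hδi]
    refine Finset.sum_congr rfl fun j _ => ?_
    rw [integral_const_mul]
    simp_rw [norm_sub_rev (p j + Q j _)]
  have hL2 := memLp_regularClipError (w := w) (δ := δ) (p := p) hT hQm hQ2 i
  have hsum : Integrable (fun ω => ∑ j, w i j * ‖(p j + Q j ω) - (p i + Q i ω)‖ ^ 2) μ :=
    integrable_finsetSum _ fun j _ => hint j
  -- One cannot divide by a zero radius. In that case the weighted second moment is zero, so the
  -- error vanishes by Jensen's inequality.
  rcases (hT i).eq_or_lt with h0 | h0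
  · have h1 := norm_integral_sq_le hL2
    have h2 := integral_mono (memLp_two_integrable_sq hL2) hsum
      fun ω => norm_regularClipError_sq_le (δ := δ) hw hrow hT (fun k => p k + Q k ω) i
    rw [hv, ← h0] at h2
    have h3 : ‖∫ ω, regularClipError w δ T (fun k => p k + Q k ω) i ∂μ‖ ^ 2 ≤ 0 := by
      simpa using h1.trans h2
    have h4 : ‖∫ ω, regularClipError w δ T (fun k => p k + Q k ω) i ∂μ‖ = 0 :=
      pow_eq_zero_iff two_ne_zero |>.1 (le_antisymm h3 (sq_nonneg _))
    rw [h4, ← h0, mul_zero]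
  · have h1 := norm_integral_le_integral_norm (μ := μ)
      fun ω => regularClipError w δ T (fun k => p k + Q k ω) i
    have h2 := integral_mono ((hL2.integrable one_le_two).norm.const_mul (T i)) hsum
      fun ω => mul_norm_regularClipError_le (δ := δ) hw hT (fun k => p k + Q k ω) i
    rw [integral_const_mul, hv] at h2
    refine h1.trans (le_of_mul_le_mul_left ?_ h0)
    linarith

/-- The variance of the clipping error of regular messages at one worker. -/
theorem variance_regularClipError_le (hw : ∀ i j, 0 ≤ w i j) (hrow : ∀ i, ∑ j, w i j ≤ 1)
    (hT : ∀ i, 0 ≤ T i) (hQ : iIndepFun Q μ) (hQm : ∀ i, Measurable (Q i))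
    (hQ2 : ∀ i, MemLp (Q i) 2 μ) (hQ0 : ∀ i, ∫ ω, Q i ω ∂μ = 0) (hs0 : 0 ≤ s)
    (hs : ∀ i, ∫ ω, ‖Q i ω‖ ^ 2 ∂μ ≤ s) (i : ι) :
    ∫ ω, ‖regularClipError w δ T (fun k => p k + Q k ω) i
      - ∫ ω', regularClipError w δ T (fun k => p k + Q k ω') i ∂μ‖ ^ 2 ∂μ ≤ 2 * s := by
  have hL2 := memLp_regularClipError (w := w) (δ := δ) (p := p) hT hQm hQ2 i
  -- The variance is at most the second moment about any point. The error without noise is a good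
  -- one, since nonexpansiveness then leaves only Q j - Q i.
  refine (integral_norm_sub_integral_sq_le hL2 (regularClipError w δ T p i)).trans ?_
  have hint : ∀ j, Integrable (fun ω => w i j * ‖Q j ω - Q i ω‖ ^ 2) μ :=
    fun j => (memLp_two_integrable_sq ((hQ2 j).sub (hQ2 i))).const_mul _
  have h1 : ∀ ω, ‖regularClipError w δ T (fun k => p k + Q k ω) i - regularClipError w δ T p i‖ ^ 2
      ≤ ∑ j, w i j * ‖Q j ω - Q i ω‖ ^ 2 := by
    intro ω
    rw [regularClipError, regularClipError, ← Finset.sum_sub_distrib]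
    simp_rw [← smul_sub]
    refine (norm_sum_smul_sq_le _ (fun j _ => hw i j) (hrow i) _).trans ?_
    refine Finset.sum_le_sum fun j _ => mul_le_mul_of_nonneg_left ?_ (hw i j)
    refine pow_le_pow_left₀ (norm_nonneg _) ((norm_clipResidual_sub_le _ (hT i) _ _).trans ?_) 2
    apply le_of_eq
    congr 1
    abel
  refine (integral_mono (memLp_two_integrable_sq (hL2.sub (memLp_const _)))
    (integrable_finsetSum _ fun j _ => hint j) h1).trans ?_
  rw [integral_finsetSum _ fun j _ => hint j]
  simp_rw [integral_const_mul]
  calc _ ≤ ∑ j, w i j * (2 * s) := Finset.sum_le_sum fun j _ =>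
        mul_le_mul_of_nonneg_left (integral_norm_sub_sq_le_of_indep hQ hQ2 hQ0 hs0 hs i j) (hw i j)
    _ = (∑ j, w i j) * (2 * s) := by rw [Finset.sum_mul]
    _ ≤ 1 * (2 * s) := mul_le_mul_of_nonneg_right (hrow i) (by linarith)
    _ = _ := one_mul _

/-- The variance of the average clipping error of regular messages is of order `1 / n`. -/
theorem variance_mean_regularClipError_le [Nonempty ι] (hw : ∀ i j, 0 ≤ w i j)
    (hsymm : ∀ i j, w i j = w j i) (hrow : ∀ i, ∑ j, w i j ≤ 1)
    (hT : ∀ i, 0 ≤ T i) (hQ : iIndepFun Q μ) (hQm : ∀ i, Measurable (Q i))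
    (hQ2 : ∀ i, MemLp (Q i) 2 μ) (hQ0 : ∀ i, ∫ ω, Q i ω ∂μ = 0) (hs0 : 0 ≤ s)
    (hs : ∀ i, ∫ ω, ‖Q i ω‖ ^ 2 ∂μ ≤ s) :
    ∫ ω, ‖mean (fun i => regularClipError w δ T (fun k => p k + Q k ω) i
      - ∫ ω', regularClipError w δ T (fun k => p k + Q k ω') i ∂μ)‖ ^ 2 ∂μ
      ≤ 2 * s / Fintype.card ι := by
  have hc : (0 : ℝ) < Fintype.card ι := by positivity
  set φ : ι → ι → EuclideanSpace ℝ (Fin d) → EuclideanSpace ℝ (Fin d) := fun i j v =>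
    clipResidual (δ i) (T i) v - clipResidual (δ j) (T j) v with hφ
  have hφm : ∀ i j, Measurable (φ i j) := fun i j =>
    (measurable_clipResidual _ measurable_const measurable_id).sub
      (measurable_clipResidual _ measurable_const measurable_id)
  set u : ι → ι → Ω → EuclideanSpace ℝ (Fin d) :=
    fun i j ω => (p j + Q j ω) - (p i + Q i ω) with hu
  have hum : ∀ i j, Measurable (u i j) :=
    fun i j => ((hQm j).const_add _).sub ((hQm i).const_add _)
  have hu2 : ∀ i j, MemLp (fun ω => φ i j (u i j ω)) 2 μ := fun i j =>
    (memLp_clipResidual (memLp_translate hQ2 i j) (hum i j) _ (hT i)).sub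
      (memLp_clipResidual (memLp_translate hQ2 i j) (hum i j) _ (hT j))
  set X : ι → ι → Ω → EuclideanSpace ℝ (Fin d) :=
    fun i j ω => φ i j (u i j ω) - ∫ ω', φ i j (u i j ω') ∂μ with hX
  have hX2 : ∀ i j, MemLp (X i j) 2 μ := fun i j => (hu2 i j).sub (memLp_const _)
  have hX0 : ∀ i j, ∫ ω, X i j ω ∂μ = 0 := by
    intro i j
    rw [hX]
    simp only
    rw [integral_sub ((hu2 i j).integrable one_le_two) (integrable_const _)]
    simp
  have hXs : ∀ i j, ∫ ω, ‖X i j ω‖ ^ 2 ∂μ ≤ 2 * s := by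
    intro i j
    refine (integral_norm_sub_integral_sq_le (hu2 i j) (φ i j (p j - p i))).trans ?_
    refine (integral_mono (memLp_two_integrable_sq ((hu2 i j).sub (memLp_const _)))
      (memLp_two_integrable_sq ((hQ2 j).sub (hQ2 i))) fun ω => ?_).trans
      (integral_norm_sub_sq_le_of_indep hQ hQ2 hQ0 hs0 hs i j)
    refine pow_le_pow_left₀ (norm_nonneg _)
      ((norm_clipResidual_diff_le _ _ (hT i) (hT j) _ _).trans (le_of_eq ?_)) 2
    simp only [hu, Pi.sub_apply]
    congr 1
    abel
  -- X i j depends only on the noises of i and j, so disjoint pairs give independent centered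
  -- vectors.
  have horth : ∀ i j k l, i ≠ k → i ≠ l → j ≠ k → j ≠ l →
      ∫ ω, inner ℝ (X i j ω) (X k l ω) ∂μ = 0 := by
    intro i j k l hik hil hjk hjl
    have h1 := hQ.indepFun_prodMk_prodMk hQm i j k l hik hil hjk hjl
    have hm : ∀ i j, Measurable fun q : EuclideanSpace ℝ (Fin d) × EuclideanSpace ℝ (Fin d) =>
        φ i j ((p j + q.2) - (p i + q.1)) - ∫ ω', φ i j (u i j ω') ∂μ := fun i j =>
      ((hφm i j).comp ((measurable_snd.const_add _).sub (measurable_fst.const_add _))).sub_const _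
    exact integral_inner_eq_zero_of_indepFun (h1.comp (hm i j) (hm k l))
      ((hX2 i j).integrable one_le_two) ((hX2 k l).integrable one_le_two) (hX0 k l)
  have key := integral_norm_sum_pairs_sq_le hw hsymm hrow hX2 hXs horth
  have hmean : ∀ ω, mean (fun i => regularClipError w δ T (fun k => p k + Q k ω) i
      - ∫ ω', regularClipError w δ T (fun k => p k + Q k ω') i ∂μ)
      = (1 / (2 * (Fintype.card ι : ℝ))) • ∑ i, ∑ j, w i j • X i j ω := by
    intro ω
    have hri : ∀ i, Integrable (fun ω => regularClipError w δ T (fun k => p k + Q k ω) i) μ :=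
      fun i => (memLp_regularClipError hT hQm hQ2 i).integrable one_le_two
    have h1 : mean (fun i => ∫ ω', regularClipError w δ T (fun k => p k + Q k ω') i ∂μ)
        = (1 / (2 * (Fintype.card ι : ℝ))) • ∑ i, ∑ j, w i j • ∫ ω', φ i j (u i j ω') ∂μ := by
      have e : mean (fun i => ∫ ω', regularClipError w δ T (fun k => p k + Q k ω') i ∂μ)
          = ∫ ω', mean (regularClipError w δ T (fun k => p k + Q k ω')) ∂μ := by
        simp only [mean]
        rw [integral_smul, integral_finsetSum _ fun i _ => hri i]
      rw [e]
      simp_rw [mean_regularClipError hsymm]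
      have hij : ∀ i j, Integrable (fun ω => w i j • φ i j (u i j ω)) μ :=
        fun i j => Integrable.smul (w i j) ((hu2 i j).integrable one_le_two)
      rw [integral_smul]
      congr 1
      refine (integral_finsetSum _ fun i _ => integrable_finsetSum _ fun j _ => hij i j).trans ?_
      refine Finset.sum_congr rfl fun i _ => ?_
      refine (integral_finsetSum _ fun j _ => hij i j).trans ?_
      exact Finset.sum_congr rfl fun j _ => integral_smul _ _
    rw [mean_sub, h1]
    have h2 : mean (fun i => regularClipError w δ T (fun k => p k + Q k ω) i)
        = (1 / (2 * (Fintype.card ι : ℝ))) • ∑ i, ∑ j, w i j • φ i j (u i j ω) :=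
      mean_regularClipError hsymm _
    rw [h2, ← smul_sub]
    simp only [hX, smul_sub, Finset.sum_sub_distrib]
  simp_rw [hmean, norm_smul, mul_pow]
  rw [integral_const_mul, Real.norm_of_nonneg (by positivity), le_div_iff₀ hc]
  calc _ ≤ (1 / (2 * (Fintype.card ι : ℝ))) ^ 2 * (4 * (Fintype.card ι * (2 * s)))
        * Fintype.card ι := by gcongr
    _ = 2 * s := by field_simp; ring

end ClippingOfIndependent

end ClippedGossip

end

noncomputable section

namespace ClippedGossip

/-! ### Independence from the past: freezing the known variables. -/

section Freezing

variable {Ω Y F E : Type*} {m : MeasurableSpace Ω} [mΩ : MeasurableSpace Ω] [MeasurableSpace Y] [MeasurableSpace F]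
  {μ : Measure Ω} [IsProbabilityMeasure μ] {X : Ω → Y} {A : Ω → F}

theorem lintegral_comp_of_indepFun (hX : Measurable X) (hA : Measurable A) (hXA : IndepFun X A μ)
    {f : Y → F → ENNReal} (hf : Measurable (Function.uncurry f)) :
    ∫⁻ ω, f (X ω) (A ω) ∂μ = ∫⁻ ω', ∫⁻ ω, f (X ω') (A ω) ∂μ ∂μ := by
  have h1 := (indepFun_iff_map_prod_eq_prod_map_map hX.aemeasurable hA.aemeasurable).1 hXA
  have := Measure.isProbabilityMeasure_map (μ := μ) hA.aemeasurable
  calc ∫⁻ ω, f (X ω) (A ω) ∂μ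
      = ∫⁻ q, Function.uncurry f q ∂(μ.map fun ω => (X ω, A ω)) :=
        (lintegral_map hf (hX.prodMk hA)).symm
    _ = ∫⁻ y, ∫⁻ a, f y a ∂(μ.map A) ∂(μ.map X) := by
        rw [h1, lintegral_prod _ hf.aemeasurable]
        rfl
    _ = ∫⁻ ω', ∫⁻ a, f (X ω') a ∂(μ.map A) ∂μ :=
        lintegral_map hf.lintegral_prod_right' hX
    _ = _ := lintegral_congr fun ω' => lintegral_map (hf.comp measurable_prodMk_left) hA

theorem integral_comp_of_indepFun [NormedAddCommGroup E] [NormedSpace ℝ E]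
    (hX : Measurable X) (hA : Measurable A) (hXA : IndepFun X A μ)
    {f : Y → F → E} (hf : StronglyMeasurable (Function.uncurry f))
    (hi : Integrable (fun ω => f (X ω) (A ω)) μ) :
    ∫ ω, f (X ω) (A ω) ∂μ = ∫ ω', ∫ ω, f (X ω') (A ω) ∂μ ∂μ := by
  have h1 := (indepFun_iff_map_prod_eq_prod_map_map hX.aemeasurable hA.aemeasurable).1 hXA
  have := Measure.isProbabilityMeasure_map (μ := μ) hA.aemeasurable
  have := Measure.isProbabilityMeasure_map (μ := μ) hX.aemeasurable
  have hi' : Integrable (Function.uncurry f) (μ.map fun ω => (X ω, A ω)) :=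
    (integrable_map_measure hf.aestronglyMeasurable (hX.prodMk hA).aemeasurable).2 hi
  calc ∫ ω, f (X ω) (A ω) ∂μ
      = ∫ q, Function.uncurry f q ∂(μ.map fun ω => (X ω, A ω)) :=
        (integral_map (hX.prodMk hA).aemeasurable hf.aestronglyMeasurable).symm
    _ = ∫ y, ∫ a, f y a ∂(μ.map A) ∂(μ.map X) := by
        rw [h1] at hi' ⊢
        rw [integral_prod _ hi']
        rfl
    _ = ∫ ω', ∫ a, f (X ω') a ∂(μ.map A) ∂μ :=
        integral_map hX.aemeasurable hf.integral_prod_right'.aestronglyMeasurable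
    _ = _ := integral_congr_ae (Filter.Eventually.of_forall fun ω' =>
        integral_map hA.aemeasurable (hf.comp_measurable measurable_prodMk_left).aestronglyMeasurable)

variable {d : ℕ}

/-- A bound of the second moment that holds for every frozen value of `X` holds altogether. -/
theorem memLp_two_of_frozen (hX : Measurable X) (hA : Measurable A) (hXA : IndepFun X A μ)
    {f : Y → F → EuclideanSpace ℝ (Fin d)} (hf : Measurable (Function.uncurry f)) {s : ℝ}
    (h2 : ∀ y, MemLp (fun ω => f y (A ω)) 2 μ) (hs : ∀ y, ∫ ω, ‖f y (A ω)‖ ^ 2 ∂μ ≤ s) :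
    MemLp (fun ω => f (X ω) (A ω)) 2 μ ∧ ∫ ω, ‖f (X ω) (A ω)‖ ^ 2 ∂μ ≤ s := by
  have hm : Measurable fun ω => f (X ω) (A ω) := hf.comp (hX.prodMk hA)
  -- Tonelli needs no integrability, which is part of the conclusion here.
  have h1 : ∫⁻ ω, ENNReal.ofReal (‖f (X ω) (A ω)‖ ^ 2) ∂μ ≤ ENNReal.ofReal s := by
    rw [lintegral_comp_of_indepFun (f := fun y a => ENNReal.ofReal (‖f y a‖ ^ 2)) hX hA hXA
      ((hf.norm.pow_const 2).ennreal_ofReal)]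
    calc _ ≤ ∫⁻ _ : Ω, ENNReal.ofReal s ∂μ := by
          refine lintegral_mono fun ω' => ?_
          simp only
          rw [← ofReal_integral_eq_lintegral_ofReal (memLp_two_integrable_sq (h2 (X ω')))
            (Filter.Eventually.of_forall fun ω => sq_nonneg _)]
          exact ENNReal.ofReal_le_ofReal (hs _)
      _ = _ := by simp
  have hint : Integrable (fun ω => ‖f (X ω) (A ω)‖ ^ 2) μ := by
    refine ⟨(hm.norm.pow_const 2).aestronglyMeasurable, ?_⟩
    rw [hasFiniteIntegral_iff_ofReal (Filter.Eventually.of_forall fun ω => sq_nonneg _)]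
    exact h1.trans_lt ENNReal.ofReal_lt_top
  refine ⟨(memLp_two_iff_integrable_sq_norm hm.aestronglyMeasurable).2 hint, ?_⟩
  have hne : Nonempty Ω := by
    by_contra h
    rw [not_nonempty_iff] at h
    exact IsProbabilityMeasure.ne_zero μ (Measure.eq_zero_of_isEmpty μ)
  have hs0 : 0 ≤ s := (integral_nonneg fun ω => sq_nonneg _).trans (hs (X hne.some))
  rw [integral_eq_lintegral_of_nonneg_ae (Filter.Eventually.of_forall fun ω => sq_nonneg _)
    hint.1]
  exact ENNReal.toReal_le_of_le_ofReal hs0 h1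

omit [IsProbabilityMeasure μ] in
theorem indepFun_of_indep_comap (hind : Indep (MeasurableSpace.comap A inferInstance) m μ)
    (hX : Measurable[m] X) : IndepFun X A μ :=
  (indep_of_indep_of_le_right hind hX.comap_le).symm

/-- The pair (k, X) is frozen jointly; the inner integral of the inner product is then the inner
product with a zero mean. -/
theorem integral_inner_frozen_eq_zero (hm : m ≤ mΩ) (hX : Measurable[m] X) (hA : Measurable A)
    (hind : Indep (MeasurableSpace.comap A inferInstance) m μ)
    {f : Y → F → EuclideanSpace ℝ (Fin d)} (hf : Measurable (Function.uncurry f))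
    (hfi : ∀ y, Integrable (fun ω => f y (A ω)) μ) (hf0 : ∀ y, ∫ ω, f y (A ω) ∂μ = 0)
    {k : Ω → EuclideanSpace ℝ (Fin d)} (hkm : Measurable[m] k)
    (hk : MemLp k 2 μ) (hf2 : MemLp (fun ω => f (X ω) (A ω)) 2 μ) :
    ∫ ω, inner ℝ (k ω) (f (X ω) (A ω)) ∂μ = 0 := by
  have hkX : Measurable[m] fun ω => (k ω, X ω) := hkm.prodMk hX
  have hfm : Measurable (Function.uncurry
      fun (y : EuclideanSpace ℝ (Fin d) × Y) a => (inner ℝ y.1 (f y.2 a) : ℝ)) :=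
    Measurable.inner (measurable_fst.comp measurable_fst)
      (hf.comp ((measurable_snd.comp measurable_fst).prodMk measurable_snd))
  have := integral_comp_of_indepFun (f := fun (y : EuclideanSpace ℝ (Fin d) × Y) a =>
    (inner ℝ y.1 (f y.2 a) : ℝ)) (hkX.mono hm le_rfl) hA (indepFun_of_indep_comap hind hkX)
    hfm.stronglyMeasurable (memLp_two_integrable_inner hk hf2)
  rw [this]
  refine integral_eq_zero_of_ae (Filter.Eventually.of_forall fun ω' => ?_)
  exact (integral_inner (hfi (X ω')) (k ω')).trans (by rw [hf0, inner_zero_right]; rfl)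

/-- Conditioning on the past integrates out what is independent of the past. -/
theorem condExp_frozen (hm : m ≤ mΩ) (hX : Measurable[m] X) (hA : Measurable A)
    (hind : Indep (MeasurableSpace.comap A inferInstance) m μ)
    {f : Y → F → ℝ} (hf : Measurable (Function.uncurry f))
    (hi : Integrable (fun ω => f (X ω) (A ω)) μ) :
    μ[fun ω => f (X ω) (A ω) | m] =ᵐ[μ] fun ω' => ∫ ω, f (X ω') (A ω) ∂μ := by
  have hXm := hX.mono hm le_rfl
  have hXA := indepFun_of_indep_comap hind hX
  have hg : StronglyMeasurable fun y => ∫ ω, f y (A ω) ∂μ := by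
    have : StronglyMeasurable (Function.uncurry fun (y : Y) (ω : Ω) => f y (A ω)) :=
      (hf.comp (measurable_fst.prodMk (hA.comp measurable_snd))).stronglyMeasurable
    exact this.integral_prod_right
  have hgi : Integrable (fun ω' => ∫ ω, f (X ω') (A ω) ∂μ) μ := by
    have h1 := (indepFun_iff_map_prod_eq_prod_map_map hXm.aemeasurable hA.aemeasurable).1 hXA
    have := Measure.isProbabilityMeasure_map (μ := μ) hA.aemeasurable
    have := Measure.isProbabilityMeasure_map (μ := μ) hXm.aemeasurable
    have hi' : Integrable (Function.uncurry f) ((μ.map X).prod (μ.map A)) := by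
      rw [← h1]
      exact (integrable_map_measure hf.aestronglyMeasurable (hXm.prodMk hA).aemeasurable).2 hi
    have h2 := hi'.integral_prod_left
    have h3 : (fun y => ∫ a, f y a ∂(μ.map A)) = fun y => ∫ ω, f y (A ω) ∂μ := by
      ext y
      exact integral_map hA.aemeasurable (hf.comp measurable_prodMk_left).aestronglyMeasurable
    simp only [Function.uncurry_apply_pair] at h2
    rw [h3] at h2
    exact h2.comp_measurable hXm
  refine (ae_eq_condExp_of_forall_setIntegral_eq hm hi (fun B _ _ => hgi.integrableOn) ?_
    (hg.comp_measurable hX).aestronglyMeasurable).symm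
  intro B hB _
  have hBm := hm B hB
  rw [← integral_indicator hBm, ← integral_indicator hBm]
  -- The indicator of the past event B is frozen together with X, which reduces the defining
  -- property of conditional expectation to Fubini.
  set k : Ω → ℝ := B.indicator fun _ => 1 with hk
  have hkm : Measurable[m] k := Measurable.indicator measurable_const hB
  have hkX : Measurable[m] fun ω => (k ω, X ω) := hkm.prodMk hX
  have hfm : Measurable (Function.uncurry fun (y : ℝ × Y) a => y.1 * f y.2 a) :=
    (measurable_fst.comp measurable_fst).mul
      (hf.comp ((measurable_snd.comp measurable_fst).prodMk measurable_snd))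
  have e1 : B.indicator (fun ω => f (X ω) (A ω)) = fun ω => k ω * f (X ω) (A ω) := by
    ext ω
    by_cases hω : ω ∈ B <;> simp [hk, hω]
  have e2 : B.indicator (fun ω' => ∫ ω, f (X ω') (A ω) ∂μ)
      = fun ω' => ∫ ω, k ω' * f (X ω') (A ω) ∂μ := by
    ext ω
    by_cases hω : ω ∈ B <;> simp [hk, hω]
  rw [e1, e2]
  refine (integral_comp_of_indepFun (f := fun (y : ℝ × Y) a => y.1 * f y.2 a)
    (hkX.mono hm le_rfl) hA (indepFun_of_indep_comap hind hkX) hfm.stronglyMeasurable ?_).symm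
  simp only
  rw [← e1]
  exact hi.indicator hBm

end Freezing

/-! ### Centered clipping errors with a random past. -/

section FrozenClipping

variable {ι Ω Y S : Type*} [Fintype ι] {m : MeasurableSpace Ω} [mΩ : MeasurableSpace Ω]
  [MeasurableSpace Y] [MeasurableSpace S] {μ : Measure Ω} [IsProbabilityMeasure μ] {d : ℕ}

/-- The clipping error of regular messages minus its conditional expectation, as a function of the
past `y` and the samples `a`. -/
def centeredClipError (μ : Measure Ω) (w : ι → ι → ℝ) (δ : ι → ℝ) (T : Y → ι → ℝ)
    (p : ι → Y → EuclideanSpace ℝ (Fin d)) (q : ι → Y → S → EuclideanSpace ℝ (Fin d))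
    (A : Ω → ι → S) (i : ι) (y : Y) (a : ι → S) : EuclideanSpace ℝ (Fin d) :=
  regularClipError w δ (T y) (fun k => p k y + q k y (a k)) i
    - ∫ ω', regularClipError w δ (T y) (fun k => p k y + q k y (A ω' k)) i ∂μ

variable {w : ι → ι → ℝ} {δ : ι → ℝ} {T : Y → ι → ℝ} {p : ι → Y → EuclideanSpace ℝ (Fin d)}
  {q : ι → Y → S → EuclideanSpace ℝ (Fin d)} {A : Ω → ι → S} {X : Ω → Y} {s : ℝ}

theorem measurable_clipError_frozen (hT : ∀ i, Measurable fun y => T y i)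
    (hp : ∀ i, Measurable (p i)) (hq : ∀ i, Measurable (Function.uncurry (q i))) (i : ι) :
    Measurable (Function.uncurry fun (y : Y) (a : ι → S) =>
      regularClipError w δ (T y) (fun k => p k y + q k y (a k)) i) :=
  measurable_regularClipError (T := fun v : Y × (ι → S) => T v.1)
    (z := fun (v : Y × (ι → S)) k => p k v.1 + q k v.1 (v.2 k))
    (fun i => (hT i).comp measurable_fst)
    (fun k => ((hp k).comp measurable_fst).add ((hq k).comp
      (measurable_fst.prodMk ((measurable_pi_apply k).comp measurable_snd)))) i

theorem measurable_integral_clipError (hT : ∀ i, Measurable fun y => T y i)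
    (hp : ∀ i, Measurable (p i)) (hq : ∀ i, Measurable (Function.uncurry (q i)))
    (hA : Measurable A) (i : ι) :
    Measurable fun y : Y =>
      ∫ ω', regularClipError w δ (T y) (fun k => p k y + q k y (A ω' k)) i ∂μ := by
  have h1 : StronglyMeasurable (Function.uncurry fun (y : Y) (ω : Ω) =>
      regularClipError w δ (T y) (fun k => p k y + q k y (A ω k)) i) :=
    ((measurable_clipError_frozen hT hp hq i).comp
      (measurable_fst.prodMk (hA.comp measurable_snd))).stronglyMeasurable
  exact h1.integral_prod_right.measurable

theorem measurable_centeredClipError (hT : ∀ i, Measurable fun y => T y i)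
    (hp : ∀ i, Measurable (p i)) (hq : ∀ i, Measurable (Function.uncurry (q i)))
    (hA : Measurable A) (i : ι) :
    Measurable (Function.uncurry (centeredClipError μ w δ T p q A i)) :=
  (measurable_clipError_frozen hT hp hq i).sub
    ((measurable_integral_clipError hT hp hq hA i).comp measurable_fst)

variable (hw : ∀ i j, 0 ≤ w i j) (hsymm : ∀ i j, w i j = w j i) (hrow : ∀ i, ∑ j, w i j ≤ 1)
  (hT0 : ∀ y i, 0 ≤ T y i) (hT : ∀ i, Measurable fun y => T y i) (hp : ∀ i, Measurable (p i))
  (hq : ∀ i, Measurable (Function.uncurry (q i))) (hA : Measurable A)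
  (hAi : iIndepFun (fun i ω => A ω i) μ)
  (hq2 : ∀ i y, MemLp (fun ω => q i y (A ω i)) 2 μ)
  (hq0 : ∀ i y, ∫ ω, q i y (A ω i) ∂μ = 0) (hs0 : 0 ≤ s)
  (hqs : ∀ i y, ∫ ω, ‖q i y (A ω i)‖ ^ 2 ∂μ ≤ s)

include hq hA in
omit [Fintype ι] in
theorem measurable_frozen_noise (i : ι) (y : Y) : Measurable fun ω => q i y (A ω i) :=
  (hq i).comp (measurable_const.prodMk ((measurable_pi_apply i).comp hA))

include hq hAi in
omit [Fintype ι] [IsProbabilityMeasure μ] in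
theorem iIndepFun_frozen_noise (y : Y) : iIndepFun (fun i ω => q i y (A ω i)) μ :=
  hAi.comp (fun i a => q i y a) fun i => (hq i).comp (measurable_const.prodMk measurable_id)

include hT0 hq hA hq2 in
theorem memLp_centeredClipError_frozen (i : ι) (y : Y) :
    MemLp (fun ω => centeredClipError μ w δ T p q A i y (A ω)) 2 μ :=
  (memLp_regularClipError (hT0 y) (fun i => measurable_frozen_noise hq hA i y)
    (fun i => hq2 i y) i).sub (memLp_const _)

include hT0 hq hA hq2 in
theorem integral_centeredClipError_frozen (i : ι) (y : Y) :
    ∫ ω, centeredClipError μ w δ T p q A i y (A ω) ∂μ = 0 := by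
  have h1 : Integrable (fun ω => regularClipError w δ (T y) (fun k => p k y + q k y (A ω k)) i) μ :=
    (memLp_regularClipError (hT0 y) (fun i => measurable_frozen_noise hq hA i y)
      (fun i => hq2 i y) i).integrable one_le_two
  simp only [centeredClipError]
  rw [integral_sub h1 (integrable_const _)]
  simp

variable (hm : m ≤ mΩ) (hX : Measurable[m] X)
  (hind : Indep (MeasurableSpace.comap A inferInstance) m μ)

include hw hrow hT0 hT hp hq hA hAi hq2 hq0 hs0 hqs hm hX hind in
theorem centeredClipError_sq_le (i : ι) :
    MemLp (fun ω => centeredClipError μ w δ T p q A i (X ω) (A ω)) 2 μ ∧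
      ∫ ω, ‖centeredClipError μ w δ T p q A i (X ω) (A ω)‖ ^ 2 ∂μ ≤ 2 * s :=
  memLp_two_of_frozen (hX.mono hm le_rfl) hA (indepFun_of_indep_comap hind hX)
    (measurable_centeredClipError hT hp hq hA i)
    (memLp_centeredClipError_frozen hT0 hq hA hq2 i)
    fun y => variance_regularClipError_le (p := fun k => p k y) hw hrow (hT0 y)
      (iIndepFun_frozen_noise hq hAi y) (fun i => measurable_frozen_noise hq hA i y)
      (fun i => hq2 i y) (fun i => hq0 i y) hs0 (fun i => hqs i y) i

include hw hsymm hrow hT0 hT hp hq hA hAi hq2 hq0 hs0 hqs hm hX hind in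
theorem mean_centeredClipError_sq_le [Nonempty ι] :
    ∫ ω, ‖mean fun i => centeredClipError μ w δ T p q A i (X ω) (A ω)‖ ^ 2 ∂μ
      ≤ 2 * s / Fintype.card ι := by
  refine (memLp_two_of_frozen (f := fun y a =>
    mean fun i => centeredClipError μ w δ T p q A i y a)
    (hX.mono hm le_rfl) hA (indepFun_of_indep_comap hind hX)
    ?_ (fun y => ?_) fun y => ?_).2
  · have h1 : Measurable fun v : Y × (ι → S) =>
        ∑ i, Function.uncurry (centeredClipError μ w δ T p q A i) v :=
      Finset.measurable_sum _ fun i _ => measurable_centeredClipError hT hp hq hA i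
    exact h1.const_smul (1 / (Fintype.card ι : ℝ))
  · exact (memLp_finsetSum _ fun i _ =>
      memLp_centeredClipError_frozen hT0 hq hA hq2 i y).const_smul (1 / (Fintype.card ι : ℝ))
  · exact variance_mean_regularClipError_le (p := fun k => p k y) hw hsymm hrow (hT0 y)
      (iIndepFun_frozen_noise hq hAi y) (fun i => measurable_frozen_noise hq hA i y)
      (fun i => hq2 i y) (fun i => hq0 i y) hs0 (fun i => hqs i y)

include hw hrow hT0 hT hp hq hA hAi hq2 hq0 hs0 hqs hm hX hind in
theorem integral_inner_centeredClipError (i : ι) {k : Ω → EuclideanSpace ℝ (Fin d)}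
    (hkm : Measurable[m] k) (hk : MemLp k 2 μ) :
    ∫ ω, inner ℝ (k ω) (centeredClipError μ w δ T p q A i (X ω) (A ω)) ∂μ = 0 :=
  integral_inner_frozen_eq_zero hm hX hA hind (measurable_centeredClipError hT hp hq hA i)
    (fun y => (memLp_centeredClipError_frozen hT0 hq hA hq2 i y).integrable one_le_two)
    (integral_centeredClipError_frozen hT0 hq hA hq2 i) hkm hk
    (centeredClipError_sq_le hw hrow hT0 hT hp hq hA hAi hq2 hq0 hs0 hqs hm hX hind i).1

end FrozenClipping

end ClippedGossip

end

noncomputable section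

namespace ClippedGossip

/-! ### Gradients of the local and the average objectives. -/

section Gradients

variable {V S : Type*} [MeasurableSpace S] {d : ℕ} {R : Finset V}
  {f : V → EuclideanSpace ℝ (Fin d) → ℝ}
  {g : V → EuclideanSpace ℝ (Fin d) → S → EuclideanSpace ℝ (Fin d)}
  {D : V → Measure S} {L σ ζ : ℝ}

theorem continuous_of_norm_sub_le {E F : Type*} [NormedAddCommGroup E] [NormedAddCommGroup F]
    {φ : E → F} (hL : 0 ≤ L) (h : ∀ x y, ‖φ x - φ y‖ ≤ L * ‖x - y‖) : Continuous φ :=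
  (LipschitzWith.of_dist_le_mul (K := ⟨L, hL⟩) fun x y => by
    rw [dist_eq_norm, dist_eq_norm]; exact h x y).continuous

theorem IsProblem.measurable_gradient (hL : 0 < L) (hp : IsProblem R f g D L σ ζ) {i : V}
    (hi : i ∈ R) : Measurable (gradient (f i)) :=
  (continuous_of_norm_sub_le hL.le (hp.smooth i hi)).measurable

theorem IsProblem.hasGradientAt_avgObjective (hp : IsProblem R f g D L σ ζ)
    (x : EuclideanSpace ℝ (Fin d)) : HasGradientAt (avgObjective R f)
      ((1 / (R.card : ℝ)) • ∑ i ∈ R, gradient (f i) x) x := by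
  rw [hasGradientAt_iff_hasFDerivAt, map_smul, map_sum]
  exact (HasFDerivAt.fun_sum fun i hi =>
    (hp.differentiable i hi x).hasGradientAt.hasFDerivAt).const_mul _

theorem IsProblem.gradient_avgObjective (hp : IsProblem R f g D L σ ζ)
    (x : EuclideanSpace ℝ (Fin d)) : gradient (avgObjective R f) x
      = (1 / (R.card : ℝ)) • ∑ i ∈ R, gradient (f i) x :=
  (hp.hasGradientAt_avgObjective x).gradient

theorem IsProblem.differentiable_avgObjective (hp : IsProblem R f g D L σ ζ) :
    Differentiable ℝ (avgObjective R f) :=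
  fun x => (hp.hasGradientAt_avgObjective x).differentiableAt

theorem IsProblem.smooth_avgObjective (hL : 0 < L) (hp : IsProblem R f g D L σ ζ)
    (x y : EuclideanSpace ℝ (Fin d)) :
    ‖gradient (avgObjective R f) x - gradient (avgObjective R f) y‖ ≤ L * ‖x - y‖ := by
  rw [hp.gradient_avgObjective, hp.gradient_avgObjective, ← smul_sub, ← Finset.sum_sub_distrib,
    norm_smul, Real.norm_of_nonneg (by positivity)]
  have h1 : ‖∑ i ∈ R, (gradient (f i) x - gradient (f i) y)‖ ≤ R.card * (L * ‖x - y‖) := by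
    refine (norm_sum_le_of_le _ fun i hi => hp.smooth i hi x y).trans ?_
    simp
  have h0 : 0 ≤ L * ‖x - y‖ := by positivity
  rcases Nat.eq_zero_or_pos R.card with hc | hc
  · simp [hc, h0]
  · have hc' : (0 : ℝ) < R.card := by exact_mod_cast hc
    rw [one_div_mul_eq_div, div_le_iff₀ hc']
    linarith

theorem memLp_two_lipschitz_comp {Ω : Type*} [MeasurableSpace Ω] {μ : Measure Ω}
    [IsProbabilityMeasure μ] {φ : EuclideanSpace ℝ (Fin d) → EuclideanSpace ℝ (Fin d)}
    (hL : 0 ≤ L) (h : ∀ x y, ‖φ x - φ y‖ ≤ L * ‖x - y‖) {X : Ω → EuclideanSpace ℝ (Fin d)}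
    (hX : MemLp X 2 μ) : MemLp (fun ω => φ (X ω)) 2 μ := by
  have h1 : MemLp (fun ω => φ (X ω) - φ 0) 2 μ :=
    MemLp.of_le_mul (c := L) hX
      (((continuous_of_norm_sub_le hL h).comp_aestronglyMeasurable hX.1).sub
        aestronglyMeasurable_const)
      (Filter.Eventually.of_forall fun ω => by simpa using h (X ω) 0)
  exact (h1.add (memLp_const (φ 0))).ae_eq (Filter.Eventually.of_forall fun ω => by simp)

end Gradients

/-! ### Gradient noise and clipping radii in one step. -/

section Step

variable {V S Ω : Type*} [Fintype V] [DecidableEq V] [MeasurableSpace S] [mΩ : MeasurableSpace Ω]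
  {d : ℕ} {G : SimpleGraph V} {R : Finset V} {W : V → V → ℝ}
  {f : V → EuclideanSpace ℝ (Fin d) → ℝ}
  {g : V → EuclideanSpace ℝ (Fin d) → S → EuclideanSpace ℝ (Fin d)}
  {D : V → Measure S} {L σ ζ : ℝ} {μ : Measure Ω} [IsProbabilityMeasure μ] {ℱ : Filtration ℕ mΩ}
  {ξ : ℕ → V → Ω → S} {byz : ℕ → V → V → Ω → EuclideanSpace ℝ (Fin d)}

/-- The samples of the regular workers in one step. -/
def samples (R : Finset V) (ξ : V → Ω → S) (ω : Ω) (i : {i // i ∈ R}) : S := ξ i ω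

omit [Fintype V] [DecidableEq V] [IsProbabilityMeasure μ] in
theorem IsExecution.measurable_samples (he : IsExecution R D μ ℱ ξ byz) (t : ℕ) :
    Measurable (samples R (ξ t)) :=
  measurable_pi_lambda _ fun i => (he.sample_measurable t i i.2).mono (ℱ.le _) le_rfl

omit [Fintype V] [DecidableEq V] [IsProbabilityMeasure μ] in
theorem IsExecution.indep_samples (he : IsExecution R D μ ℱ ξ byz) (t : ℕ) :
    Indep (MeasurableSpace.comap (samples R (ξ t)) inferInstance) (ℱ t) μ := by
  have h := he.sample_indep_past t
  have e : MeasurableSpace.comap (samples R (ξ t)) inferInstance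
      = ⨆ i : {i // i ∈ R}, MeasurableSpace.comap (ξ t i) inferInstance := by
    change MeasurableSpace.comap _ (⨆ i, MeasurableSpace.comap _ _) = _
    rw [MeasurableSpace.comap_iSup]
    refine iSup_congr fun i => ?_
    rw [MeasurableSpace.comap_comp]
    rfl
  rw [e]
  exact h

omit [Fintype V] [DecidableEq V] [IsProbabilityMeasure μ] in
theorem IsExecution.measurable_sample (he : IsExecution R D μ ℱ ξ byz) (t : ℕ) {i : V}
    (hi : i ∈ R) : Measurable (ξ t i) := (he.sample_measurable t i hi).mono (ℱ.le _) le_rfl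

omit [Fintype V] [DecidableEq V] in
theorem noise_frozen (hp : IsProblem R f g D L σ ζ) (he : IsExecution R D μ ℱ ξ byz) (t : ℕ)
    {i : V} (hi : i ∈ R) (x : EuclideanSpace ℝ (Fin d)) :
    MemLp (fun ω => g i x (ξ t i ω) - gradient (f i) x) 2 μ ∧
      ∫ ω, (g i x (ξ t i ω) - gradient (f i) x) ∂μ = 0 ∧
      ∫ ω, ‖g i x (ξ t i ω) - gradient (f i) x‖ ^ 2 ∂μ ≤ σ ^ 2 := by
  have hξ := he.measurable_sample t hi
  have hg : Measurable (g i x) := (hp.measurable i hi).comp measurable_prodMk_left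
  have hgs : Measurable fun s => ‖g i x s - gradient (f i) x‖ ^ 2 :=
    ((hg.sub_const _).norm.pow_const 2)
  have h1 := hp.sq_integrable i hi x
  have h2 := hp.noise i hi x
  have h3 := hp.integrable i hi x
  have h4 := hp.unbiased i hi x
  rw [← he.sample_law t i hi] at h1 h2 h3 h4
  rw [integral_map hξ.aemeasurable hgs.aestronglyMeasurable] at h2
  rw [integral_map hξ.aemeasurable hg.aestronglyMeasurable] at h4
  have h1' := (integrable_map_measure hgs.aestronglyMeasurable hξ.aemeasurable).1 h1
  have h3' := (integrable_map_measure hg.aestronglyMeasurable hξ.aemeasurable).1 h3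
  refine ⟨(memLp_two_iff_integrable_sq_norm
    ((hg.comp hξ).sub_const _).aestronglyMeasurable).2 h1', ?_, h2⟩
  have h5 := integral_sub h3' (integrable_const (μ := μ) (gradient (f i) x))
  simp only [Function.comp_apply] at h5
  rw [h5, h4]
  simp

/-- The models and momenta of the regular workers are square integrable and known. -/
structure IsSquareIntegrable (R : Finset V) (μ : Measure Ω) (m : MeasurableSpace Ω)
    (s : State V Ω d) : Prop where
  x_measurable : ∀ i ∈ R, Measurable[m] (s.x i)
  m_measurable : ∀ i ∈ R, Measurable[m] (s.m i)
  x_memLp : ∀ i ∈ R, MemLp (s.x i) 2 μ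
  m_memLp : ∀ i ∈ R, MemLp (s.m i) 2 μ

/-- The noise of the stochastic gradients. -/
def gradNoise (f : V → EuclideanSpace ℝ (Fin d) → ℝ)
    (g : V → EuclideanSpace ℝ (Fin d) → S → EuclideanSpace ℝ (Fin d)) (ξ : V → Ω → S)
    (s : State V Ω d) (i : V) (ω : Ω) : EuclideanSpace ℝ (Fin d) :=
  g i (s.x i ω) (ξ i ω) - gradient (f i) (s.x i ω)

variable {s : State V Ω d} {t : ℕ} {α η : ℝ}

omit [Fintype V] [DecidableEq V] in
theorem measurable_noise (hL : 0 < L) (hp : IsProblem R f g D L σ ζ) {i : V} (hi : i ∈ R) :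
    Measurable (Function.uncurry fun x a => g i x a - gradient (f i) x) :=
  (hp.measurable i hi).sub ((hp.measurable_gradient hL hi).comp measurable_fst)

omit [Fintype V] [DecidableEq V] [IsProbabilityMeasure μ] in
theorem indep_sample (he : IsExecution R D μ ℱ ξ byz) (t : ℕ) {i : V} (hi : i ∈ R) :
    Indep (MeasurableSpace.comap (ξ t i) inferInstance) (ℱ t) μ :=
  indep_of_indep_of_le_left (he.sample_indep_past t)
    (le_iSup (fun i : {i // i ∈ R} => MeasurableSpace.comap (ξ t i) inferInstance) ⟨i, hi⟩)

omit [Fintype V] [DecidableEq V] in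
theorem gradNoise_sq (hL : 0 < L) (hp : IsProblem R f g D L σ ζ)
    (he : IsExecution R D μ ℱ ξ byz) (hs : IsSquareIntegrable R μ (ℱ t) s) {i : V} (hi : i ∈ R) :
    MemLp (gradNoise f g (ξ t) s i) 2 μ ∧
      ∫ ω, ‖gradNoise f g (ξ t) s i ω‖ ^ 2 ∂μ ≤ σ ^ 2 :=
  memLp_two_of_frozen ((hs.x_measurable i hi).mono (ℱ.le t) le_rfl) (he.measurable_sample t hi)
    (indepFun_of_indep_comap (indep_sample he t hi) (hs.x_measurable i hi))
    (measurable_noise hL hp hi) (fun x => (noise_frozen hp he t hi x).1)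
    (fun x => (noise_frozen hp he t hi x).2.2)

omit [Fintype V] [DecidableEq V] in
theorem integral_inner_gradNoise (hL : 0 < L) (hp : IsProblem R f g D L σ ζ)
    (he : IsExecution R D μ ℱ ξ byz) (hs : IsSquareIntegrable R μ (ℱ t) s) {i : V} (hi : i ∈ R)
    {k : Ω → EuclideanSpace ℝ (Fin d)} (hkm : Measurable[ℱ t] k) (hk : MemLp k 2 μ) :
    ∫ ω, inner ℝ (k ω) (gradNoise f g (ξ t) s i ω) ∂μ = 0 :=
  integral_inner_frozen_eq_zero (ℱ.le t) (hs.x_measurable i hi) (he.measurable_sample t hi)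
    (indep_sample he t hi) (measurable_noise hL hp hi)
    (fun x => (noise_frozen hp he t hi x).1.integrable one_le_two)
    (fun x => (noise_frozen hp he t hi x).2.1) hkm hk (gradNoise_sq hL hp he hs hi).1

-- Once both models are frozen, the noises are functions of two independent samples and have mean
-- zero.
omit [Fintype V] [DecidableEq V] in
theorem integral_inner_gradNoise_pair (hL : 0 < L) (hp : IsProblem R f g D L σ ζ)
    (he : IsExecution R D μ ℱ ξ byz) (hs : IsSquareIntegrable R μ (ℱ t) s) {i j : V} (hi : i ∈ R)
    (hj : j ∈ R) (hij : i ≠ j) :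
    ∫ ω, inner ℝ (gradNoise f g (ξ t) s i ω) (gradNoise f g (ξ t) s j ω) ∂μ = 0 := by
  have hX : Measurable[ℱ t] fun ω => (s.x i ω, s.x j ω) :=
    (hs.x_measurable i hi).prodMk (hs.x_measurable j hj)
  have hfm : Measurable (Function.uncurry
      fun (y : EuclideanSpace ℝ (Fin d) × EuclideanSpace ℝ (Fin d)) (a : {i // i ∈ R} → S) =>
        (inner ℝ (g i y.1 (a ⟨i, hi⟩) - gradient (f i) y.1)
          (g j y.2 (a ⟨j, hj⟩) - gradient (f j) y.2) : ℝ)) :=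
    Measurable.inner
      ((measurable_noise hL hp hi).comp ((measurable_fst.comp measurable_fst).prodMk
        ((measurable_pi_apply _).comp measurable_snd)))
      ((measurable_noise hL hp hj).comp ((measurable_snd.comp measurable_fst).prodMk
        ((measurable_pi_apply _).comp measurable_snd)))
  have h := integral_comp_of_indepFun (f := fun
      (y : EuclideanSpace ℝ (Fin d) × EuclideanSpace ℝ (Fin d)) (a : {i // i ∈ R} → S) =>
        (inner ℝ (g i y.1 (a ⟨i, hi⟩) - gradient (f i) y.1)
          (g j y.2 (a ⟨j, hj⟩) - gradient (f j) y.2) : ℝ))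
    (hX.mono (ℱ.le t) le_rfl) (he.measurable_samples t)
    (indepFun_of_indep_comap (he.indep_samples t) hX) hfm.stronglyMeasurable
    (memLp_two_integrable_inner (gradNoise_sq hL hp he hs hi).1 (gradNoise_sq hL hp he hs hj).1)
  refine h.trans (integral_eq_zero_of_ae (Filter.Eventually.of_forall fun ω' => ?_))
  have hind := (he.sample_indep t).indepFun
    (show (⟨i, hi⟩ : {i // i ∈ R}) ≠ ⟨j, hj⟩ from fun e => hij (congrArg Subtype.val e))
  exact integral_inner_eq_zero_of_indepFun (hind.comp
      ((measurable_noise hL hp hi).comp (measurable_prodMk_left (x := s.x i ω')))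
      ((measurable_noise hL hp hj).comp (measurable_prodMk_left (x := s.x j ω'))))
    ((noise_frozen hp he t hi _).1.integrable one_le_two)
    ((noise_frozen hp he t hj _).1.integrable one_le_two) (noise_frozen hp he t hj _).2.1

omit [Fintype V] [DecidableEq V] in
theorem memLp_gradient (hL : 0 < L) (hp : IsProblem R f g D L σ ζ)
    (hs : IsSquareIntegrable R μ (ℱ t) s) {i : V} (hi : i ∈ R) :
    MemLp (fun ω => gradient (f i) (s.x i ω)) 2 μ :=
  memLp_two_lipschitz_comp hL.le (hp.smooth i hi) (hs.x_memLp i hi)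

omit [Fintype V] [DecidableEq V] [MeasurableSpace S] mΩ in
theorem nextMomentum_eq (ω : Ω) (i : V) : nextMomentum g α (ξ t) s i ω
    = (1 - α) • s.m i ω + α • (gradient (f i) (s.x i ω) + gradNoise f g (ξ t) s i ω) := by
  rw [nextMomentum, gradNoise, add_sub_cancel]

omit [Fintype V] [DecidableEq V] in
theorem memLp_nextMomentum (hL : 0 < L) (hp : IsProblem R f g D L σ ζ)
    (he : IsExecution R D μ ℱ ξ byz) (hs : IsSquareIntegrable R μ (ℱ t) s) {i : V} (hi : i ∈ R) :
    MemLp (nextMomentum g α (ξ t) s i) 2 μ := by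
  have h := ((hs.m_memLp i hi).const_smul (1 - α)).add
    (((memLp_gradient hL hp hs hi).add (gradNoise_sq hL hp he hs hi).1).const_smul α)
  refine h.ae_eq (Filter.Eventually.of_forall fun ω => ?_)
  rw [nextMomentum_eq (f := f)]
  rfl

omit [Fintype V] [DecidableEq V] [IsProbabilityMeasure μ] in
theorem measurable_nextMomentum (hp : IsProblem R f g D L σ ζ)
    (he : IsExecution R D μ ℱ ξ byz) (hs : IsSquareIntegrable R μ (ℱ t) s) {i : V} (hi : i ∈ R) :
    Measurable[ℱ (t + 1)] (nextMomentum g α (ξ t) s i) := by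
  have hle := ℱ.mono (Nat.le_succ t)
  have h1 : Measurable[ℱ (t + 1)] fun ω => g i (s.x i ω) (ξ t i ω) :=
    (hp.measurable i hi).comp
      (((hs.x_measurable i hi).mono hle le_rfl).prodMk (he.sample_measurable t i hi))
  exact (((hs.m_measurable i hi).mono hle le_rfl).const_smul (1 - α)).add (h1.const_smul α)

omit [Fintype V] [DecidableEq V] in
theorem memLp_halfStep (hL : 0 < L) (hp : IsProblem R f g D L σ ζ)
    (he : IsExecution R D μ ℱ ξ byz) (hs : IsSquareIntegrable R μ (ℱ t) s) {i : V} (hi : i ∈ R) :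
    MemLp (halfStep g α η (ξ t) s i) 2 μ :=
  (hs.x_memLp i hi).sub ((memLp_nextMomentum hL hp he hs hi).const_smul η)

omit [Fintype V] [DecidableEq V] [IsProbabilityMeasure μ] in
theorem measurable_halfStep (hp : IsProblem R f g D L σ ζ)
    (he : IsExecution R D μ ℱ ξ byz) (hs : IsSquareIntegrable R μ (ℱ t) s) {i : V} (hi : i ∈ R) :
    Measurable[ℱ (t + 1)] (halfStep g α η (ξ t) s i) :=
  ((hs.x_measurable i hi).mono (ℱ.mono (Nat.le_succ t)) le_rfl).sub
    ((measurable_nextMomentum hp he hs hi).const_smul η)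

omit [MeasurableSpace S] [IsProbabilityMeasure μ] in
theorem measurable_clipRadius (i : V) :
    Measurable[ℱ t] (clipRadius R W g α η μ ℱ t (ξ t) s i) := by
  have h : Measurable[ℱ t] fun ω => (1 / byzWeight R W i) * ∑ j ∈ R, W i j *
      (μ[fun ω' => ‖halfStep g α η (ξ t) s i ω' - halfStep g α η (ξ t) s j ω'‖ ^ 2 | ℱ t]) ω :=
    (Finset.measurable_sum _ fun j _ =>
      stronglyMeasurable_condExp.measurable.const_mul (W i j)).const_mul _
  exact Real.continuous_sqrt.measurable.comp h

omit [MeasurableSpace S] [IsProbabilityMeasure μ] in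
theorem clipRadius_nonneg (i : V) (ω : Ω) :
    0 ≤ clipRadius R W g α η μ ℱ t (ξ t) s i ω := Real.sqrt_nonneg _

omit [MeasurableSpace S] [IsProbabilityMeasure μ] in
theorem clipRadius_sq (h : IsNetwork G R W) {i : V} (hi : i ∈ R) :
    ∀ᵐ ω ∂μ, clipRadius R W g α η μ ℱ t (ξ t) s i ω ^ 2 = (1 / byzWeight R W i) *
      ∑ j : {j // j ∈ R}, W i j *
      (μ[fun ω' => ‖halfStep g α η (ξ t) s i ω' - halfStep g α η (ξ t) s j ω'‖ ^ 2 | ℱ t]) ω := by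
  have h1 : ∀ᵐ ω ∂μ, ∀ j : {j // j ∈ R}, 0 ≤
      (μ[fun ω' => ‖halfStep g α η (ξ t) s i ω' - halfStep g α η (ξ t) s j ω'‖ ^ 2 | ℱ t]) ω := by
    rw [ae_all_iff]
    exact fun j => condExp_nonneg (Filter.Eventually.of_forall fun ω => sq_nonneg _)
  filter_upwards [h1] with ω hω
  rw [clipRadius, Real.sq_sqrt]
  · rw [← Finset.sum_coe_sort R]
  · rw [← Finset.sum_coe_sort R]
    exact mul_nonneg (one_div_nonneg.2 (h.byzWeight_nonneg hi))
      (Finset.sum_nonneg fun j _ => mul_nonneg (h.nonneg i hi j) (hω j))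

omit [MeasurableSpace S] [IsProbabilityMeasure μ] in
theorem memLp_clipRadius (h : IsNetwork G R W) {i : V} (hi : i ∈ R) :
    MemLp (clipRadius R W g α η μ ℱ t (ξ t) s i) 2 μ := by
  refine (memLp_two_iff_integrable_sq
    ((measurable_clipRadius i).mono (ℱ.le t) le_rfl).aestronglyMeasurable).2 ?_
  refine Integrable.congr ?_ (Filter.EventuallyEq.symm (clipRadius_sq h hi))
  exact (integrable_finsetSum _ fun j _ => integrable_condExp.const_mul _).const_mul _

omit [MeasurableSpace S] in
/-- The mean square of `δ_i τ_i`. -/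
theorem integral_byzWeight_mul_clipRadius_sq (h : IsNetwork G R W) {i : V} (hi : i ∈ R) :
    ∫ ω, (byzWeight R W i * clipRadius R W g α η μ ℱ t (ξ t) s i ω) ^ 2 ∂μ
      ≤ byzWeight R W i * ∑ j : {j // j ∈ R}, W i j *
        ∫ ω, ‖halfStep g α η (ξ t) s i ω - halfStep g α η (ξ t) s j ω‖ ^ 2 ∂μ := by
  by_cases h0 : byzWeight R W i = 0
  · simp [h0]
  · refine le_of_eq ?_
    simp_rw [mul_pow]
    rw [integral_const_mul, integral_congr_ae (clipRadius_sq h hi), integral_const_mul,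
      integral_finsetSum _ fun j _ => integrable_condExp.const_mul _]
    simp_rw [integral_const_mul, fun j => integral_condExp (μ := μ) (ℱ.le t)
      (f := fun ω' => ‖halfStep g α η (ξ t) s i ω' - halfStep g α η (ξ t) s j ω'‖ ^ 2)]
    field_simp

end Step

end ClippedGossip

end

noncomputable section

namespace ClippedGossip

theorem measurable_triple {Ω ι A B C : Type*} {m : MeasurableSpace Ω} [MeasurableSpace A]
    [MeasurableSpace B] [MeasurableSpace C] {u : ι → Ω → A} {v : ι → Ω → B} {w : ι → Ω → C}
    (hu : ∀ i, Measurable (u i)) (hv : ∀ i, Measurable (v i)) (hw : ∀ i, Measurable (w i)) :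
    Measurable fun ω => (fun i => u i ω, fun i => v i ω, fun i => w i ω) :=
  (measurable_pi_lambda _ hu).prodMk ((measurable_pi_lambda _ hv).prodMk (measurable_pi_lambda _ hw))

/-! ### Decomposition of one step into gossip, bias and centered error. -/

section Decomposition

variable {V S Ω : Type*} [Fintype V] [DecidableEq V] [MeasurableSpace S] [mΩ : MeasurableSpace Ω]
  {d : ℕ} {G : SimpleGraph V} {R : Finset V} {W : V → V → ℝ}
  {f : V → EuclideanSpace ℝ (Fin d) → ℝ}
  {g : V → EuclideanSpace ℝ (Fin d) → S → EuclideanSpace ℝ (Fin d)}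
  {D : V → Measure S} {L σ ζ : ℝ} {μ : Measure Ω} [IsProbabilityMeasure μ] {ℱ : Filtration ℕ mΩ}
  {ξ : ℕ → V → Ω → S} {byz : ℕ → V → V → Ω → EuclideanSpace ℝ (Fin d)}

/-- The values of models, momenta and clipping radii of the regular workers. -/
abbrev PastData (R : Finset V) (d : ℕ) : Type _ :=
  ({i // i ∈ R} → EuclideanSpace ℝ (Fin d)) × ({i // i ∈ R} → EuclideanSpace ℝ (Fin d)) ×
    ({i // i ∈ R} → ℝ)

/-- The models, momenta and clipping radii at the start of a step. -/
def pastData (R : Finset V) (W : V → V → ℝ)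
    (g : V → EuclideanSpace ℝ (Fin d) → S → EuclideanSpace ℝ (Fin d)) (α η : ℝ)
    (μ : Measure Ω) (ℱ : Filtration ℕ mΩ) (t : ℕ) (ξ : V → Ω → S) (s : State V Ω d) (ω : Ω) :
    PastData R d :=
  (fun i => s.x i ω, fun i => s.m i ω, fun i => clipRadius R W g α η μ ℱ t ξ s i ω)

/-- The part of the local update that is determined by the past. -/
def driftPart (f : V → EuclideanSpace ℝ (Fin d) → ℝ) (α η : ℝ) (i : {i // i ∈ R})
    (y : PastData R d) : EuclideanSpace ℝ (Fin d) :=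
  y.1 i - η • ((1 - α) • y.2.1 i + α • gradient (f i) (y.1 i))

/-- The part of the local update that comes from the gradient noise. -/
def noisePart (f : V → EuclideanSpace ℝ (Fin d) → ℝ)
    (g : V → EuclideanSpace ℝ (Fin d) → S → EuclideanSpace ℝ (Fin d)) (α η : ℝ)
    (i : {i // i ∈ R}) (y : PastData R d) (a : S) : EuclideanSpace ℝ (Fin d) :=
  -(η * α) • (g i (y.1 i) a - gradient (f i) (y.1 i))

/-- The nonnegative clipping radii. -/
def radiusPart (y : PastData R d) (i : {i // i ∈ R}) : ℝ := |y.2.2 i|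

/-- The weights between regular workers. -/
def regularWeight (R : Finset V) (W : V → V → ℝ) (i j : {i // i ∈ R}) : ℝ := W i j

/-- The change of the model of worker `i` that is caused by Byzantine messages. -/
def byzError (R : Finset V) (W : V → V → ℝ)
    (g : V → EuclideanSpace ℝ (Fin d) → S → EuclideanSpace ℝ (Fin d)) (α η : ℝ)
    (μ : Measure Ω) (ℱ : Filtration ℕ mΩ) (t : ℕ) (ξ : V → Ω → S)
    (byz : V → V → Ω → EuclideanSpace ℝ (Fin d)) (s : State V Ω d) (i : V) (ω : Ω) :
    EuclideanSpace ℝ (Fin d) :=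
  ∑ j ∈ Rᶜ, W i j • (clippedMsg R W g α η μ ℱ t ξ byz s j i ω - halfStep g α η ξ s i ω)

/-- The conditional expectation of the clipping error of regular messages. -/
def clipBias (μ : Measure Ω) (R : Finset V) (W : V → V → ℝ)
    (f : V → EuclideanSpace ℝ (Fin d) → ℝ)
    (g : V → EuclideanSpace ℝ (Fin d) → S → EuclideanSpace ℝ (Fin d)) (α η : ℝ) (ξ : V → Ω → S)
    (i : {i // i ∈ R}) (y : PastData R d) : EuclideanSpace ℝ (Fin d) :=
  ∫ ω', regularClipError (regularWeight R W) (fun i => byzWeight R W i) (radiusPart y)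
    (fun k => driftPart f α η k y + noisePart f g α η k y (samples R ξ ω' k)) i ∂μ

variable {s : State V Ω d} {t : ℕ} {α η : ℝ}

omit [IsProbabilityMeasure μ] [MeasurableSpace S] in
theorem halfStep_eq (ω : Ω) (i : {i // i ∈ R}) : halfStep g α η (ξ t) s i ω
    = driftPart f α η i (pastData R W g α η μ ℱ t (ξ t) s ω)
      + noisePart f g α η i (pastData R W g α η μ ℱ t (ξ t) s ω) (samples R (ξ t) ω i) := by
  rw [halfStep, nextMomentum_eq (f := f)]
  simp only [driftPart, noisePart, pastData, samples, gradNoise]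
  module

-- The absolute value in `radiusPart` serves the frozen estimates, which are required for every
-- value of the past data; on the data of the algorithm it has no effect.
omit [MeasurableSpace S] [IsProbabilityMeasure μ] in
theorem radiusPart_pastData (ω : Ω) :
    radiusPart (pastData R W g α η μ ℱ t (ξ t) s ω)
      = fun i : {i // i ∈ R} => clipRadius R W g α η μ ℱ t (ξ t) s i ω := by
  ext i
  exact abs_of_nonneg (clipRadius_nonneg _ _)

omit [MeasurableSpace S] [IsProbabilityMeasure μ] in
theorem clippedMsg_of_mem {i j : V} (hj : j ∈ R) (ω : Ω) :
    clippedMsg R W g α η μ ℱ t (ξ t) (byz t) s j i ω = halfStep g α η (ξ t) s j ω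
      + clipResidual (byzWeight R W i) (clipRadius R W g α η μ ℱ t (ξ t) s i ω)
        (halfStep g α η (ξ t) s j ω - halfStep g α η (ξ t) s i ω) := by
  simp only [clippedMsg, received, if_pos hj, clipResidual]
  split_ifs
  · simp
  · abel

omit [MeasurableSpace S] [IsProbabilityMeasure μ] in
/-- One step is gossip averaging up to three errors. -/
theorem sum_clippedMsg_eq (i : {i // i ∈ R}) (ω : Ω) :
    ∑ j, W i j • clippedMsg R W g α η μ ℱ t (ξ t) (byz t) s j i ω
      = ∑ j : {j // j ∈ R}, regularMixing R W i j • halfStep g α η (ξ t) s j ω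
        + ((byzError R W g α η μ ℱ t (ξ t) (byz t) s i ω
            + clipBias μ R W f g α η (ξ t) i (pastData R W g α η μ ℱ t (ξ t) s ω))
          + centeredClipError μ (regularWeight R W) (fun i => byzWeight R W i) radiusPart
            (driftPart f α η) (noisePart f g α η) (samples R (ξ t)) i
            (pastData R W g α η μ ℱ t (ξ t) s ω) (samples R (ξ t) ω)) := by
  have h1 : ∑ j ∈ R, W i j • clippedMsg R W g α η μ ℱ t (ξ t) (byz t) s j i ω
      = ∑ j : {j // j ∈ R}, W i j • halfStep g α η (ξ t) s j ω
        + regularClipError (regularWeight R W) (fun i => byzWeight R W i)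
          (fun i => clipRadius R W g α η μ ℱ t (ξ t) s i ω)
          (fun k => halfStep g α η (ξ t) s k ω) i := by
    rw [← Finset.sum_coe_sort, regularClipError, ← Finset.sum_add_distrib]
    refine Finset.sum_congr rfl fun j _ => ?_
    rw [clippedMsg_of_mem j.2, smul_add]
    rfl
  -- Byzantine messages are measured relative to the receiver's own half step. This puts the weight
  -- δ_i on the diagonal and produces W̃.
  have h2 : ∑ j ∈ Rᶜ, W i j • clippedMsg R W g α η μ ℱ t (ξ t) (byz t) s j i ω
      = byzError R W g α η μ ℱ t (ξ t) (byz t) s i ω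
        + byzWeight R W i • halfStep g α η (ξ t) s i ω := by
    simp only [byzError, byzWeight, smul_sub, Finset.sum_sub_distrib, Finset.sum_smul]
    abel
  have h3 : ∑ j : {j // j ∈ R}, regularMixing R W i j • halfStep g α η (ξ t) s j ω
      = ∑ j : {j // j ∈ R}, W i j • halfStep g α η (ξ t) s j ω
        + byzWeight R W i • halfStep g α η (ξ t) s i ω := by
    simp [regularMixing, add_smul, Finset.sum_add_distrib, ite_smul]
  have h4 : (fun k : {k // k ∈ R} => driftPart f α η k (pastData R W g α η μ ℱ t (ξ t) s ω)
      + noisePart f g α η k (pastData R W g α η μ ℱ t (ξ t) s ω) (samples R (ξ t) ω k))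
      = fun k : {k // k ∈ R} => halfStep g α η (ξ t) s k ω := by
    ext1 k
    rw [halfStep_eq (f := f) (R := R) (W := W) (μ := μ) (ℱ := ℱ)]
  rw [← Finset.sum_add_sum_compl R, h1, h2, h3, centeredClipError, clipBias, h4,
    radiusPart_pastData]
  abel

omit [MeasurableSpace S] [IsProbabilityMeasure μ] in
theorem measurable_pastData (hs : IsSquareIntegrable R μ (ℱ t) s) :
    Measurable[ℱ t] (pastData R W g α η μ ℱ t (ξ t) s) :=
  measurable_triple (u := fun (i : {i // i ∈ R}) => s.x i) (v := fun (i : {i // i ∈ R}) => s.m i)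
    (w := fun (i : {i // i ∈ R}) => clipRadius R W g α η μ ℱ t (ξ t) s i)
    (fun i => hs.x_measurable i i.2) (fun i => hs.m_measurable i i.2)
    (fun _ => measurable_clipRadius _)

omit [Fintype V] [DecidableEq V] in
theorem measurable_radiusPart (i : {i // i ∈ R}) :
    Measurable fun y : PastData R d => radiusPart y i :=
  continuous_abs.measurable.comp
    ((measurable_pi_apply i).comp (measurable_snd.comp measurable_snd))

omit [Fintype V] [DecidableEq V] in
theorem measurable_driftPart (hL : 0 < L) (hp : IsProblem R f g D L σ ζ) (i : {i // i ∈ R}) :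
    Measurable (driftPart (R := R) f α η i) := by
  have h1 : Measurable fun y : PastData R d => y.1 i :=
    (measurable_pi_apply i).comp measurable_fst
  have h2 : Measurable fun y : PastData R d => y.2.1 i :=
    (measurable_pi_apply i).comp (measurable_fst.comp measurable_snd)
  exact h1.sub (((h2.const_smul (1 - α)).add
    (((hp.measurable_gradient hL i.2).comp h1).const_smul α)).const_smul η)

omit [Fintype V] [DecidableEq V] in
theorem measurable_noisePart (hL : 0 < L) (hp : IsProblem R f g D L σ ζ) (i : {i // i ∈ R}) :
    Measurable (Function.uncurry (noisePart (R := R) f g α η i)) := by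
  have h1 : Measurable fun y : PastData R d × S => (y.1.1 i, y.2) :=
    ((measurable_pi_apply i).comp (measurable_fst.comp measurable_fst)).prodMk measurable_snd
  exact ((measurable_noise hL hp i.2).comp h1).const_smul (-(η * α))

omit [Fintype V] [DecidableEq V] in
theorem noisePart_frozen (hp : IsProblem R f g D L σ ζ) (he : IsExecution R D μ ℱ ξ byz) (t : ℕ)
    (i : {i // i ∈ R}) (y : PastData R d) :
    MemLp (fun ω => noisePart f g α η i y (samples R (ξ t) ω i)) 2 μ ∧
      ∫ ω, noisePart f g α η i y (samples R (ξ t) ω i) ∂μ = 0 ∧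
      ∫ ω, ‖noisePart f g α η i y (samples R (ξ t) ω i)‖ ^ 2 ∂μ ≤ η ^ 2 * α ^ 2 * σ ^ 2 := by
  obtain ⟨h1, h2, h3⟩ := noise_frozen hp he t i.2 (y.1 i)
  refine ⟨h1.const_smul (-(η * α)), ?_, ?_⟩
  · simp only [noisePart, samples]
    rw [integral_smul, h2, smul_zero]
  · simp only [noisePart, samples, norm_smul, mul_pow, norm_neg, norm_mul, Real.norm_eq_abs,
      sq_abs]
    rw [integral_const_mul]
    exact mul_le_mul_of_nonneg_left h3 (by positivity)

omit [DecidableEq V] in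
theorem IsNetwork.regularWeight_nonneg (h : IsNetwork G R W) (i j : {i // i ∈ R}) :
    0 ≤ regularWeight R W i j := h.nonneg i i.2 j

theorem IsNetwork.sum_regularWeight_le (h : IsNetwork G R W) (i : {i // i ∈ R}) :
    ∑ j, regularWeight R W i j ≤ 1 := by
  have := h.sum_add_byzWeight i.2
  have h0 := h.byzWeight_nonneg i.2
  simp only [regularWeight]
  linarith

omit [DecidableEq V] in
theorem IsNetwork.regularWeight_symm (h : IsNetwork G R W) (i j : {i // i ∈ R}) :
    regularWeight R W i j = regularWeight R W j i := h.symm i i.2 j j.2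

/-- The radius is defined by conditional expectations, while the bias estimate uses integrals over
fresh samples with frozen past; both agree almost surely. -/
theorem condExp_norm_halfStep_sub_sq (hL : 0 < L) (hp : IsProblem R f g D L σ ζ)
    (he : IsExecution R D μ ℱ ξ byz) (hs : IsSquareIntegrable R μ (ℱ t) s) (i j : {i // i ∈ R}) :
    μ[fun ω' => ‖halfStep g α η (ξ t) s i ω' - halfStep g α η (ξ t) s j ω'‖ ^ 2 | ℱ t]
      =ᵐ[μ] fun ω =>
        ∫ ω', ‖(driftPart f α η i (pastData R W g α η μ ℱ t (ξ t) s ω)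
        + noisePart f g α η i (pastData R W g α η μ ℱ t (ξ t) s ω) (samples R (ξ t) ω' i))
        - (driftPart f α η j (pastData R W g α η μ ℱ t (ξ t) s ω)
        + noisePart f g α η j (pastData R W g α η μ ℱ t (ξ t) s ω) (samples R (ξ t) ω' j))‖ ^ 2
          ∂μ := by
  have hX := measurable_pastData (W := W) (g := g) (α := α) (η := η) (ξ := ξ) hs
  have hm : ∀ k : {k // k ∈ R}, Measurable
      fun v : PastData R d × ({k // k ∈ R} → S) =>
        driftPart f α η k v.1 + noisePart f g α η k v.1 (v.2 k) := fun k =>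
    ((measurable_driftPart hL hp k).comp measurable_fst).add
      ((measurable_noisePart hL hp k).comp
        (measurable_fst.prodMk ((measurable_pi_apply k).comp measurable_snd)))
  have hint : Integrable (fun ω =>
      ‖halfStep g α η (ξ t) s i ω - halfStep g α η (ξ t) s j ω‖ ^ 2) μ :=
    memLp_two_integrable_sq ((memLp_halfStep hL hp he hs i.2).sub (memLp_halfStep hL hp he hs j.2))
  have e : (fun ω => ‖halfStep g α η (ξ t) s i ω - halfStep g α η (ξ t) s j ω‖ ^ 2)
      = fun ω => (fun (y : PastData R d) (a : {k // k ∈ R} → S) =>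
        ‖(driftPart f α η i y + noisePart f g α η i y (a i))
        - (driftPart f α η j y + noisePart f g α η j y (a j))‖ ^ 2)
        (pastData R W g α η μ ℱ t (ξ t) s ω) (samples R (ξ t) ω) := by
    ext1 ω
    rw [halfStep_eq (f := f) (R := R) (W := W) (μ := μ) (ℱ := ℱ) ω i,
      halfStep_eq (f := f) (R := R) (W := W) (μ := μ) (ℱ := ℱ) ω j]
  rw [e] at hint ⊢
  exact condExp_frozen (f := fun (y : PastData R d) (a : {k // k ∈ R} → S) =>
        ‖(driftPart f α η i y + noisePart f g α η i y (a i))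
        - (driftPart f α η j y + noisePart f g α η j y (a j))‖ ^ 2)
    (ℱ.le t) hX (he.measurable_samples t) (he.indep_samples t)
    (((hm i).sub (hm j)).norm.pow_const 2) hint

/-- For a frozen past, the hypothesis that ties second moments to δ_i τ_i² in
`norm_integral_regularClipError_le` is precisely the definition of the radius. -/
theorem norm_clipBias_le (h : IsNetwork G R W) (hL : 0 < L) (hp : IsProblem R f g D L σ ζ)
    (he : IsExecution R D μ ℱ ξ byz) (hs : IsSquareIntegrable R μ (ℱ t) s) (i : {i // i ∈ R}) :
    ∀ᵐ ω ∂μ, ‖clipBias μ R W f g α η (ξ t) i (pastData R W g α η μ ℱ t (ξ t) s ω)‖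
      ≤ byzWeight R W i * clipRadius R W g α η μ ℱ t (ξ t) s i ω := by
  have h1 : ∀ᵐ ω ∂μ, ∀ j : {j // j ∈ R},
      (μ[fun ω' => ‖halfStep g α η (ξ t) s i ω' - halfStep g α η (ξ t) s j ω'‖ ^ 2 | ℱ t]) ω
      = ∫ ω', ‖(driftPart f α η i (pastData R W g α η μ ℱ t (ξ t) s ω)
        + noisePart f g α η i (pastData R W g α η μ ℱ t (ξ t) s ω) (samples R (ξ t) ω' i))
        - (driftPart f α η j (pastData R W g α η μ ℱ t (ξ t) s ω)
        + noisePart f g α η j (pastData R W g α η μ ℱ t (ξ t) s ω) (samples R (ξ t) ω' j))‖ ^ 2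
          ∂μ := by
    rw [ae_all_iff]
    exact fun j => condExp_norm_halfStep_sub_sq hL hp he hs i j
  filter_upwards [h1, clipRadius_sq (g := g) (α := α) (η := η) (ξ := ξ) (ℱ := ℱ) (μ := μ) (t := t)
    (s := s) h i.2] with ω hω1 hω2
  have h3 := norm_integral_regularClipError_le (μ := μ) (w := regularWeight R W)
    (δ := fun i : {i // i ∈ R} => byzWeight R W i)
    (T := radiusPart (pastData R W g α η μ ℱ t (ξ t) s ω))
    (p := fun k => driftPart f α η k (pastData R W g α η μ ℱ t (ξ t) s ω))
    (Q := fun k ω' => noisePart f g α η k (pastData R W g α η μ ℱ t (ξ t) s ω)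
      (samples R (ξ t) ω' k)) h.regularWeight_nonneg h.sum_regularWeight_le
    (fun i => abs_nonneg _)
    (fun k => (measurable_noisePart hL hp k).comp (measurable_const.prodMk
      ((measurable_pi_apply k).comp (he.measurable_samples t))))
    (fun k => (noisePart_frozen hp he t k _).1) i ?_
  · rw [clipBias]
    rw [radiusPart_pastData] at h3 ⊢
    exact h3
  · intro hδ
    rw [radiusPart_pastData]
    simp only [← hω1, regularWeight]
    rw [hω2]
    field_simp

theorem IsNetwork.weight_eq_zero (h : IsNetwork G R W) {i : V} (hi : i ∈ R)
    (h0 : byzWeight R W i = 0) {j : V} (hj : j ∈ Rᶜ) : W i j = 0 :=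
  (Finset.sum_eq_zero_iff_of_nonneg fun j _ => h.nonneg i hi j).1 h0 j hj

omit [MeasurableSpace S] [IsProbabilityMeasure μ] in
theorem norm_byzError_le (h : IsNetwork G R W) {i : V} (hi : i ∈ R) (ω : Ω) :
    ‖byzError R W g α η μ ℱ t (ξ t) (byz t) s i ω‖
      ≤ byzWeight R W i * clipRadius R W g α η μ ℱ t (ξ t) s i ω := by
  -- An unclipped Byzantine message may be arbitrarily large, but all these weights are then zero.
  by_cases h0 : byzWeight R W i = 0
  · rw [byzError, Finset.sum_eq_zero fun j hj => by rw [h.weight_eq_zero hi h0 hj, zero_smul]]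
    simp [h0]
  · rw [byzError, byzWeight, Finset.sum_mul]
    refine norm_sum_le_of_le _ fun j _ => ?_
    rw [norm_smul, Real.norm_of_nonneg (h.nonneg i hi j)]
    refine mul_le_mul_of_nonneg_left ?_ (h.nonneg i hi j)
    rw [clippedMsg, if_neg h0, add_sub_cancel_left]
    exact norm_clip_le (clipRadius_nonneg _ _) _

omit [IsProbabilityMeasure μ] in
theorem measurable_clippedMsg (hp : IsProblem R f g D L σ ζ)
    (he : IsExecution R D μ ℱ ξ byz) (hs : IsSquareIntegrable R μ (ℱ t) s) {i : V} (hi : i ∈ R)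
    (j : V) : Measurable[ℱ (t + 1)] (clippedMsg R W g α η μ ℱ t (ξ t) (byz t) s j i) := by
  have h1 : Measurable[ℱ (t + 1)] (received R g α η (ξ t) (byz t) s j i) := by
    unfold received
    split_ifs with hj
    · exact measurable_halfStep hp he hs hj
    · exact he.byz_measurable t j hj i hi
  unfold clippedMsg
  split_ifs
  · exact h1
  · have h2 := measurable_halfStep (α := α) (η := η) hp he hs hi
    have h3 : Measurable[ℱ (t + 1)] (clipRadius R W g α η μ ℱ t (ξ t) s i) :=
      (measurable_clipRadius i).mono (ℱ.mono (Nat.le_succ t)) le_rfl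
    exact h2.add (@measurable_clip d Ω (ℱ (t + 1)) _ _ h3 (h1.sub h2))

omit [IsProbabilityMeasure μ] in
theorem memLp_byzError (h : IsNetwork G R W) (hp : IsProblem R f g D L σ ζ)
    (he : IsExecution R D μ ℱ ξ byz) (hs : IsSquareIntegrable R μ (ℱ t) s) {i : V} (hi : i ∈ R) :
    MemLp (byzError R W g α η μ ℱ t (ξ t) (byz t) s i) 2 μ := by
  have hm : Measurable[ℱ (t + 1)] (byzError R W g α η μ ℱ t (ξ t) (byz t) s i) :=
    Finset.measurable_sum _ fun j _ => ((measurable_clippedMsg hp he hs hi j).sub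
      (measurable_halfStep hp he hs hi)).const_smul (W i j)
  refine MemLp.of_le_mul (c := byzWeight R W i)
    (memLp_clipRadius (g := g) (α := α) (η := η) (ξ := ξ) (ℱ := ℱ) (t := t) (s := s) h hi)
    (hm.mono (ℱ.le _) le_rfl).aestronglyMeasurable (Filter.Eventually.of_forall fun ω => ?_)
  rw [Real.norm_of_nonneg (clipRadius_nonneg _ _)]
  exact norm_byzError_le h hi ω

theorem measurable_clipBias (hL : 0 < L) (hp : IsProblem R f g D L σ ζ)
    (he : IsExecution R D μ ℱ ξ byz) (t : ℕ) (i : {i // i ∈ R}) :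
    Measurable (clipBias μ R W f g α η (ξ t) i) :=
  measurable_integral_clipError measurable_radiusPart (measurable_driftPart hL hp)
    (measurable_noisePart hL hp) (he.measurable_samples t) i

theorem memLp_clipBias (h : IsNetwork G R W) (hL : 0 < L) (hp : IsProblem R f g D L σ ζ)
    (he : IsExecution R D μ ℱ ξ byz) (hs : IsSquareIntegrable R μ (ℱ t) s) (i : {i // i ∈ R}) :
    MemLp (fun ω => clipBias μ R W f g α η (ξ t) i (pastData R W g α η μ ℱ t (ξ t) s ω)) 2 μ := by
  refine MemLp.of_le_mul (c := byzWeight R W i)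
    (memLp_clipRadius (g := g) (α := α) (η := η) (ξ := ξ) (ℱ := ℱ) (t := t) (s := s) h i.2)
    ((measurable_clipBias hL hp he t i).comp
      ((measurable_pastData hs).mono (ℱ.le t) le_rfl)).aestronglyMeasurable ?_
  filter_upwards [norm_clipBias_le h hL hp he hs i] with ω hω
  rwa [Real.norm_of_nonneg (clipRadius_nonneg _ _)]

theorem memLp_centeredClipError (h : IsNetwork G R W) (hL : 0 < L) (hp : IsProblem R f g D L σ ζ)
    (he : IsExecution R D μ ℱ ξ byz) (hs : IsSquareIntegrable R μ (ℱ t) s) (i : {i // i ∈ R}) :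
    MemLp (fun ω => centeredClipError μ (regularWeight R W) (fun i => byzWeight R W i) radiusPart
            (driftPart f α η) (noisePart f g α η) (samples R (ξ t)) i
            (pastData R W g α η μ ℱ t (ξ t) s ω) (samples R (ξ t) ω)) 2 μ ∧
      ∫ ω, ‖centeredClipError μ (regularWeight R W) (fun i => byzWeight R W i) radiusPart
            (driftPart f α η) (noisePart f g α η) (samples R (ξ t)) i
            (pastData R W g α η μ ℱ t (ξ t) s ω) (samples R (ξ t) ω)‖ ^ 2 ∂μ
        ≤ 2 * (η ^ 2 * α ^ 2 * σ ^ 2) :=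
  centeredClipError_sq_le h.regularWeight_nonneg h.sum_regularWeight_le
    (fun _ _ => abs_nonneg _) measurable_radiusPart (measurable_driftPart hL hp)
    (measurable_noisePart hL hp) (he.measurable_samples t) (he.sample_indep t)
    (fun i y => (noisePart_frozen hp he t i y).1) (fun i y => (noisePart_frozen hp he t i y).2.1)
    (by positivity) (fun i y => (noisePart_frozen hp he t i y).2.2) (ℱ.le t)
    (measurable_pastData hs) (he.indep_samples t) i

/-- The errors that are not centered are controlled by the disagreement of the workers. -/
theorem sum_integral_bias_sq_le (h : IsNetwork G R W) (hL : 0 < L) (hp : IsProblem R f g D L σ ζ)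
    (he : IsExecution R D μ ℱ ξ byz) (hs : IsSquareIntegrable R μ (ℱ t) s) :
    ∑ i : {i // i ∈ R}, ∫ ω, ‖byzError R W g α η μ ℱ t (ξ t) (byz t) s i ω
        + clipBias μ R W f g α η (ξ t) i (pastData R W g α η μ ℱ t (ξ t) s ω)‖ ^ 2 ∂μ
      ≤ 16 * byzWeightMax R W * ∑ i : {i // i ∈ R},
        ∫ ω, ‖dev (fun k : {k // k ∈ R} => halfStep g α η (ξ t) s k ω) i‖ ^ 2 ∂μ := by
  set a : {i // i ∈ R} → ℝ := fun i =>
    ∫ ω, ‖dev (fun k : {k // k ∈ R} => halfStep g α η (ξ t) s k ω) i‖ ^ 2 ∂μ with ha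
  have ha0 : ∀ i, 0 ≤ a i := fun i => integral_nonneg fun ω => sq_nonneg _
  have hdev : ∀ i : {i // i ∈ R},
      MemLp (fun ω => dev (fun k : {k // k ∈ R} => halfStep g α η (ξ t) s k ω) i) 2 μ := fun i =>
    (memLp_halfStep hL hp he hs i.2).sub ((memLp_finsetSum _ fun (k : {k // k ∈ R}) _ =>
      memLp_halfStep hL hp he hs k.2).const_smul (1 / (Fintype.card {i // i ∈ R} : ℝ)))
  -- Each of the two errors is at most δ_i τ_i, so the square of their sum is at most 4 δ_i² τ_i².
  -- The definition of the radius removes one factor δ_i.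
  have h1 : ∀ i : {i // i ∈ R}, ∫ ω, ‖byzError R W g α η μ ℱ t (ξ t) (byz t) s i ω
        + clipBias μ R W f g α η (ξ t) i (pastData R W g α η μ ℱ t (ξ t) s ω)‖ ^ 2 ∂μ
      ≤ 4 * (byzWeight R W i * ∑ j : {j // j ∈ R}, W i j *
        ∫ ω, ‖halfStep g α η (ξ t) s i ω - halfStep g α η (ξ t) s j ω‖ ^ 2 ∂μ) := by
    intro i
    refine le_trans ?_ (mul_le_mul_of_nonneg_left
      (integral_byzWeight_mul_clipRadius_sq (g := g) (α := α) (η := η) (ξ := ξ) (ℱ := ℱ) (t := t)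
        (μ := μ) (s := s) h i.2) (by norm_num))
    rw [← integral_const_mul]
    refine integral_mono_ae (memLp_two_integrable_sq
      ((memLp_byzError h hp he hs i.2).add (memLp_clipBias h hL hp he hs i))) ?_ ?_
    · exact ((memLp_clipRadius h i.2).const_mul (byzWeight R W i)).integrable_sq.const_mul 4
    · filter_upwards [norm_clipBias_le (α := α) (η := η) h hL hp he hs i] with ω hω
      have h2 := norm_byzError_le (g := g) (α := α) (η := η) (ξ := ξ) (byz := byz) (ℱ := ℱ)
        (t := t) (μ := μ) (s := s) h i.2 ω
      have h3 := (norm_add_le _ _).trans (add_le_add h2 hω)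
      have h4 := pow_le_pow_left₀ (norm_nonneg _) h3 2
      refine h4.trans (le_of_eq ?_)
      ring
  have h2 : ∀ i j : {i // i ∈ R},
      ∫ ω, ‖halfStep g α η (ξ t) s i ω - halfStep g α η (ξ t) s j ω‖ ^ 2 ∂μ
        ≤ 2 * a i + 2 * a j := by
    intro i j
    rw [ha, ← integral_const_mul, ← integral_const_mul, ← integral_add
      ((memLp_two_integrable_sq (hdev i)).const_mul 2)
      ((memLp_two_integrable_sq (hdev j)).const_mul 2)]
    refine integral_mono (memLp_two_integrable_sq
      ((memLp_halfStep hL hp he hs i.2).sub (memLp_halfStep hL hp he hs j.2)))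
      (((memLp_two_integrable_sq (hdev i)).const_mul 2).add
      ((memLp_two_integrable_sq (hdev j)).const_mul 2)) fun ω => ?_
    have e : halfStep g α η (ξ t) s i ω - halfStep g α η (ξ t) s j ω
        = dev (fun k : {k // k ∈ R} => halfStep g α η (ξ t) s k ω) i
          - dev (fun k : {k // k ∈ R} => halfStep g α η (ξ t) s k ω) j := by
      simp only [dev]
      abel
    simp only [e]
    exact norm_sub_sq_le_two _ _
  have hδ0 := h.byzWeightMax_nonneg
  have h3 : ∀ i : {i // i ∈ R}, 4 * (byzWeight R W i * ∑ j : {j // j ∈ R}, W i j *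
        ∫ ω, ‖halfStep g α η (ξ t) s i ω - halfStep g α η (ξ t) s j ω‖ ^ 2 ∂μ)
      ≤ 8 * byzWeightMax R W * (a i + ∑ j : {j // j ∈ R}, regularWeight R W i j * a j) := by
    intro i
    have h4 : ∑ j : {j // j ∈ R}, W i j *
        ∫ ω, ‖halfStep g α η (ξ t) s i ω - halfStep g α η (ξ t) s j ω‖ ^ 2 ∂μ
        ≤ 2 * (a i + ∑ j : {j // j ∈ R}, regularWeight R W i j * a j) := by
      calc _ ≤ ∑ j : {j // j ∈ R}, regularWeight R W i j * (2 * a i + 2 * a j) :=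
            Finset.sum_le_sum fun j _ => mul_le_mul_of_nonneg_left (h2 i j) (h.nonneg i i.2 j)
        _ = 2 * ((∑ j : {j // j ∈ R}, regularWeight R W i j) * a i
            + ∑ j : {j // j ∈ R}, regularWeight R W i j * a j) := by
            rw [mul_add, Finset.sum_mul, Finset.mul_sum, Finset.mul_sum, ← Finset.sum_add_distrib]
            exact Finset.sum_congr rfl fun j _ => by ring
        _ ≤ _ := by
            gcongr
            exact mul_le_of_le_one_left (ha0 i) (h.sum_regularWeight_le i)
    have h5 : 0 ≤ a i + ∑ j : {j // j ∈ R}, regularWeight R W i j * a j :=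
      add_nonneg (ha0 i) (Finset.sum_nonneg fun j _ =>
        mul_nonneg (h.regularWeight_nonneg i j) (ha0 j))
    calc _ ≤ 4 * (byzWeight R W i *
          (2 * (a i + ∑ j : {j // j ∈ R}, regularWeight R W i j * a j))) := by
          have := h.byzWeight_nonneg i.2
          gcongr
      _ ≤ 4 * (byzWeightMax R W *
          (2 * (a i + ∑ j : {j // j ∈ R}, regularWeight R W i j * a j))) := by
          have := byzWeight_le_max (W := W) i.2
          gcongr
      _ = _ := by ring
  calc _ ≤ ∑ i : {i // i ∈ R},
        8 * byzWeightMax R W * (a i + ∑ j : {j // j ∈ R}, regularWeight R W i j * a j) :=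
        Finset.sum_le_sum fun i _ => (h1 i).trans (h3 i)
    _ = 8 * byzWeightMax R W * (∑ i, a i
        + ∑ j, (∑ i : {i // i ∈ R}, regularWeight R W j i) * a j) := by
        rw [← Finset.mul_sum, Finset.sum_add_distrib, Finset.sum_comm]
        simp_rw [Finset.sum_mul, fun i j => h.regularWeight_symm i j]
    _ ≤ 8 * byzWeightMax R W * (∑ i, a i + ∑ j, a j) := by
        gcongr with j
        exact mul_le_of_le_one_left (ha0 j) (h.sum_regularWeight_le j)
    _ = _ := by ring

end Decomposition

end ClippedGossip

end

noncomputable section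

namespace ClippedGossip

/-! ### Passage to the Hilbert space L². -/

section SquareIntegrable

variable {Ω E ι : Type*} [mΩ : MeasurableSpace Ω] {μ : Measure Ω} [NormedAddCommGroup E]
  [InnerProductSpace ℝ E] {u v : Ω → E}

omit [InnerProductSpace ℝ E] in
theorem memLp_fun_add (hu : MemLp u 2 μ) (hv : MemLp v 2 μ) :
    MemLp (fun ω => u ω + v ω) 2 μ := hu.add hv

omit [InnerProductSpace ℝ E] in
theorem memLp_fun_sub (hu : MemLp u 2 μ) (hv : MemLp v 2 μ) :
    MemLp (fun ω => u ω - v ω) 2 μ := hu.sub hv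

theorem memLp_fun_smul (a : ℝ) (hu : MemLp u 2 μ) : MemLp (fun ω => a • u ω) 2 μ :=
  hu.const_smul a

omit [InnerProductSpace ℝ E] in
theorem memLp_fun_sum (s : Finset ι) {u : ι → Ω → E} (hu : ∀ i, MemLp (u i) 2 μ) :
    MemLp (fun ω => ∑ i ∈ s, u i ω) 2 μ := memLp_finsetSum s fun i _ => hu i

open Classical in
/-- A square integrable random vector as a point of the Hilbert space `L²`. -/
def toL2 (μ : Measure Ω) (u : Ω → E) : Lp E 2 μ := if h : MemLp u 2 μ then h.toLp u else 0

omit [InnerProductSpace ℝ E] in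
theorem toL2_eq (h : MemLp u 2 μ) : toL2 μ u = h.toLp u := dif_pos h

omit [InnerProductSpace ℝ E] in
theorem toL2_add (hu : MemLp u 2 μ) (hv : MemLp v 2 μ) :
    toL2 μ (fun ω => u ω + v ω) = toL2 μ u + toL2 μ v := by
  rw [toL2_eq hu, toL2_eq hv, toL2_eq (u := fun ω => u ω + v ω) (hu.add hv)]
  exact MemLp.toLp_add hu hv

omit [InnerProductSpace ℝ E] in
theorem toL2_sub (hu : MemLp u 2 μ) (hv : MemLp v 2 μ) :
    toL2 μ (fun ω => u ω - v ω) = toL2 μ u - toL2 μ v := by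
  rw [toL2_eq hu, toL2_eq hv, toL2_eq (u := fun ω => u ω - v ω) (hu.sub hv)]
  exact MemLp.toLp_sub hu hv

theorem toL2_smul (a : ℝ) (hu : MemLp u 2 μ) :
    toL2 μ (fun ω => a • u ω) = a • toL2 μ u := by
  rw [toL2_eq hu, toL2_eq (u := fun ω => a • u ω) (hu.const_smul a)]
  exact MemLp.toLp_const_smul a hu

omit [InnerProductSpace ℝ E] in
theorem toL2_zero : toL2 μ (fun _ => (0 : E)) = 0 := by
  rw [toL2_eq (u := fun _ => (0 : E)) MemLp.zero]
  exact MemLp.toLp_zero _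

omit [InnerProductSpace ℝ E] in
theorem toL2_sum (s : Finset ι) {u : ι → Ω → E} (hu : ∀ i, MemLp (u i) 2 μ) :
    toL2 μ (fun ω => ∑ i ∈ s, u i ω) = ∑ i ∈ s, toL2 μ (u i) := by
  classical
  induction s using Finset.induction_on with
  | empty => simpa using toL2_zero
  | insert i s hi ih =>
    simp only [Finset.sum_insert hi]
    rw [toL2_add (hu i) (memLp_fun_sum s hu), ih]

theorem memLp_mean [Fintype ι] {u : ι → Ω → E} (hu : ∀ i, MemLp (u i) 2 μ) :
    MemLp (fun ω => mean fun i => u i ω) 2 μ :=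
  (memLp_fun_sum Finset.univ hu).const_smul (1 / (Fintype.card ι : ℝ))

theorem toL2_mean [Fintype ι] {u : ι → Ω → E} (hu : ∀ i, MemLp (u i) 2 μ) :
    toL2 μ (fun ω => mean fun i => u i ω) = mean fun i => toL2 μ (u i) := by
  have h := toL2_smul (1 / (Fintype.card ι : ℝ))
    (memLp_fun_sum Finset.univ hu)
  rw [toL2_sum _ hu] at h
  exact h

theorem memLp_dev [Fintype ι] {u : ι → Ω → E} (hu : ∀ i, MemLp (u i) 2 μ) (i : ι) :
    MemLp (fun ω => dev (fun i => u i ω) i) 2 μ := (hu i).sub (memLp_mean hu)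

theorem toL2_dev [Fintype ι] {u : ι → Ω → E} (hu : ∀ i, MemLp (u i) 2 μ) (i : ι) :
    toL2 μ (fun ω => dev (fun i => u i ω) i) = dev (fun i => toL2 μ (u i)) i := by
  rw [dev, ← toL2_mean hu, ← toL2_sub (hu i) (memLp_mean hu)]
  simp only [dev]

theorem toL2_sum_smul_add [Fintype ι] (a : ι → ℝ) {y : ι → Ω → E} {w : Ω → E}
    (hy : ∀ i, MemLp (y i) 2 μ) (hu : MemLp u 2 μ) (hv : MemLp v 2 μ)
    (hw : ∀ ω, w ω = ∑ i, a i • y i ω + (u ω + v ω)) :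
    toL2 μ w = ∑ i, a i • toL2 μ (y i) + (toL2 μ u + toL2 μ v) := by
  have hay := fun i => memLp_fun_smul (a i) (hy i)
  simp_rw [← toL2_smul _ (hy _)]
  rw [← toL2_sum _ hay, ← toL2_add hu hv,
    ← toL2_add (memLp_fun_sum Finset.univ hay) (memLp_fun_add hu hv)]
  congr 1
  ext1 ω
  exact hw ω

theorem toL2_smul_add_smul (a b : ℝ) {w z : Ω → E} (hu : MemLp u 2 μ) (hv : MemLp v 2 μ)
    (hw : MemLp w 2 μ) (hz : ∀ ω, z ω = a • u ω + b • (v ω + w ω)) :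
    toL2 μ z = a • toL2 μ u + b • (toL2 μ v + toL2 μ w) := by
  have hvw := memLp_fun_add hv hw
  rw [← toL2_add hv hw, ← toL2_smul _ hu, ← toL2_smul _ hvw,
    ← toL2_add (memLp_fun_smul _ hu) (memLp_fun_smul _ hvw)]
  congr 1
  ext1 ω
  exact hz ω

theorem inner_toL2 (hu : MemLp u 2 μ) (hv : MemLp v 2 μ) :
    inner ℝ (toL2 μ u) (toL2 μ v) = ∫ ω, inner ℝ (u ω) (v ω) ∂μ := by
  rw [toL2_eq hu, toL2_eq hv, L2.inner_def]
  refine integral_congr_ae ?_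
  filter_upwards [hu.coeFn_toLp, hv.coeFn_toLp] with ω h1 h2
  rw [h1, h2]

theorem norm_toL2_sq (hu : MemLp u 2 μ) : ‖toL2 μ u‖ ^ 2 = ∫ ω, ‖u ω‖ ^ 2 ∂μ := by
  rw [← real_inner_self_eq_norm_sq, inner_toL2 hu hu]
  simp_rw [real_inner_self_eq_norm_sq]

omit [InnerProductSpace ℝ E] in
theorem norm_toL2_le (hu : MemLp u 2 μ) (hv : MemLp v 2 μ) {a : ℝ}
    (h : ∀ ω, ‖u ω‖ ≤ a * ‖v ω‖) : ‖toL2 μ u‖ ≤ a * ‖toL2 μ v‖ := by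
  rw [toL2_eq hu, toL2_eq hv]
  refine Lp.norm_le_mul_norm_of_ae_le_mul ?_
  filter_upwards [hu.coeFn_toLp, hv.coeFn_toLp] with ω h1 h2
  rw [h1, h2]
  exact h ω

end SquareIntegrable

section PastSpace

variable {Ω : Type*} {m : MeasurableSpace Ω} [mΩ : MeasurableSpace Ω] {μ : Measure Ω} {d : ℕ}

/-- The square integrable random vectors that are known given `m`. -/
def pastSpace {Ω : Type*} (m : MeasurableSpace Ω) [mΩ : MeasurableSpace Ω] (μ : Measure Ω) (d : ℕ) :
    Submodule ℝ (Lp (EuclideanSpace ℝ (Fin d)) 2 μ) where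
  carrier := {k | ∃ u : Ω → EuclideanSpace ℝ (Fin d), Measurable[m] u ∧ MemLp u 2 μ ∧ toL2 μ u = k}
  add_mem' := by
    rintro _ _ ⟨u, hu, hu2, rfl⟩ ⟨v, hv, hv2, rfl⟩
    exact ⟨_, hu.add hv, hu2.add hv2, toL2_add hu2 hv2⟩
  zero_mem' := ⟨_, measurable_const, MemLp.zero, toL2_zero⟩
  smul_mem' := by
    rintro a _ ⟨u, hu, hu2, rfl⟩
    exact ⟨_, hu.const_smul a, hu2.const_smul a, toL2_smul a hu2⟩

theorem toL2_mem_pastSpace {u : Ω → EuclideanSpace ℝ (Fin d)}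
    (hu : Measurable[m] u) (hu2 : MemLp u 2 μ) : toL2 μ u ∈ pastSpace m μ d := ⟨u, hu, hu2, rfl⟩

end PastSpace

/-! ### The iterates as a perturbed gossip process. -/

section Iterates

variable {V S Ω : Type*} [Fintype V] [DecidableEq V] [MeasurableSpace S] [mΩ : MeasurableSpace Ω]
  {d : ℕ} {G : SimpleGraph V} {R : Finset V} {W : V → V → ℝ}
  {f : V → EuclideanSpace ℝ (Fin d) → ℝ}
  {g : V → EuclideanSpace ℝ (Fin d) → S → EuclideanSpace ℝ (Fin d)}
  {D : V → Measure S} {L σ ζ : ℝ} {μ : Measure Ω} [IsProbabilityMeasure μ] {ℱ : Filtration ℕ mΩ}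
  {ξ : ℕ → V → Ω → S} {byz : ℕ → V → V → Ω → EuclideanSpace ℝ (Fin d)} {α η : ℝ}
  {x₀ : EuclideanSpace ℝ (Fin d)} {s : ℕ → State V Ω d}

omit [Fintype V] [DecidableEq V] mΩ in
theorem avgModel_eq_mean (s : State V Ω d) (ω : Ω) :
    avgModel R s ω = mean fun i : {i // i ∈ R} => s.x i ω := by
  rw [avgModel, mean, Fintype.card_coe, ← Finset.sum_coe_sort]

omit [Fintype V] [DecidableEq V] in
theorem IsProblem.gradient_avgObjective_eq_mean (hp : IsProblem R f g D L σ ζ)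
    (x : EuclideanSpace ℝ (Fin d)) :
    gradient (avgObjective R f) x = mean fun i : {i // i ∈ R} => gradient (f i) x := by
  rw [hp.gradient_avgObjective, mean, Fintype.card_coe, ← Finset.sum_coe_sort]

/-- Byzantine messages need not be integrable, so integrability of the new model is read off from
the decomposition of the step, where each part has a finite second moment. -/
theorem isSquareIntegrable_iterates (h : IsNetwork G R W) (hL : 0 < L)
    (hp : IsProblem R f g D L σ ζ) (he : IsExecution R D μ ℱ ξ byz) (t : ℕ) :
    IsSquareIntegrable R μ (ℱ t) (iterates R W g α η x₀ μ ℱ ξ byz t) := by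
  induction t with
  | zero => exact ⟨fun _ _ => measurable_const, fun _ _ => measurable_const,
      fun _ _ => memLp_const _, fun _ _ => memLp_const _⟩
  | succ t hs =>
    refine ⟨fun i hi => ?_, fun i hi => measurable_nextMomentum hp he hs hi, fun i hi => ?_,
      fun i hi => memLp_nextMomentum hL hp he hs hi⟩
    · exact Finset.measurable_sum _ fun j _ =>
        (measurable_clippedMsg hp he hs hi j).const_smul (W i j)
    · have h1 := (memLp_finsetSum (Finset.univ : Finset {j // j ∈ R}) fun j _ =>
        (memLp_halfStep (α := α) (η := η) hL hp he hs j.2).const_smul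
          (regularMixing R W ⟨i, hi⟩ j)).add
        (((memLp_byzError (α := α) (η := η) h hp he hs hi).add
          (memLp_clipBias (α := α) (η := η) h hL hp he hs ⟨i, hi⟩)).add
          (memLp_centeredClipError (α := α) (η := η) h hL hp he hs ⟨i, hi⟩).1)
      refine h1.ae_eq (Filter.Eventually.of_forall fun ω => ?_)
      exact (sum_clippedMsg_eq ⟨i, hi⟩ ω).symm

omit [Fintype V] [DecidableEq V] [IsProbabilityMeasure μ] in
theorem memLp_avgModel {s : State V Ω d}
    (hs : ∀ i ∈ R, MemLp (s.x i) 2 μ) : MemLp (avgModel R s) 2 μ :=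
  (memLp_finsetSum R hs).const_smul (1 / (R.card : ℝ))

omit [Fintype V] [DecidableEq V] in
theorem measurable_avgModel {Ω : Type*} {m : MeasurableSpace Ω} {s : State V Ω d}
    (hs : ∀ i ∈ R, Measurable (s.x i)) : Measurable (avgModel R s) := by
  unfold avgModel
  exact (Finset.measurable_sum R hs).const_smul (1 / (R.card : ℝ))

/-- The iterates, as sequences in the Hilbert space of square integrable random vectors. -/
theorem isPerturbedGossip_iterates (h : IsNetwork G R W) (hL : 0 < L)
    (hp : IsProblem R f g D L σ ζ) (he : IsExecution R D μ ℱ ξ byz)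
    (hs : s = iterates R W g α η x₀ μ ℱ ξ byz) :
    IsPerturbedGossip (regularMixing R W) (spectralGap R W) (byzWeightMax R W) L σ ζ α η
      (fun t => pastSpace (ℱ t) μ d)
      (fun t i => toL2 μ ((s t).x i)) (fun t i => toL2 μ ((s t).m i))
      (fun t i => toL2 μ fun ω => gradient (f i) ((s t).x i ω))
      (fun t i => toL2 μ fun ω => gradient (f i) (avgModel R (s t) ω))
      (fun t i => toL2 μ (gradNoise f g (ξ t) (s t) i))
      (fun t i => toL2 μ fun ω => byzError R W g α η μ ℱ t (ξ t) (byz t) (s t) i ω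
        + clipBias μ R W f g α η (ξ t) i (pastData R W g α η μ ℱ t (ξ t) (s t) ω))
      (fun t i => toL2 μ fun ω => centeredClipError μ (regularWeight R W)
        (fun i => byzWeight R W i) radiusPart (driftPart f α η) (noisePart f g α η)
        (samples R (ξ t)) i (pastData R W g α η μ ℱ t (ξ t) (s t) ω) (samples R (ξ t) ω))
      (fun t => toL2 μ fun ω => gradient (avgObjective R f) (avgModel R (s t) ω)) := by
  have hne := h.nonempty
  have hsq : ∀ t, IsSquareIntegrable R μ (ℱ t) (s t) := by
    intro t
    rw [hs]
    exact isSquareIntegrable_iterates h hL hp he t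
  have hx1 : ∀ t i ω, (s (t + 1)).x i ω
      = ∑ j, W i j • clippedMsg R W g α η μ ℱ t (ξ t) (byz t) (s t) j i ω := by
    intro t i ω
    rw [hs]
    rfl
  have hm1 : ∀ t i, (s (t + 1)).m i = nextMomentum g α (ξ t) (s t) i := by
    intro t i
    rw [hs]
    rfl
  have hx : ∀ t (i : {i // i ∈ R}), MemLp ((s t).x i) 2 μ := fun t i => (hsq t).x_memLp i i.2
  have hm : ∀ t (i : {i // i ∈ R}), MemLp ((s t).m i) 2 μ := fun t i => (hsq t).m_memLp i i.2
  have hg : ∀ t (i : {i // i ∈ R}), MemLp (fun ω => gradient (f i) ((s t).x i ω)) 2 μ :=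
    fun t i => memLp_gradient hL hp (hsq t) i.2
  have ha : ∀ t, MemLp (avgModel R (s t)) 2 μ := fun t =>
    (memLp_finsetSum R fun i hi => (hsq t).x_memLp i hi).const_smul (1 / (R.card : ℝ))
  have hh : ∀ t (i : {i // i ∈ R}), MemLp (fun ω => gradient (f i) (avgModel R (s t) ω)) 2 μ :=
    fun t i => memLp_two_lipschitz_comp hL.le (hp.smooth i i.2) (ha t)
  have hN : ∀ t (i : {i // i ∈ R}), MemLp (gradNoise f g (ξ t) (s t) i) 2 μ :=
    fun t i => (gradNoise_sq hL hp he (hsq t) i.2).1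
  have hy : ∀ t (i : {i // i ∈ R}), MemLp (halfStep g α η (ξ t) (s t) i) 2 μ :=
    fun t i => memLp_halfStep hL hp he (hsq t) i.2
  have hb := fun t (i : {i // i ∈ R}) => memLp_fun_add
    (memLp_byzError (α := α) (η := η) h hp he (hsq t) i.2) (memLp_clipBias (α := α) (η := η) h hL hp he (hsq t) i)
  have hc := fun t i => memLp_centeredClipError (α := α) (η := η) h hL hp he (hsq t) i
  have hf : ∀ t, MemLp (fun ω => gradient (avgObjective R f) (avgModel R (s t) ω)) 2 μ :=
    fun t => memLp_two_lipschitz_comp hL.le (hp.smooth_avgObjective hL) (ha t)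
  have hfm : ∀ t, Measurable[ℱ t]
      fun ω => gradient (avgObjective R f) (avgModel R (s t) ω) := fun t =>
    (continuous_of_norm_sub_le hL.le (hp.smooth_avgObjective hL)).measurable.comp
      (measurable_avgModel (hsq t).x_measurable)
  have hyL : ∀ t (i : {i // i ∈ R}), toL2 μ ((s t).x i) - η • toL2 μ ((s (t + 1)).m i)
      = toL2 μ (halfStep g α η (ξ t) (s t) i) := by
    intro t i
    rw [← toL2_smul _ (hm (t + 1) i), ← toL2_sub (hx t i) (memLp_fun_smul η (hm (t + 1) i)), hm1]
    rfl
  have hxbar : ∀ t, mean (fun i : {i // i ∈ R} => toL2 μ ((s t).x i))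
      = toL2 μ (avgModel R (s t)) := by
    intro t
    rw [← toL2_mean (hx t)]
    congr 1
    ext1 ω
    exact (avgModel_eq_mean (s t) ω).symm
  refine
    { row_sum := h.sum_regularMixing
      col_sum := fun j => ?_
      contraction := sum_norm_sq_regularMixing_le
      x_zero := fun i j => by rw [hs]; rfl
      m_zero := fun i => by rw [hs]; exact toL2_zero
      m_succ := fun t i => ?_
      x_succ := fun t i => ?_
      m_mem := fun t i => toL2_mem_pastSpace ((hsq t).m_measurable i i.2) (hm t i)
      gl_mem := fun t i => toL2_mem_pastSpace
        ((hp.measurable_gradient hL i.2).comp ((hsq t).x_measurable i i.2)) (hg t i)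
      h_mem := fun t => toL2_mem_pastSpace (hfm t) (hf t)
      noise_orthogonal := ?_
      noise_pairwise := fun t i j hij => ?_
      noise_sq := fun t i => ?_
      c_orthogonal := fun t => ?_
      c_sq := fun t i => ?_
      c_mean_sq := fun t => ?_
      b_sq := fun t => ?_
      smooth := fun t i => ?_
      mean_hl := fun t => ?_
      heterogeneity := fun t => ?_
      h_lipschitz := fun t => ?_ }
  · simp_rw [fun i => h.regularMixing_symm i j]
    exact h.sum_regularMixing j
  · rw [hm1]
    exact toL2_smul_add_smul (1 - α) α (hm t i) (hg t i) (hN t i) fun ω =>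
      nextMomentum_eq (f := f) (g := g) (ξ := ξ) (s := s t) ω i
  · simp_rw [hyL]
    refine toL2_sum_smul_add (regularMixing R W i) (hy t) (hb t i) (hc t i).1 fun ω => ?_
    rw [hx1]
    exact sum_clippedMsg_eq i ω
  · rintro t i _ ⟨u, hu, hu2, rfl⟩
    rw [inner_toL2 hu2 (hN t i)]
    exact integral_inner_gradNoise hL hp he (hsq t) i.2 hu hu2
  · rw [inner_toL2 (hN t i) (hN t j)]
    exact integral_inner_gradNoise_pair hL hp he (hsq t) i.2 j.2 fun e => hij (Subtype.ext e)
  · rw [norm_toL2_sq (hN t i)]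
    exact (gradNoise_sq hL hp he (hsq t) i.2).2
  -- ∇f(x̄^t) is known before step t, so it is orthogonal to every centered clipping error.
  · rw [mean, inner_smul_right, inner_sum, Finset.sum_eq_zero, mul_zero]
    intro i _
    rw [inner_toL2 (hf t) (hc t i).1]
    exact integral_inner_centeredClipError h.regularWeight_nonneg h.sum_regularWeight_le
      (fun _ _ => abs_nonneg _) measurable_radiusPart (measurable_driftPart hL hp)
      (measurable_noisePart hL hp) (he.measurable_samples t) (he.sample_indep t)
      (fun i y => (noisePart_frozen hp he t i y).1) (fun i y => (noisePart_frozen hp he t i y).2.1)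
      (by positivity) (fun i y => (noisePart_frozen hp he t i y).2.2) (ℱ.le t)
      (measurable_pastData (hsq t)) (he.indep_samples t) i (hfm t) (hf t)
  · rw [norm_toL2_sq (hc t i).1]
    exact (hc t i).2.trans_eq (by ring)
  · rw [← toL2_mean fun i => (hc t i).1, norm_toL2_sq (memLp_mean fun i => (hc t i).1)]
    refine (mean_centeredClipError_sq_le h.regularWeight_nonneg h.regularWeight_symm
      h.sum_regularWeight_le
      (fun _ _ => abs_nonneg _) measurable_radiusPart (measurable_driftPart hL hp)
      (measurable_noisePart hL hp) (he.measurable_samples t) (he.sample_indep t)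
      (fun i y => (noisePart_frozen hp he t i y).1) (fun i y => (noisePart_frozen hp he t i y).2.1)
      (by positivity) (fun i y => (noisePart_frozen hp he t i y).2.2) (ℱ.le t)
      (measurable_pastData (hsq t)) (he.indep_samples t)).trans_eq ?_
    ring
  · simp_rw [hyL, norm_toL2_sq (hb t _)]
    refine (sum_integral_bias_sq_le h hL hp he (hsq t)).trans_eq ?_
    congr 1
    refine Finset.sum_congr rfl fun i _ => ?_
    rw [← toL2_dev (hy t), norm_toL2_sq (memLp_dev (hy t) i)]
  · rw [← toL2_sub (hg t i) (hh t i), ← toL2_dev (hx t)]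
    refine norm_toL2_le (memLp_fun_sub (hg t i) (hh t i)) (memLp_dev (hx t) i) fun ω => ?_
    rw [avgModel_eq_mean]
    exact hp.smooth i i.2 _ _
  · rw [← toL2_mean (hh t)]
    congr 1
    ext1 ω
    exact (hp.gradient_avgObjective_eq_mean _).symm
  · have hd := memLp_dev (hh t)
    simp_rw [← toL2_dev (hh t), norm_toL2_sq (hd _)]
    rw [← integral_finsetSum _ fun i _ => memLp_two_integrable_sq (hd i)]
    have hc0 : (0 : ℝ) < R.card := by
      have : 0 < Fintype.card {i // i ∈ R} := Fintype.card_pos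
      rw [Fintype.card_coe] at this
      exact_mod_cast this
    refine (integral_mono (integrable_finsetSum _ fun i _ => memLp_two_integrable_sq (hd i))
      (integrable_const (R.card * ζ ^ 2)) fun ω => ?_).trans_eq (by simp)
    have h2 := hp.heterogeneity (avgModel R (s t) ω)
    rw [one_div_mul_eq_div, div_le_iff₀ hc0, ← Finset.sum_coe_sort,
      hp.gradient_avgObjective_eq_mean] at h2
    simp only [dev]
    linarith
  · rw [← toL2_sub (hf (t + 1)) (hf t), hxbar, hxbar, ← toL2_sub (ha (t + 1)) (ha t)]
    exact norm_toL2_le (memLp_fun_sub (hf (t + 1)) (hf t)) (memLp_fun_sub (ha (t + 1)) (ha t)) fun ω =>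
      hp.smooth_avgObjective hL _ _

end Iterates

end ClippedGossip

end

noncomputable section

namespace ClippedGossip

/-! ### Convergence of the algorithm for a given step size. -/

section Convergence

variable {V S Ω : Type*} [Fintype V] [DecidableEq V] [MeasurableSpace S] [mΩ : MeasurableSpace Ω]
  {d : ℕ} {G : SimpleGraph V} {R : Finset V} {W : V → V → ℝ}
  {f : V → EuclideanSpace ℝ (Fin d) → ℝ}
  {g : V → EuclideanSpace ℝ (Fin d) → S → EuclideanSpace ℝ (Fin d)}
  {D : V → Measure S} {L σ ζ : ℝ} {μ : Measure Ω} [IsProbabilityMeasure μ] {ℱ : Filtration ℕ mΩ}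
  {ξ : ℕ → V → Ω → S} {byz : ℕ → V → V → Ω → EuclideanSpace ℝ (Fin d)} {η fstar : ℝ}
  {x₀ : EuclideanSpace ℝ (Fin d)}

-- The objective lies between the constant `fstar` and a quadratic function of X, and X is square
-- integrable.
omit [Fintype V] [DecidableEq V] in
theorem integrable_avgObjective (hL : 0 < L) (hp : IsProblem R f g D L σ ζ)
    (hfs : ∀ x, fstar ≤ avgObjective R f x) {X : Ω → EuclideanSpace ℝ (Fin d)}
    (hX : MemLp X 2 μ) : Integrable (fun ω => avgObjective R f (X ω)) μ := by
  have hc : Continuous (avgObjective R f) := hp.differentiable_avgObjective.continuous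
  refine integrable_of_le_of_le (hc.comp_aestronglyMeasurable hX.1)
    (Filter.Eventually.of_forall fun ω => hfs _)
    (Filter.Eventually.of_forall fun ω => le_quadratic_of_lipschitz_gradient
      hp.differentiable_avgObjective (hp.smooth_avgObjective hL) 0 (X ω))
    (integrable_const _) ?_
  simp only [sub_zero]
  exact ((integrable_const _).add (memLp_two_integrable_inner (memLp_const _) hX)).add
    ((memLp_two_integrable_sq hX).const_mul _)

omit [MeasurableSpace S] [IsProbabilityMeasure μ] in
theorem avgModel_iterates_zero (h : IsNetwork G R W) {α : ℝ} (ω : Ω) :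
    avgModel R (iterates R W g α η x₀ μ ℱ ξ byz 0) ω = x₀ := by
  have := h.nonempty
  rw [avgModel_eq_mean]
  exact mean_const x₀

theorem integrable_norm_gradient_avgModel_sq (h : IsNetwork G R W) (hL : 0 < L)
    (hp : IsProblem R f g D L σ ζ) (he : IsExecution R D μ ℱ ξ byz) {α : ℝ} (t : ℕ) :
    MemLp (fun ω => gradient (avgObjective R f)
      (avgModel R (iterates R W g α η x₀ μ ℱ ξ byz t) ω)) 2 μ :=
  memLp_two_lipschitz_comp hL.le (hp.smooth_avgObjective hL)
    (memLp_avgModel (isSquareIntegrable_iterates h hL hp he t).x_memLp)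

/-- Convergence before the step size is tuned. -/
theorem average_norm_gradient_sq_le (h : IsNetwork G R W) (hL : 0 < L)
    (hp : IsProblem R f g D L σ ζ) (he : IsExecution R D μ ℱ ξ byz)
    (hfs : ∀ x, fstar ≤ avgObjective R f x)
    (hδ : byzWeightMax R W ≤ spectralGap R W ^ 2 / 10240) (hη : 0 < η)
    (hηL : η * L ≤ 3 * spectralGap R W / 40) (T : ℕ) :
    1 / ((T : ℝ) + 1) * ∑ t ∈ Finset.range (T + 1), ∫ ω, ‖gradient (avgObjective R f)
        (avgModel R (iterates R W g (3 * η * L) η x₀ μ ℱ ξ byz t) ω)‖ ^ 2 ∂μ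
      ≤ 3 * (avgObjective R f x₀ - fstar) / (η * (T + 1)) + 9 * η * L * σ ^ 2 / R.card
        + (5040 * byzWeightMax R W / spectralGap R W ^ 2
          + 15 / 2 * (η * L) ^ 2 / spectralGap R W ^ 2) * (ζ ^ 2 + 3 * η * L * σ ^ 2) := by
  have hne := h.nonempty
  set s := iterates R W g (3 * η * L) η x₀ μ ℱ ξ byz with hs
  have P := isPerturbedGossip_iterates h hL hp he hs
  have hsq : ∀ t, IsSquareIntegrable R μ (ℱ t) (s t) :=
    isSquareIntegrable_iterates h hL hp he
  have ha : ∀ t, MemLp (avgModel R (s t)) 2 μ := fun t => memLp_avgModel (hsq t).x_memLp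
  have hg : ∀ t, MemLp (fun ω => gradient (avgObjective R f) (avgModel R (s t) ω)) 2 μ :=
    integrable_norm_gradient_avgModel_sq h hL hp he
  have hf : ∀ t, Integrable (fun ω => avgObjective R f (avgModel R (s t) ω)) μ := fun t =>
    integrable_avgObjective hL hp hfs (ha t)
  have hxbar : ∀ t, mean (fun i : {i // i ∈ R} => toL2 μ ((s t).x i))
      = toL2 μ (avgModel R (s t)) := by
    intro t
    rw [← toL2_mean fun i : {i // i ∈ R} => (hsq t).x_memLp i i.2]
    congr 1
    ext1 ω
    exact (avgModel_eq_mean (s t) ω).symm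
  have h0 : ∫ ω, avgObjective R f (avgModel R (s 0) ω) ∂μ = avgObjective R f x₀ := by
    simp_rw [hs, avgModel_iterates_zero h]
    simp
  -- The pointwise descent lemma integrated over Ω; the expected inner product and square become
  -- those of L².
  have hφ : ∀ t, ∫ ω, avgObjective R f (avgModel R (s (t + 1)) ω) ∂μ
      ≤ ∫ ω, avgObjective R f (avgModel R (s t) ω) ∂μ
        + inner ℝ (toL2 μ fun ω => gradient (avgObjective R f) (avgModel R (s t) ω))
          (mean (fun i : {i // i ∈ R} => toL2 μ ((s (t + 1)).x i))
            - mean (fun i : {i // i ∈ R} => toL2 μ ((s t).x i)))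
        + L / 2 * ‖mean (fun i : {i // i ∈ R} => toL2 μ ((s (t + 1)).x i))
            - mean (fun i : {i // i ∈ R} => toL2 μ ((s t).x i))‖ ^ 2 := by
    intro t
    have hd := memLp_fun_sub (ha (t + 1)) (ha t)
    have i1 := memLp_two_integrable_inner (hg t) hd
    have i2 := (memLp_two_integrable_sq hd).const_mul (L / 2)
    have i3 : Integrable (fun ω => avgObjective R f (avgModel R (s t) ω)
        + inner ℝ (gradient (avgObjective R f) (avgModel R (s t) ω))
          (avgModel R (s (t + 1)) ω - avgModel R (s t) ω)) μ := (hf t).add i1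
    rw [hxbar, hxbar, ← toL2_sub (ha (t + 1)) (ha t), inner_toL2 (hg t) hd, norm_toL2_sq hd,
      ← integral_const_mul, ← integral_add (hf t) i1, ← integral_add i3 i2]
    exact integral_mono (hf (t + 1)) (i3.add i2) fun ω => le_quadratic_of_lipschitz_gradient
      hp.differentiable_avgObjective (hp.smooth_avgObjective hL) _ _
  have hfφ : ∀ t, fstar ≤ ∫ ω, avgObjective R f (avgModel R (s t) ω) ∂μ := by
    intro t
    have := integral_mono (integrable_const fstar) (hf t) fun ω => hfs _
    simpa using this
  have hg0 : ‖toL2 μ fun ω => gradient (avgObjective R f) (avgModel R (s 0) ω)‖ ^ 2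
      ≤ 2 * L * (∫ ω, avgObjective R f (avgModel R (s 0) ω) ∂μ - fstar) := by
    have e : ∫ ω, 2 * L * (avgObjective R f (avgModel R (s 0) ω) - fstar) ∂μ
        = 2 * L * (∫ ω, avgObjective R f (avgModel R (s 0) ω) ∂μ - fstar) := by
      rw [integral_const_mul, integral_sub (hf 0) (integrable_const _)]
      simp
    rw [norm_toL2_sq (hg 0), ← e]
    exact integral_mono (memLp_two_integrable_sq (hg 0))
      (((hf 0).sub (integrable_const _)).const_mul _) fun ω =>
      norm_gradient_sq_le hL hp.differentiable_avgObjective (hp.smooth_avgObjective hL) hfs _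
  have key := IsPerturbedGossip.average_norm_h_sq_le hL h.spectralGap_pos spectralGap_le_one h.byzWeightMax_nonneg
    hδ hη hηL rfl (φ := fun t => ∫ ω, avgObjective R f (avgModel R (s t) ω) ∂μ) (fs := fstar)
    hφ hfφ hg0 P T
  rw [h0, Fintype.card_coe] at key
  simp_rw [norm_toL2_sq (hg _)] at key
  exact key

theorem integral_consensusDist_le (h : IsNetwork G R W) (hL : 0 < L)
    (hp : IsProblem R f g D L σ ζ) (he : IsExecution R D μ ℱ ξ byz)
    (hδ : byzWeightMax R W ≤ spectralGap R W ^ 2 / 10240) (hη : 0 < η)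
    (hηL : η * L ≤ 3 * spectralGap R W / 40) (t : ℕ) :
    Integrable (consensusDist R (iterates R W g (3 * η * L) η x₀ μ ℱ ξ byz t)) μ ∧
      ∫ ω, consensusDist R (iterates R W g (3 * η * L) η x₀ μ ℱ ξ byz t) ω ∂μ
        ≤ 5 * η ^ 2 * (ζ ^ 2 + 3 * η * L * σ ^ 2) / spectralGap R W ^ 2 := by
  have hne := h.nonempty
  set s := iterates R W g (3 * η * L) η x₀ μ ℱ ξ byz with hs
  have P := isPerturbedGossip_iterates h hL hp he hs
  have hx : ∀ i : {i // i ∈ R}, MemLp ((s t).x i) 2 μ := fun i =>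
    (isSquareIntegrable_iterates h hL hp he t).x_memLp i i.2
  have hd := memLp_dev hx
  have e : consensusDist R (s t) = fun ω => (1 / (R.card : ℝ)) *
      ∑ i : {i // i ∈ R}, ‖dev (fun i : {i // i ∈ R} => (s t).x i ω) i‖ ^ 2 := by
    ext1 ω
    rw [consensusDist, avgModel_eq_mean, ← Finset.sum_coe_sort]
    rfl
  have hi : Integrable (fun ω =>
      ∑ i : {i // i ∈ R}, ‖dev (fun i : {i // i ∈ R} => (s t).x i ω) i‖ ^ 2) μ :=
    integrable_finsetSum _ fun i _ => memLp_two_integrable_sq (hd i)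
  have hc0 : (0 : ℝ) < R.card := by
    have : 0 < Fintype.card {i // i ∈ R} := Fintype.card_pos
    rw [Fintype.card_coe] at this
    exact_mod_cast this
  rw [e]
  refine ⟨hi.const_mul _, ?_⟩
  have h1 := (P.consensus_le hL h.spectralGap_pos spectralGap_le_one hδ hη hηL rfl t).1
  simp_rw [← toL2_dev hx, norm_toL2_sq (hd _)] at h1
  rw [Fintype.card_coe] at h1
  rw [integral_const_mul, integral_finsetSum _ fun i _ => memLp_two_integrable_sq (hd i),
    one_div_mul_eq_div, div_le_iff₀ hc0]
  linarith

end Convergence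

end ClippedGossip

end

/-- The order of the quantifiers expresses the dependence of the constants: C precedes γ, δ, ζ,
while the step sizes and the threshold precede the network, the objectives and the adversary. -/
theorem theorem1 (n : ℕ) (L σ r₀ : ℝ) (hL : 0 < L) (hσ : 0 ≤ σ) (hr₀ : 0 < r₀) :
    ∃ C : ℝ, ∀ γ δ ζ : ℝ, 0 ≤ ζ → δ ≤ γ ^ 2 / (64 * 32 * 5) →
    ∃ (η : ℕ → ℝ) (T₀ : ℕ), (∀ T, 0 < η T ∧ 3 * η T * L ≤ 1) ∧
    ∀ {V S Ω : Type*} [Fintype V] [DecidableEq V] [MeasurableSpace S] [mΩ : MeasurableSpace Ω]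
      {d : ℕ} (G : SimpleGraph V) (R : Finset V) (W : V → V → ℝ)
      (f : V → EuclideanSpace ℝ (Fin d) → ℝ)
      (g : V → EuclideanSpace ℝ (Fin d) → S → EuclideanSpace ℝ (Fin d))
      (D : V → Measure S) (x₀ : EuclideanSpace ℝ (Fin d)) (fstar : ℝ)
      (μ : Measure Ω) [IsProbabilityMeasure μ] (ℱ : Filtration ℕ mΩ)
      (ξ : ℕ → V → Ω → S) (byz : ℕ → V → V → Ω → EuclideanSpace ℝ (Fin d)),
      ClippedGossip.IsNetwork G R W →
      R.card = n →
      ClippedGossip.spectralGap R W = γ →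
      ClippedGossip.byzWeightMax R W = δ →
      ClippedGossip.IsProblem R f g D L σ ζ →
      IsGLB (Set.range (ClippedGossip.avgObjective R f)) fstar →
      ClippedGossip.avgObjective R f x₀ - fstar = r₀ →
      ClippedGossip.IsExecution R D μ ℱ ξ byz →
      (∀ T : ℕ,
        let s := ClippedGossip.iterates R W g (3 * η T * L) (η T) x₀ μ ℱ ξ byz
        (∀ t ≤ T, Integrable (fun ω =>
          ‖gradient (ClippedGossip.avgObjective R f) (ClippedGossip.avgModel R (s t) ω)‖ ^ 2) μ) ∧
        (1 / ((T : ℝ) + 1)) * ∑ t ∈ Finset.range (T + 1),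
          ∫ ω, ‖gradient (ClippedGossip.avgObjective R f)
            (ClippedGossip.avgModel R (s t) ω)‖ ^ 2 ∂μ
        ≤ 200 * 32 * 5 / γ ^ 2 * δ * ζ ^ 2
          + 2 * (3 ^ 2 / (n : ℝ) + 320 * 32 * 5 / γ ^ 2 * δ) ^ (1 / 2 : ℝ)
            * (3 * L * σ ^ 2 * r₀ / ((T : ℝ) + 1)) ^ (1 / 2 : ℝ)
          + 2 * (48 * 5 / γ ^ 2 * ζ ^ 2) ^ (1 / 3 : ℝ)
            * (r₀ * L / ((T : ℝ) + 1)) ^ (2 / 3 : ℝ)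
          + 2 * (144 * 5 / γ ^ 2 * σ ^ 2) ^ (1 / 4 : ℝ)
            * (r₀ * L / ((T : ℝ) + 1)) ^ (3 / 4 : ℝ)
          + (40 * L / γ) * r₀ / ((T : ℝ) + 1)) ∧
      (0 < σ → 0 < ζ → ∀ T ≥ T₀,
        let s := ClippedGossip.iterates R W g (3 * η T * L) (η T) x₀ μ ℱ ξ byz
        ∀ t ≤ T + 1,
          Integrable (ClippedGossip.consensusDist R (s t)) μ ∧
          ∫ ω, ClippedGossip.consensusDist R (s t) ω ∂μ
            ≤ C * ζ ^ 2 / (γ ^ 2 * ((T : ℝ) + 1))) := by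
  -- This is 5 · 2 · r₀ n/(3Lσ²): the consensus constant, the doubling ζ² + ασ² ≤ 2ζ² for large T,
  -- and the bound of η² (T+1).
  refine ⟨10 * r₀ * n / (3 * L * σ ^ 2), fun γ δ ζ hζ hδ => ?_⟩
  by_cases hc : 0 < γ ∧ 0 ≤ δ ∧ 0 < n ∧ γ ≤ 1
  swap
  -- Parameters outside this range belong to no network, so any admissible step size will do.
  · refine ⟨fun _ => 1 / (3 * L), 0, fun _ => ⟨by positivity, le_of_eq (by field_simp)⟩, ?_⟩
    intro V S Ω _ _ _ _ d G R W f g D x₀ fstar μ _ ℱ ξ byz hG hn hγ hδ'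
    refine absurd ⟨hγ ▸ hG.spectralGap_pos, hδ' ▸ hG.byzWeightMax_nonneg, ?_,
      hγ ▸ ClippedGossip.spectralGap_le_one⟩ hc
    obtain ⟨i⟩ := hG.nonempty
    exact hn ▸ Finset.card_pos.2 ⟨i, i.2⟩
  obtain ⟨hγ0, hδ0, hn0, hγ1⟩ := hc
  choose η h1 h2 h3 h4 using fun T =>
    ClippedGossip.exists_stepSize (σ := σ) (ζ := ζ) hn0 hL hr₀ hγ0 hδ0 T
  -- The threshold is where the bound of η² makes the noise term ασ² at most ζ².
  refine ⟨η, ⌈3 * L * σ ^ 2 * r₀ * n / ζ ^ 4⌉₊, fun T => ⟨h1 T, by linarith [h2 T]⟩, ?_⟩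
  intro V S Ω _ _ _ _ d G R W f g D x₀ fstar μ _ ℱ ξ byz hG hn hγ hδ' hp hfs hr he
  have hfs' : ∀ x, fstar ≤ ClippedGossip.avgObjective R f x := fun x => hfs.1 ⟨x, rfl⟩
  have hδ'' : ClippedGossip.byzWeightMax R W ≤ ClippedGossip.spectralGap R W ^ 2 / 10240 := by
    rw [hδ', hγ]
    exact hδ.trans_eq (by norm_num)
  have h2' : ∀ T, η T * L ≤ 3 * ClippedGossip.spectralGap R W / 40 := by
    rw [hγ]
    exact h2
  refine ⟨fun T => ⟨fun t _ => ClippedGossip.memLp_two_integrable_sq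
    (ClippedGossip.integrable_norm_gradient_avgModel_sq hG hL hp he t), ?_⟩, fun hσ0 hζ0 T hT => ?_⟩
  · have h5 := ClippedGossip.average_norm_gradient_sq_le (x₀ := x₀) hG hL hp he hfs' hδ'' (h1 T)
      (h2' T) T
    rw [hr, hγ, hδ', hn] at h5
    exact h5.trans (h4 T)
  · intro s t _
    obtain ⟨h5, h6⟩ := ClippedGossip.integral_consensusDist_le (x₀ := x₀) hG hL hp he hδ'' (h1 T)
      (h2' T) t
    refine ⟨h5, h6.trans ?_⟩
    rw [hγ]
    have hT1 : (0 : ℝ) < (T : ℝ) + 1 := by positivity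
    have hn' : (0 : ℝ) < n := by exact_mod_cast hn0
    have hT2 : 3 * L * σ ^ 2 * r₀ * n ≤ ζ ^ 4 * ((T : ℝ) + 1) := by
      have h7 : 3 * L * σ ^ 2 * r₀ * n / ζ ^ 4 ≤ T := (Nat.le_ceil _).trans (by exact_mod_cast hT)
      rw [div_le_iff₀ (by positivity)] at h7
      nlinarith [pow_pos hζ0 4]
    have h8 : 3 * η T * L * σ ^ 2 ≤ ζ ^ 2 := by
      refine (le_abs_self _).trans (abs_le_of_sq_le_sq ?_ (by positivity))
      refine le_of_mul_le_mul_right ?_ hT1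
      calc (3 * η T * L * σ ^ 2) ^ 2 * ((T : ℝ) + 1)
          = 3 * L * σ ^ 2 * (3 * L * σ ^ 2 * η T ^ 2 * (T + 1)) := by ring
        _ ≤ 3 * L * σ ^ 2 * (r₀ * n) := mul_le_mul_of_nonneg_left (h3 T) (by positivity)
        _ ≤ (ζ ^ 2) ^ 2 * ((T : ℝ) + 1) := by linarith
    have h9 : η T ^ 2 ≤ r₀ * n / (3 * L * σ ^ 2 * (T + 1)) := by
      rw [le_div_iff₀ (by positivity)]
      linarith [h3 T]
    have h10 := h1 T
    calc 5 * η T ^ 2 * (ζ ^ 2 + 3 * η T * L * σ ^ 2) / γ ^ 2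
        ≤ 5 * (r₀ * n / (3 * L * σ ^ 2 * (T + 1))) * (ζ ^ 2 + ζ ^ 2) / γ ^ 2 := by gcongr
      _ = _ := by field_simp; ring
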